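/- **Conventions.** A *conic arc* in $\mathbb{RP}^3$ is a regularly parametrized simple arc of a non-degenerate conic lying in a plane. A *supercyclidic patch* (SC-patch) is a map $f:[0,1]^2\to\mathbb{RP}^3$ with a smooth nowhere vanishing homogeneous lift $F$ such that $F,F_u,F_v,F_{uv}$ are everywhere linearly dependent (conjugacy), every parameter line is a conic arc or shrinks to a point (a singular point), and for all but finitely many parameter lines of either family the line is a conic arc along which the tangent planes envelop a quadratic cone; off finitely many parameter lines $F,F_u,F_v$ are linearly independent. The parameter lines are the *characteristic conics*. The *characteristic line* of a family of characteristic conics is the intersection of their supporting planes. An SC-patch is *generic* if its four boundary curves are conic arcs, opposite ones lie in different planes, and its two characteristic lines are disjoint. An *SC-cube* is a combinatorial cube of points in $\mathbb{RP}^3$ with planar faces, together with an SC-patch on each face having the vertices of the face as its vertices, such that the two patches at each edge have the same boundary arc (as a set) there. It is *generic* if its six patches are generic and the planes of opposite faces are different. A closed quadrilateral formed by two pairs of opposite arcs is *non-degenerate* if: the four arcs are conic arcs; opposite arcs lie in different planes, so that each pair determines a line, the intersection of its two planes; these two lines are disjoint; no arc meets the line of the other pair; and arcs meeting the line of their own pair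 occur in at most one of the two pairs. Two parametrized conjugate nets $F,F^+$ over the same domain are *fundamental transforms* of each other if for each net direction the tangents of corresponding parameter lines at corresponding points intersect (that is, $F,\partial_iF,F^+,\partial_iF^+$ are linearly dependent). **Theorem (Properties of SC-cubes).** Let a generic SC-cube be given. *Closing.* For each direction $i$, take one characteristic conic on each of the four faces around the direction $i$, namely conics crossing the boundary arcs of direction $i$. If consecutive conics meet on the common boundary arc at three of the four $i$-edges, they also meet at the fourth. Accordingly the six faces can be smoothly reparametrized in each net direction so that their parametrizations agree on all common edges; for $t\in[0,1]$ the conics with parameter $t$ on the four faces around the direction $i$ then form a closed quadrilateral $R^i_t$. Let $N^i$ be the set of $t\in[0,1]$ for which $R^i_t$ is non-degenerate; it contains $0$ and $1$. *Families.* For $t\in N^i$ there is a generic SC-patch $f^i_t$ with boundary $R^i_t$, and every SC-patch with the same vertices and boundary arcs is obtained from it by changes of parameter in the two net directions. The patches $f^i_0,f^i_1$ are the two (reparametrized) faces opposite in direction $i$, and $f^i_t$ depends smoothly on $t$: there is a smooth map $G^i:\mathbb R^3\to\mathbb R^4$ such that $G^i(t,a,b)$ is a non-zero homogeneous coordinate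 vector of $f^i_t(a,b)$ for all $t\in N^i$, $a,b\in[0,1]$. Let $\mathcal F^i=\{f^i_t: t\in N^i\}$. With suitable parametrizations of all these patches, the following holds. 1. For $\{i,j,k\}=\{1,2,3\}$, the planes of the characteristic conics of direction $i$ of each patch in $\mathcal F^j\cup\mathcal F^k$ have exactly a line $a^i$ in common, and there is a point $q^i$ that lies on the characteristic lines $a^i$ of all patches in $\mathcal F^j\cup\mathcal F^k$. This point is unique, unless the characteristic lines $a^i$ of the four faces around the direction $i$ all coincide. 2. For $i\ne j$, $s\in N^i$ and $t\in N^j$, the patches $f^i_s$ and $f^j_t$ have a common parameter line of their shared net direction: the line of $f^i_s$ with parameter $t$ in direction $j$ and the line of $f^j_t$ with parameter $s$ in direction $i$ coincide pointwise. 3. Any two patches $f^i_s,f^i_t\in\mathcal F^i$ are classical fundamental transforms of each other; in particular this holds for opposite faces of the cube. -/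

import Mathlib

open scoped ContDiff

/-- Homogeneous coordinates of real projective 3-space. -/
abbrev V4 : Type := Fin 4 → ℝ

/-- Real projective 3-space. -/
abbrev RP3 : Type := Projectivization ℝ V4

/-- The parameter interval `[0,1]`. -/
abbrev UI : Set ℝ := Set.Icc (0 : ℝ) 1

/-- The vector `v` is a homogeneous coordinate vector of the point `p`. -/
def Represents (v : V4) (p : RP3) : Prop :=
  ∃ h : v ≠ 0, Projectivization.mk ℝ v h = p

/-- Partial derivatives of a map of two real variables. -/
noncomputable def partial₁ (F : ℝ → ℝ → V4) (u v : ℝ) : V4 := deriv (fun s => F s v) u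

noncomputable def partial₂ (F : ℝ → ℝ → V4) (u v : ℝ) : V4 := deriv (fun s => F u s) v

noncomputable def partial₁₂ (F : ℝ → ℝ → V4) (u v : ℝ) : V4 :=
  deriv (fun s => partial₂ F s v) u

/-- `F` is a smooth homogeneous lift of `f` over the closed unit square
(smooth up to the boundary, i.e. it is given by a map that is smooth on the whole plane). -/
def IsSmoothLift (F : ℝ → ℝ → V4) (f : ℝ → ℝ → RP3) : Prop :=
  ContDiff ℝ ∞ (fun p : ℝ × ℝ => F p.1 p.2) ∧
    ∀ u ∈ UI, ∀ v ∈ UI, Represents (F u v) (f u v)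

/-- The curve `c`, restricted to `[0,1]`, is a regularly parametrized simple arc of a
non-degenerate conic in the plane `W` (a linear subspace of dimension three). -/
def IsConicArc (c : ℝ → RP3) (W : Submodule ℝ V4) : Prop :=
  Module.finrank ℝ W = 3 ∧
  Set.InjOn c UI ∧
  (∃ γ : ℝ → V4, ContDiff ℝ ∞ γ ∧
    ∀ t ∈ UI, Represents (γ t) (c t) ∧ LinearIndependent ℝ ![γ t, deriv γ t]) ∧
  ∃ Q : QuadraticForm ℝ V4,
    (∀ x ∈ W, (∀ y ∈ W, QuadraticMap.polar Q x y = 0) → x = 0) ∧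
    ∀ t ∈ UI, ∀ x ∈ (c t).submodule, x ∈ W ∧ Q x = 0

/-- The curve `c` degenerates to a single point. -/
def IsCollapsed (c : ℝ → RP3) : Prop := ∀ t ∈ UI, c t = c 0

/-- The planes spanned by `γ t`, `γ' t` and `δ t` are the tangent planes, along the curve `γ`,
of one quadratic cone: a quadric whose radical is one point, the apex. -/
def EnvelopQuadraticCone (γ δ : ℝ → V4) : Prop :=
  ∃ K : QuadraticForm ℝ V4,
    Module.finrank ℝ (LinearMap.ker K.polarBilin) = 1 ∧
    ∀ t ∈ UI, K (γ t) = 0 ∧ QuadraticMap.polar K (γ t) (deriv γ t) = 0 ∧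
      QuadraticMap.polar K (γ t) (δ t) = 0

/-- Conjugacy of the parametrization with homogeneous lift `F`: the mixed derivative lies in
the tangent plane. -/
def IsConjugate (F : ℝ → ℝ → V4) : Prop :=
  ∀ u ∈ UI, ∀ v ∈ UI,
    ¬ LinearIndependent ℝ ![F u v, partial₁ F u v, partial₂ F u v, partial₁₂ F u v]

/-- Supercyclidic patches, normalized to the parameter domain `[0,1] × [0,1]`:
conjugate parametrizations by two families of conics, with a quadratic tangent cone along them.
Finitely many parameter lines `S` are exempt from regularity: along such a line the tangent cone
may degenerate to a plane (as along the top circle of a torus), or the line may shrink to a point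
(an isolated singular point of the supercyclide). -/
def IsSCPatch (f : ℝ → ℝ → RP3) : Prop :=
  ∃ F : ℝ → ℝ → V4, IsSmoothLift F f ∧ IsConjugate F ∧
    (∀ u ∈ UI, (∃ W, IsConicArc (fun v => f u v) W) ∨ IsCollapsed (fun v => f u v)) ∧
    (∀ v ∈ UI, (∃ W, IsConicArc (fun u => f u v) W) ∨ IsCollapsed (fun u => f u v)) ∧
    ∃ S : Set ℝ, S.Finite ∧
      (∀ u ∈ UI \ S, ∀ v ∈ UI \ S,
        LinearIndependent ℝ ![F u v, partial₁ F u v, partial₂ F u v]) ∧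
      (∀ u ∈ UI \ S, (∃ W, IsConicArc (fun v => f u v) W) ∧
        EnvelopQuadraticCone (fun v => F u v) (fun v => partial₁ F u v)) ∧
      (∀ v ∈ UI \ S, (∃ W, IsConicArc (fun u => f u v) W) ∧
        EnvelopQuadraticCone (fun u => F u v) (fun u => partial₂ F u v))

/-- The intersection of all planes that support the conics of the family `c t`, `t ∈ [0,1]`.
If these planes form a pencil, it is the axis of the pencil: the characteristic line. -/
noncomputable def axis (c : ℝ → ℝ → RP3) : Submodule ℝ V4 :=
  sInf {W | ∃ t ∈ UI, IsConicArc (c t) W}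

/-- Characteristic line of the conics of the first net direction, `u ↦ f u v`. -/
noncomputable def charLine₁ (f : ℝ → ℝ → RP3) : Submodule ℝ V4 := axis (fun v u => f u v)

/-- Characteristic line of the conics of the second net direction, `v ↦ f u v`. -/
noncomputable def charLine₂ (f : ℝ → ℝ → RP3) : Submodule ℝ V4 := axis (fun u v => f u v)

/-- Genericity of a patch: the boundary curves are conic arcs, opposite ones lie in different
planes, and the two characteristic lines are skew. -/
def IsGenericPatch (f : ℝ → ℝ → RP3) : Prop :=
  (∃ W₀ W₁, IsConicArc (fun v => f 0 v) W₀ ∧ IsConicArc (fun v => f 1 v) W₁ ∧ W₀ ≠ W₁) ∧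
  (∃ W₀ W₁, IsConicArc (fun u => f u 0) W₀ ∧ IsConicArc (fun u => f u 1) W₁ ∧ W₀ ≠ W₁) ∧
  Disjoint (charLine₁ f) (charLine₂ f)

/-- The span of the four vertices of a patch. -/
noncomputable def vertexSpan (f : ℝ → ℝ → RP3) : Submodule ℝ V4 :=
  (f 0 0).submodule ⊔ (f 1 0).submodule ⊔ (f 1 1).submodule ⊔ (f 0 1).submodule

/-- The two sides of a face, an edge or a cube, as parameter values. -/
def side (ε : Bool) : ℝ := cond ε 1 0

/-- Supercyclidic cubes. The six faces are labelled by their normal direction `i : Fin 3` and a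
side `ε`; the parameters of `X i ε` belong to the directions `i + 1` and `i + 2`, in this order.
The vertex quadrilaterals are planar, and two faces with a common edge have the same vertices and
the same boundary arc (as a set of points) there. -/
structure IsSCCube (X : Fin 3 → Bool → ℝ → ℝ → RP3) : Prop where
  patch : ∀ i ε, IsSCPatch (X i ε)
  planar : ∀ i ε, Module.finrank ℝ (vertexSpan (X i ε)) ≤ 3
  vertices : ∀ i ε δ τ,
    X (i + 1) ε (side δ) (side τ) = X (i + 2) δ (side τ) (side ε)
  common_boundary : ∀ i ε δ,
    (fun t => X (i + 1) ε (side δ) t) '' UI = (fun t => X (i + 2) δ t (side ε)) '' UI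

/-- Genericity of a cube: its faces are generic patches, and opposite vertex quadrilaterals lie
in different planes. -/
structure IsGenericCube (X : Fin 3 → Bool → ℝ → ℝ → RP3) : Prop where
  faces : ∀ i ε, IsGenericPatch (X i ε)
  opposite : ∀ i, vertexSpan (X i false) ≠ vertexSpan (X i true)

/-- `r` is a smooth, orientation preserving change of parameter of `[0,1]`. -/
def IsReparam (r : ℝ → ℝ) : Prop :=
  ContDiff ℝ ∞ r ∧ r 0 = 0 ∧ r 1 = 1 ∧ ∀ t ∈ UI, 0 < deriv r t

/-- `g` arises from `f` by changing the parameter in each of the two net directions. -/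
def IsReparamOf (g f : ℝ → ℝ → RP3) : Prop :=
  ∃ r r' : ℝ → ℝ, IsReparam r ∧ IsReparam r' ∧
    ∀ a ∈ UI, ∀ b ∈ UI, g a b = f (r a) (r' b)

/-- Equal vertices and equal boundary arcs, as sets of points. -/
def SameBoundary (g f : ℝ → ℝ → RP3) : Prop :=
  (∀ ε δ, g (side ε) (side δ) = f (side ε) (side δ)) ∧
  (∀ ε, (fun b => g (side ε) b) '' UI = (fun b => f (side ε) b) '' UI) ∧
  (∀ δ, (fun a => g a (side δ)) '' UI = (fun a => f a (side δ)) '' UI)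

/-- Non-degeneracy of a quadrilateral of arcs, with opposite pairs `A` and `B`:
the four arcs are conic arcs, opposite arcs lie in different planes, so that the planes meet in a
line for each pair, the two lines are skew, no arc meets the line of the other pair, and arcs
that meet the line of their own pair occur in at most one of the pairs. -/
def NondegenerateQuad (A B : Bool → ℝ → RP3) : Prop :=
  ∃ WA WB : Bool → Submodule ℝ V4,
    (∀ ε, IsConicArc (A ε) (WA ε)) ∧ (∀ ε, IsConicArc (B ε) (WB ε)) ∧
    WA false ≠ WA true ∧ WB false ≠ WB true ∧
    Disjoint (WA false ⊓ WA true) (WB false ⊓ WB true) ∧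
    (∀ ε, ∀ t ∈ UI, ¬ (A ε t).submodule ≤ WB false ⊓ WB true) ∧
    (∀ ε, ∀ t ∈ UI, ¬ (B ε t).submodule ≤ WA false ⊓ WA true) ∧
    ((∀ ε, ∀ t ∈ UI, ¬ (A ε t).submodule ≤ WA false ⊓ WA true) ∨
      (∀ ε, ∀ t ∈ UI, ¬ (B ε t).submodule ≤ WB false ⊓ WB true))

/-- For faces `Y` with matching parameters: the parameters `t ∈ [0,1]` of the direction `i` for
which the conics with parameter `t` on the four faces around the direction `i` form a
non-degenerate quadrilateral. -/
def nondegenerateParams (Y : Fin 3 → Bool → ℝ → ℝ → RP3) (i : Fin 3) : Set ℝ :=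
  {t | t ∈ UI ∧
    NondegenerateQuad (fun ε b => Y (i + 1) ε b t) (fun δ a => Y (i + 2) δ t a)}

/-- Fundamental transforms: conjugate nets such that in corresponding points the tangents to
corresponding parameter lines intersect, for both net directions. -/
def IsFundamentalTransform (f g : ℝ → ℝ → RP3) : Prop :=
  ∃ F G : ℝ → ℝ → V4, IsSmoothLift F f ∧ IsSmoothLift G g ∧ IsConjugate F ∧ IsConjugate G ∧
    ∀ u ∈ UI, ∀ v ∈ UI,
      ¬ LinearIndependent ℝ ![F u v, partial₁ F u v, G u v, partial₁ G u v] ∧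
      ¬ LinearIndependent ℝ ![F u v, partial₂ F u v, G u v, partial₂ G u v]

/-! ### Smooth functions on the unit interval -/

/-! A generic SC-patch is a translation surface in homogeneous disguise, and a cube of such patches
is one trilinear map evaluated on conics.

Single patches. Let L₁, L₂ be the characteristic lines of a generic patch; they are skew, so ℝ⁴ = L₁
⊕ L₂. After changes of parameter the patch has the lift F(u,v) = ψ(v) p(u) + φ(u) q(v), where p, q
are linear maps of ℝ³ onto L₁, L₂ and φ, ψ are linear forms, all evaluated on the standard conic
`ver`. Where φψ ≠ 0 this is proportional to p/φ + q/ψ. The form is obtained as follows. The tangent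
cone together with conjugacy forces the transversal tangents along a regular parameter line through
one apex (`IsSCLift.exists_apex`). The apex lies in the planes of all conics of the other family,
and two different apices span the intersection of two of these planes, so the planes form a pencil
(`IsSCLift.inf_le_plane`). The position of the apex on L₁ shows that the projections of two conics
to L₁, weighted by their transversal coordinates, have locally constant ratio; as a linear
coordinate on a conic has zeros of order at most two, the constant is the same on both sides of
every exceptional parameter (`IsSCFrame.global_ratio`). This yields `IsSCPatch.exists_std`.
Conversely the standard form always gives a generic SC-patch (`IsStd.isSCPatch`,
`IsStd.isGenericPatch`). Its data can be read off from the equations of two adjacent boundary arcs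
and the splitting L₁ ⊕ L₂, whence uniqueness for given boundary (`IsStd.isReparamOf`).

Cubes. Let E_d be linear equations of the three edges through a vertex o. The standard forms of the
three faces at o supply two linear forms α_d, β_d for each edge, one for either adjacent face. The
map `cubeMap` is trilinear, symmetric under cyclic rotation, and restricts to these lifts on the
near faces. A far face is known up to two linear forms once its two edges on near faces are known.
The edge shared by two far faces has two equations, which differ by a diagonal projective map; the
last vertex lies in the vertex plane of the third far face, and this fixes the remaining scalars.
Comparison of coefficients then determines the forms (`IsCubeFrame.far_forms`), and `cubeMap` turns
out to parametrize all six faces with matching parameters (`IsCubeFrame.face_rep`).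

Consequences. Since parameters match along edges, conics close up. A slice with one argument fixed
at t has, up to the factor α_i(t) β_i(t), the shape of a near face; if its boundary is a
non-degenerate quadrilateral, the slice is a patch in standard form
(`exists_isStd_of_nondegenerateQuad`, `IsCubeFrame.exists_member`). Cyclic symmetry gives the common
conics of members of different families. The common kernel of α_i and β_i supplies the point on all
characteristic lines of direction i. Finally, a slice has the form g(y) P(x) + f(x) Q(y), and the
four values of such an expression at two choices of x and two of y are linearly dependent; applied
to points and tangents this is the fundamental relation. -/

theorem zero_mem_UI : (0 : ℝ) ∈ UI := ⟨le_rfl, zero_le_one⟩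

theorem one_mem_UI : (1 : ℝ) ∈ UI := ⟨zero_le_one, le_rfl⟩

theorem side_mem_UI (ε : Bool) : side ε ∈ UI := by
  cases ε
  · exact zero_mem_UI
  · exact one_mem_UI

theorem Ioo_subset_UI {u : ℝ} (h : u ∈ Set.Ioo (0 : ℝ) 1) : u ∈ UI := ⟨h.1.le, h.2.le⟩

theorem UI_subset_closure {Z : Set ℝ} (hZ : Z.Finite) :
    UI ⊆ closure (Set.Ioo (0 : ℝ) 1 \ Z) := by
  have h1 : UI ⊆ closure (Set.Ioo (0 : ℝ) 1) := by
    rw [closure_Ioo (by norm_num : (0 : ℝ) ≠ 1)]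
  have h2 : Dense (Zᶜ) := hZ.countable.dense_compl ℝ
  have h3 := h2.open_subset_closure_inter (isOpen_Ioo : IsOpen (Set.Ioo (0 : ℝ) 1))
  exact h1.trans (closure_minimal h3 isClosed_closure)

/-- A closed condition on the unit interval may be checked off a finite set. -/
theorem forall_UI_of_cofinite {p : ℝ → Prop} (hp : IsClosed {u | p u}) {Z : Set ℝ}
    (hZ : Z.Finite) (h : ∀ u ∈ Set.Ioo (0 : ℝ) 1, u ∉ Z → p u) : ∀ u ∈ UI, p u := by
  intro u hu
  exact closure_minimal (fun v (hv : v ∈ Set.Ioo (0 : ℝ) 1 \ Z) => h v hv.1 hv.2) hp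
    (UI_subset_closure hZ hu)

theorem infinite_Ioo_diff {Z : Set ℝ} (hZ : Z.Finite) : (Set.Ioo (0 : ℝ) 1 \ Z).Infinite :=
  (Set.Ioo_infinite zero_lt_one).sdiff hZ

theorem deriv_eq_zero_of_eq_zero_on_UI {E : Type*} [NormedAddCommGroup E] [NormedSpace ℝ E]
    {f : ℝ → E} (hf : ContDiff ℝ ∞ f) (h : ∀ t ∈ UI, f t = 0) : ∀ t ∈ UI, deriv f t = 0 := by
  refine forall_UI_of_cofinite (Z := ∅) ?_ Set.finite_empty ?_
  · exact isClosed_eq (hf.continuous_deriv (by simp)) continuous_const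
  · intro u hu _
    have : f =ᶠ[nhds u] fun _ => (0 : E) := by
      filter_upwards [isOpen_Ioo.mem_nhds hu] with v hv using h v (Ioo_subset_UI hv)
    rw [this.deriv_eq, deriv_const]

theorem deriv_eq_of_eq_on_UI {E : Type*} [NormedAddCommGroup E] [NormedSpace ℝ E]
    {f g : ℝ → E} (hf : ContDiff ℝ ∞ f) (hg : ContDiff ℝ ∞ g) (h : ∀ t ∈ UI, f t = g t) :
    ∀ t ∈ UI, deriv f t = deriv g t := by
  intro t ht
  have h1 := deriv_eq_zero_of_eq_zero_on_UI (hf.sub hg) (fun s hs => by simp [h s hs]) t ht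
  rw [deriv_fun_sub (hf.differentiable (by simp) t) (hg.differentiable (by simp) t)] at h1
  exact sub_eq_zero.1 h1

theorem contDiff_deriv {E : Type*} [NormedAddCommGroup E] [NormedSpace ℝ E]
    {f : ℝ → E} (hf : ContDiff ℝ ∞ f) : ContDiff ℝ ∞ (deriv f) :=
  (contDiff_infty_iff_deriv.1 hf).2

theorem exists_smooth_indicator {s : Set ℝ} (hs : IsClosed s) (h : Disjoint s UI) :
    ∃ χ : ℝ → ℝ, ContDiff ℝ ∞ χ ∧ (∀ x, 0 ≤ χ x ∧ χ x ≤ 1) ∧ (∀ x ∈ s, χ x = 0) ∧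
      (∀ x ∉ s, 0 < χ x) ∧ (∀ x ∈ UI, χ x = 1) ∧ ∀ x ∉ UI, χ x < 1 := by
  obtain ⟨χ, h1, h2, h3, h4⟩ := exists_contMDiff_zero_iff_one_iff_of_isClosed
    (n := ⊤) (modelWithCornersSelf ℝ ℝ) hs (isClosed_Icc : IsClosed UI) h
  have hr : ∀ x, 0 ≤ χ x ∧ χ x ≤ 1 := fun x => h2 (Set.mem_range_self x)
  refine ⟨χ, h1.contDiff, hr, fun x hx => (h3 x).1 hx, fun x hx => ?_, fun x hx => (h4 x).1 hx,
    fun x hx => ?_⟩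
  · exact lt_of_le_of_ne (hr x).1 fun h => hx ((h3 x).2 h.symm)
  · exact lt_of_le_of_ne (hr x).2 fun h => hx ((h4 x).2 h)

/-- Lifts are smooth on the whole line while conditions hold only on the unit interval, so
reciprocals have to be extended past the zeros outside it. -/
theorem exists_smooth_inv {g : ℝ → ℝ} (hg : ContDiff ℝ ∞ g) (h : ∀ t ∈ UI, g t ≠ 0) :
    ∃ k : ℝ → ℝ, ContDiff ℝ ∞ k ∧ ∀ t ∈ UI, k t * g t = 1 := by
  obtain ⟨χ, h1, h2, h3, h4, h5, h6⟩ := exists_smooth_indicator (s := {t | g t = 0})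
    (isClosed_eq hg.continuous continuous_const)
    (Set.disjoint_left.2 fun t ht hu => h t hu ht)
  have hd : ∀ t, g t ^ 2 + (1 - χ t) ≠ 0 := by
    intro t
    by_cases ht : g t = 0
    · rw [h3 t ht, ht]; norm_num
    · have := (h2 t).2
      have h8 : 0 < g t ^ 2 := by positivity
      have : 0 < g t ^ 2 + (1 - χ t) := by linarith
      exact this.ne'
  -- On the unit interval χ = 1 and the quotient is 1/g; at zeros of g the cutoff χ vanishes and the
  -- denominator is 1.
  refine ⟨fun t => g t / (g t ^ 2 + (1 - χ t)),
    hg.div ((hg.pow 2).add (contDiff_const.sub h1)) hd, ?_⟩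
  intro t ht
  have := h t ht
  simp only [h5 t ht]
  field_simp
  ring

/-! ### Changes of parameter -/

namespace IsReparam

variable {r : ℝ → ℝ}

theorem strictMonoOn (h : IsReparam r) : StrictMonoOn r UI :=
  strictMonoOn_of_deriv_pos (convex_Icc 0 1) h.1.continuous.continuousOn
    (fun t ht => h.2.2.2 t (interior_subset ht))

theorem mem_UI (h : IsReparam r) {t : ℝ} (ht : t ∈ UI) : r t ∈ UI := by
  constructor
  · rw [← h.2.1]; exact h.strictMonoOn.monotoneOn zero_mem_UI ht ht.1
  · rw [← h.2.2.1]; exact h.strictMonoOn.monotoneOn ht one_mem_UI ht.2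

theorem surjOn (h : IsReparam r) : Set.SurjOn r UI UI := by
  have := intermediate_value_Icc zero_le_one (h.1.continuous.continuousOn (s := UI))
  rw [h.2.1, h.2.2.1] at this
  exact this

theorem side (h : IsReparam r) (ε : Bool) : r (_root_.side ε) = _root_.side ε := by
  cases ε
  · exact h.2.1
  · exact h.2.2.1

/-- A change of parameter is controlled only on the unit interval. Its derivative is blended there
into a positive constant and integrated again, which gives a diffeomorphism of the line to which the
inverse function theorem applies. -/
theorem exists_diffeo (h : IsReparam r) :
    ∃ R : ℝ → ℝ, ContDiff ℝ ∞ R ∧ (∀ t ∈ UI, R t = r t) ∧ ∃ m > 0, ∀ t, m ≤ deriv R t := by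
  have hg : ContDiff ℝ ∞ (deriv r) := contDiff_deriv h.1
  obtain ⟨t₀, ht₀, hmin⟩ := (isCompact_Icc : IsCompact UI).exists_isMinOn ⟨0, zero_mem_UI⟩
    hg.continuous.continuousOn
  have hm := h.2.2.2 t₀ ht₀
  -- Half the minimum keeps the set where the derivative is at most m away from the unit interval,
  -- so that a cutoff can separate the two.
  set m := deriv r t₀ / 2 with hmdef
  have hm' : 0 < m := by positivity
  obtain ⟨χ, h1, h2, h3, h4, h5, h6⟩ := exists_smooth_indicator (s := {t | deriv r t ≤ m})
    (isClosed_le hg.continuous continuous_const)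
    (Set.disjoint_left.2 fun t ht hu => by
      have h8 : deriv r t₀ ≤ deriv r t := hmin hu
      have h9 : deriv r t ≤ m := ht
      linarith)
  set G : ℝ → ℝ := fun t => χ t * deriv r t + (1 - χ t) * m with hG
  have hGs : ContDiff ℝ ∞ G := (h1.mul hg).add ((contDiff_const.sub h1).mul contDiff_const)
  have hder : ∀ t, HasDerivAt (fun t => ∫ s in (0 : ℝ)..t, G s) (G t) t := fun t =>
    intervalIntegral.integral_hasDerivAt_right (hGs.continuous.intervalIntegrable _ _)
      (hGs.continuous.stronglyMeasurableAtFilter _ _) hGs.continuous.continuousAt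
  have hder' : deriv (fun t => ∫ s in (0 : ℝ)..t, G s) = G := funext fun t => (hder t).deriv
  refine ⟨fun t => ∫ s in (0 : ℝ)..t, G s, ?_, ?_, m, hm', ?_⟩
  · rw [contDiff_infty_iff_deriv, hder']
    exact ⟨fun t => (hder t).differentiableAt, hGs⟩
  · intro t ht
    have e1 : ∫ s in (0 : ℝ)..t, G s = ∫ s in (0 : ℝ)..t, deriv r s := by
      refine intervalIntegral.integral_congr fun s hs => ?_
      rw [Set.uIcc_of_le ht.1] at hs
      have : s ∈ UI := ⟨hs.1, hs.2.trans ht.2⟩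
      simp [hG, h5 s this]
    simp only [e1]
    rw [intervalIntegral.integral_deriv_eq_sub (fun s _ => h.1.differentiable (by simp) s)
      (hg.continuous.intervalIntegrable _ _), h.2.1, sub_zero]
  · intro t
    rw [hder']
    by_cases ht : deriv r t ≤ m
    · simp [hG, h3 t ht]
    · have := h2 t
      push Not at ht
      simp only [hG]
      nlinarith

theorem exists_inverse (h : IsReparam r) :
    ∃ k : ℝ → ℝ, IsReparam k ∧ ∀ t ∈ UI, r (k t) = t := by
  obtain ⟨R, hR, hRr, m, hm, hd⟩ := h.exists_diffeo
  have hdiff : Differentiable ℝ R := hR.differentiable (by simp)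
  have hmono : StrictMono R := strictMono_of_deriv_pos fun t => hm.trans_le (hd t)
  have hslope : ∀ x y, x ≤ y → m * (y - x) ≤ R y - R x := fun x y hxy =>
    mul_sub_le_image_sub_of_le_deriv hdiff hd hxy
  have htop : Filter.Tendsto R Filter.atTop Filter.atTop := by
    have : Filter.Tendsto (fun t => m * t + R 0) Filter.atTop Filter.atTop :=
      Filter.tendsto_atTop_add_const_right _ _ (Filter.tendsto_id.const_mul_atTop hm)
    refine Filter.tendsto_atTop_mono' _ ?_ this
    filter_upwards [Filter.eventually_ge_atTop 0] with t ht
    have := hslope 0 t ht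
    linarith
  have hbot : Filter.Tendsto R Filter.atBot Filter.atBot := by
    have : Filter.Tendsto (fun t => m * t + R 0) Filter.atBot Filter.atBot :=
      Filter.tendsto_atBot_add_const_right _ _ (Filter.tendsto_id.const_mul_atBot hm)
    refine Filter.tendsto_atBot_mono' _ ?_ this
    filter_upwards [Filter.eventually_le_atBot 0] with t ht
    have := hslope t 0 ht
    linarith
  have hsurj : Function.Surjective R := hR.continuous.surjective htop hbot
  let e : ℝ ≃ₜ ℝ := (hmono.orderIsoOfSurjective R hsurj).toHomeomorph
  have he : ∀ x, e x = R x := fun x => rfl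
  have hes : ∀ x, R (e.symm x) = x := fun x => e.apply_symm_apply x
  have hder : ∀ x, HasDerivAt e (deriv R x) x := fun x => (hdiff x).hasDerivAt
  have hsm : ContDiff ℝ ∞ e.symm :=
    e.contDiff_symm_deriv (f' := deriv R) (fun x => (hm.trans_le (hd x)).ne') hder hR
  have h0 : e.symm 0 = 0 := by
    rw [e.symm_apply_eq, he, hRr 0 zero_mem_UI, h.2.1]
  have h1 : e.symm 1 = 1 := by
    rw [e.symm_apply_eq, he, hRr 1 one_mem_UI, h.2.2.1]
  have hmem : ∀ t ∈ UI, e.symm t ∈ UI := by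
    intro t ht
    obtain ⟨s, hs, hst⟩ := h.surjOn ht
    have : e.symm t = s := by rw [e.symm_apply_eq, he, hRr s hs, hst]
    rwa [this]
  refine ⟨e.symm, ⟨hsm, h0, h1, fun t _ => ?_⟩, fun t ht => ?_⟩
  · have h2 : HasDerivAt (R ∘ e.symm) (deriv R (e.symm t) * deriv e.symm t) t :=
      (hdiff _).hasDerivAt.comp t (hsm.differentiable (by simp) t).hasDerivAt
    have h3 : R ∘ e.symm = id := funext hes
    rw [h3] at h2
    have h4 := h2.unique (hasDerivAt_id t)
    have h5 := hm.trans_le (hd (e.symm t))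
    by_contra hneg
    push Not at hneg
    nlinarith
  · rw [← hRr _ (hmem t ht), hes]

end IsReparam

/-! ### Homogeneous coordinates -/

theorem Represents.ne_zero {v : V4} {p : RP3} (h : Represents v p) : v ≠ 0 := h.1

theorem Represents.submodule {v : V4} {p : RP3} (h : Represents v p) :
    p.submodule = Submodule.span ℝ {v} := by
  obtain ⟨h, rfl⟩ := h
  exact Projectivization.submodule_mk v h

theorem Represents.submodule_le {v : V4} {p : RP3} (h : Represents v p) {W : Submodule ℝ V4} :
    p.submodule ≤ W ↔ v ∈ W := by
  rw [h.submodule, Submodule.span_singleton_le_iff_mem]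

theorem Represents.exists_smul {v w : V4} {p : RP3} (hv : Represents v p) (hw : Represents w p) :
    ∃ a : ℝ, a ≠ 0 ∧ w = a • v := by
  obtain ⟨h1, rfl⟩ := hv
  obtain ⟨h2, h⟩ := hw
  obtain ⟨a, ha⟩ := (Projectivization.mk_eq_mk_iff' ℝ _ _ h2 h1).1 h
  refine ⟨a, ?_, ha.symm⟩
  rintro rfl
  exact h2 (by rw [← ha, zero_smul])

theorem Represents.smul {v : V4} {p : RP3} (hv : Represents v p) {a : ℝ} (ha : a ≠ 0) :
    Represents (a • v) p := by
  obtain ⟨h1, rfl⟩ := hv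
  exact ⟨smul_ne_zero ha h1, (Projectivization.mk_eq_mk_iff' ℝ _ _ _ _).2 ⟨a, rfl⟩⟩

theorem Represents.eq {v : V4} {p q : RP3} (hp : Represents v p) (hq : Represents v q) : p = q := by
  obtain ⟨h1, rfl⟩ := hp
  obtain ⟨h2, rfl⟩ := hq
  rfl

theorem Represents.of_eq_smul {v w : V4} {p : RP3} (hv : Represents v p) {a : ℝ} (hw : w ≠ 0)
    (h : w = a • v) : Represents w p := by
  subst h
  exact hv.smul (fun ha => hw (by rw [ha, zero_smul]))

theorem Represents.of_smul_eq {v w : V4} {p : RP3} (hv : Represents v p) {a : ℝ} (ha : a ≠ 0)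
    (h : a • w = v) : Represents w p := by
  have : w = a⁻¹ • v := by rw [← h, smul_smul, inv_mul_cancel₀ ha, one_smul]
  rw [this]
  exact hv.smul (inv_ne_zero ha)

theorem exists_represents (p : RP3) : ∃ v, Represents v p :=
  ⟨p.rep, p.rep_nonzero, p.mk_rep⟩

/-- The point with given homogeneous coordinates, with an arbitrary value at zero. -/
noncomputable def toPoint (v : V4) : RP3 :=
  if h : v ≠ 0 then Projectivization.mk ℝ v h
  else Projectivization.mk ℝ (fun _ => 1) (fun h => one_ne_zero (congrFun h 0))

theorem represents_toPoint {v : V4} (h : v ≠ 0) : Represents v (toPoint v) :=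
  ⟨h, by rw [toPoint, dif_pos h]⟩

/-! ### The Veronese conic -/

/-- Parameter space of a plane with a distinguished conic. -/
abbrev R3 : Type := Fin 3 → ℝ

/-- The standard conic in Bernstein form. -/
noncomputable def ver (t : ℝ) : R3 := ![(1 - t) ^ 2, t * (1 - t), t ^ 2]

/-- Derivative of the standard conic. -/
noncomputable def dver (t : ℝ) : R3 := ![-2 * (1 - t), 1 - 2 * t, 2 * t]

/-- The equation of the standard conic. -/
noncomputable def cq : QuadraticForm ℝ R3 := QuadraticMap.proj 1 1 - QuadraticMap.proj 0 2

theorem cq_apply (x : R3) : cq x = x 1 * x 1 - x 0 * x 2 := rfl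

theorem polar_cq (x y : R3) :
    QuadraticMap.polar cq x y = 2 * x 1 * y 1 - x 0 * y 2 - x 2 * y 0 := by
  simp only [QuadraticMap.polar, cq_apply, Pi.add_apply]
  ring

@[simp] theorem ver_apply_zero (t : ℝ) : ver t 0 = (1 - t) ^ 2 := rfl
@[simp] theorem ver_apply_one (t : ℝ) : ver t 1 = t * (1 - t) := rfl
@[simp] theorem ver_apply_two (t : ℝ) : ver t 2 = t ^ 2 := rfl
@[simp] theorem dver_apply_zero (t : ℝ) : dver t 0 = -2 * (1 - t) := rfl
@[simp] theorem dver_apply_one (t : ℝ) : dver t 1 = 1 - 2 * t := rfl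
@[simp] theorem dver_apply_two (t : ℝ) : dver t 2 = 2 * t := rfl

theorem ext3 {x y : R3} (h0 : x 0 = y 0) (h1 : x 1 = y 1) (h2 : x 2 = y 2) : x = y := by
  funext i
  fin_cases i
  · exact h0
  · exact h1
  · exact h2

theorem hasDerivAt_ver (t : ℝ) : HasDerivAt ver (dver t) t := by
  rw [hasDerivAt_pi]
  intro i
  fin_cases i
  · change HasDerivAt (fun t : ℝ => (1 - t) ^ 2) (-2 * (1 - t)) t
    refine (((hasDerivAt_id' t).const_sub 1).fun_pow 2).congr_deriv ?_
    norm_num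
  · change HasDerivAt (fun t : ℝ => t * (1 - t)) (1 - 2 * t) t
    refine ((hasDerivAt_id' t).fun_mul ((hasDerivAt_id' t).const_sub 1)).congr_deriv ?_
    ring
  · change HasDerivAt (fun t : ℝ => t ^ 2) (2 * t) t
    refine ((hasDerivAt_id' t).fun_pow 2).congr_deriv ?_
    norm_num

theorem contDiff_ver : ContDiff ℝ ∞ ver := by
  rw [contDiff_pi]
  intro i
  fin_cases i
  · exact (contDiff_const.sub contDiff_id).pow 2
  · exact contDiff_id.mul (contDiff_const.sub contDiff_id)
  · exact contDiff_id.pow 2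

theorem LinearMap.contDiff_of_finite {E F : Type*} [NormedAddCommGroup E] [NormedSpace ℝ E]
    [FiniteDimensional ℝ E] [NormedAddCommGroup F] [NormedSpace ℝ F] (Γ : E →ₗ[ℝ] F) :
    ContDiff ℝ ∞ Γ :=
  (LinearMap.toContinuousLinearMap Γ).contDiff

theorem contDiff_lin_ver {F : Type*} [NormedAddCommGroup F] [NormedSpace ℝ F] (Γ : R3 →ₗ[ℝ] F) :
    ContDiff ℝ ∞ fun t => Γ (ver t) :=
  Γ.contDiff_of_finite.comp contDiff_ver

theorem hasDerivAt_lin {E F : Type*} [NormedAddCommGroup E] [NormedSpace ℝ E]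
    [FiniteDimensional ℝ E] [NormedAddCommGroup F] [NormedSpace ℝ F] (Γ : E →ₗ[ℝ] F)
    {f : ℝ → E} {f' : E} {t : ℝ} (h : HasDerivAt f f' t) :
    HasDerivAt (fun t => Γ (f t)) (Γ f') t :=
  (LinearMap.toContinuousLinearMap Γ).hasFDerivAt.comp_hasDerivAt t h

theorem hasDerivAt_lin_ver {F : Type*} [NormedAddCommGroup F] [NormedSpace ℝ F] (Γ : R3 →ₗ[ℝ] F)
    (t : ℝ) : HasDerivAt (fun t => Γ (ver t)) (Γ (dver t)) t :=
  hasDerivAt_lin Γ (hasDerivAt_ver t)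

theorem ver_zero : ver 0 = ![1, 0, 0] := by
  simp [ver]

theorem ver_one : ver 1 = ![0, 0, 1] := by
  simp [ver]

theorem ver_ne_zero (t : ℝ) : ver t ≠ 0 := by
  intro h
  have h0 := congrFun h 0
  have h2 := congrFun h 2
  simp at h0 h2
  subst h2
  norm_num at h0

theorem cq_ver (t : ℝ) : cq (ver t) = 0 := by
  simp only [cq_apply, ver_apply_zero, ver_apply_one, ver_apply_two]; ring

theorem polar_ver_ver (t : ℝ) : QuadraticMap.polar cq (ver t) (ver t) = 0 := by
  rw [polar_cq]; simp; ring

theorem polar_ver_dver (t : ℝ) : QuadraticMap.polar cq (ver t) (dver t) = 0 := by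
  rw [polar_cq]; simp; ring

theorem eq_zero_of_polar_cq {x : R3} (h : ∀ y, QuadraticMap.polar cq x y = 0) : x = 0 := by
  have h0 := h ![1, 0, 0]
  have h1 := h ![0, 1, 0]
  have h2 := h ![0, 0, 1]
  simp [polar_cq] at h0 h1 h2
  exact ext3 h2 h1 h0

theorem smul_ver_add_smul_dver {a b t : ℝ} (h : a • ver t + b • dver t = 0) : a = 0 ∧ b = 0 := by
  have h0 := congrFun h 0
  have h1 := congrFun h 1
  have h2 := congrFun h 2
  simp at h0 h1 h2
  have hb : b = 0 := by linear_combination -t * h0 + h1 * (1 - 2 * t) + (1 - t) * h2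
  refine ⟨?_, hb⟩
  subst hb
  linear_combination h0 + 2 * h1 + h2

theorem ver_injective {s t a : ℝ} (h : ver s = a • ver t) : s = t := by
  have h0 := congrFun h 0
  have h1 := congrFun h 1
  have h2 := congrFun h 2
  simp at h0 h1 h2
  have ha : a = 1 := by linear_combination -h0 - 2 * h1 - h2
  subst ha
  linear_combination h1 + h2

theorem eq_poly_zero_of_infinite {p : Polynomial ℝ} {S : Set ℝ} (hS : S.Infinite)
    (h : ∀ t ∈ S, p.eval t = 0) : p = 0 :=
  Polynomial.eq_zero_of_infinite_isRoot p (hS.mono h)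

theorem sum_basis3 {F : Type*} [AddCommGroup F] [Module ℝ F] (Γ : R3 →ₗ[ℝ] F) (x : R3) :
    Γ x = x 0 • Γ ![1, 0, 0] + x 1 • Γ ![0, 1, 0] + x 2 • Γ ![0, 0, 1] := by
  rw [← map_smul, ← map_smul, ← map_smul, ← map_add, ← map_add]
  congr 1
  apply ext3 <;> simp

theorem lin_eq_zero_of_infinite {ℓ : R3 →ₗ[ℝ] ℝ} {S : Set ℝ} (hS : S.Infinite)
    (h : ∀ t ∈ S, ℓ (ver t) = 0) : ℓ = 0 := by
  set a := ℓ ![1, 0, 0]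
  set b := ℓ ![0, 1, 0]
  set c := ℓ ![0, 0, 1]
  have hp : (Polynomial.C a * (1 - Polynomial.X) ^ 2 + Polynomial.C b * (Polynomial.X *
      (1 - Polynomial.X)) + Polynomial.C c * Polynomial.X ^ 2 : Polynomial ℝ) = 0 := by
    refine eq_poly_zero_of_infinite hS fun t ht => ?_
    have := h t ht
    rw [sum_basis3] at this
    simp at this ⊢
    linear_combination this
  have e := fun t : ℝ => congrArg (Polynomial.eval t) hp
  simp at e
  have e0 := e 0
  have e1 := e 1
  have e2 := e 2
  norm_num at e0 e1 e2
  apply LinearMap.ext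
  intro x
  rw [sum_basis3]
  change x 0 * a + x 1 * b + x 2 * c = 0
  have hb : b = 0 := by linear_combination (-1/2 : ℝ) * e2 + (1/2 : ℝ) * e0 + 2 * e1
  rw [e0, e1, hb]
  ring

theorem lin_ver_finite {ℓ : R3 →ₗ[ℝ] ℝ} (h : ℓ ≠ 0) : {t | ℓ (ver t) = 0}.Finite := by
  by_contra hinf
  exact h (lin_eq_zero_of_infinite hinf fun t ht => ht)

theorem quadraticForm_basis3 (q : QuadraticForm ℝ R3) (x : R3) :
    q x = x 0 * x 0 * q ![1, 0, 0] + x 1 * x 1 * q ![0, 1, 0] + x 2 * x 2 * q ![0, 0, 1]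
      + x 0 * x 1 * QuadraticMap.polar q ![1, 0, 0] ![0, 1, 0]
      + x 0 * x 2 * QuadraticMap.polar q ![1, 0, 0] ![0, 0, 1]
      + x 1 * x 2 * QuadraticMap.polar q ![0, 1, 0] ![0, 0, 1] := by
  have hx : x = x 0 • ![1, 0, 0] + x 1 • ![0, 1, 0] + x 2 • ![0, 0, 1] := by
    apply ext3 <;> simp
  conv_lhs => rw [hx]
  rw [QuadraticMap.map_add q, QuadraticMap.map_add q, QuadraticMap.map_smul, QuadraticMap.map_smul,
    QuadraticMap.map_smul, QuadraticMap.polar_add_left]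
  simp only [QuadraticMap.polar_smul_left, QuadraticMap.polar_smul_right, smul_eq_mul]
  ring

/-- Along the standard conic a quadratic form becomes a quartic polynomial. Its vanishing kills five
combinations of the six coefficients, and what survives is the equation of the conic. -/
theorem quadraticForm_eq_of_infinite {q : QuadraticForm ℝ R3} {S : Set ℝ} (hS : S.Infinite)
    (h : ∀ t ∈ S, q (ver t) = 0) : ∃ c : ℝ, ∀ x, q x = c * cq x := by
  have key := quadraticForm_basis3 q
  generalize q ![1, 0, 0] = A at key
  generalize q ![0, 1, 0] = B at key
  generalize q ![0, 0, 1] = C at key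
  generalize QuadraticMap.polar q ![1, 0, 0] ![0, 1, 0] = D at key
  generalize QuadraticMap.polar q ![1, 0, 0] ![0, 0, 1] = E at key
  generalize QuadraticMap.polar q ![0, 1, 0] ![0, 0, 1] = F at key
  have hp : (Polynomial.C A * (1 - Polynomial.X) ^ 4 + Polynomial.C D * (Polynomial.X *
      (1 - Polynomial.X) ^ 3) + Polynomial.C (B + E) * (Polynomial.X ^ 2 * (1 - Polynomial.X) ^ 2)
      + Polynomial.C F * (Polynomial.X ^ 3 * (1 - Polynomial.X))
      + Polynomial.C C * Polynomial.X ^ 4 : Polynomial ℝ) = 0 := by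
    refine eq_poly_zero_of_infinite hS fun t ht => ?_
    have := h t ht
    rw [key] at this
    simp at this ⊢
    linear_combination this
  have e := fun t : ℝ => congrArg (Polynomial.eval t) hp
  simp only [Polynomial.eval_add, Polynomial.eval_mul, Polynomial.eval_C, Polynomial.eval_pow,
    Polynomial.eval_sub, Polynomial.eval_one, Polynomial.eval_X, Polynomial.eval_zero] at e
  have e0 := e 0
  have e1 := e 1
  have e2 := e 2
  have e3 := e 3
  -- Five values of a quartic determine its five coefficients.
  have e4 := e (-1)
  norm_num at e0 e1 e2 e3 e4
  have hD : D = 0 := by linarith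
  have hF : F = 0 := by linarith
  have hE : E = -B := by linarith
  refine ⟨B, fun x => ?_⟩
  rw [key, cq_apply, e0, e1, hD, hF, hE]
  ring

/-- A linear map that preserves the standard arc with its end points is diagonal. -/
theorem diagonal_of_preserves_arc {M : R3 →ₗ[ℝ] R3} {s₀ s₂ : ℝ} (h0 : M (ver 0) = s₀ • ver 0)
    (h2 : M (ver 1) = s₂ • ver 1)
    (h : ∀ t ∈ UI, ∃ t' ∈ UI, ∃ s : ℝ, s ≠ 0 ∧ M (ver t) = s • ver t') :
    ∃ l > 0, ∀ x, M x = s₀ • ![x 0, l * x 1, l ^ 2 * x 2] := by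
  have hs₀ : s₀ ≠ 0 := by
    obtain ⟨t', ht', s, hs, he⟩ := h 0 zero_mem_UI
    rintro rfl
    rw [h0, zero_smul] at he
    exact smul_ne_zero hs (ver_ne_zero t') he.symm
  rw [ver_zero] at h0
  rw [ver_one] at h2
  set m := M ![0, 1, 0] with hm
  have hM : ∀ x, M x = x 0 • (s₀ • ![1, 0, 0]) + x 1 • m + x 2 • (s₂ • ![0, 0, 1]) := by
    intro x
    rw [sum_basis3, h0, h2]
  have hM0 : ∀ x, M x 0 = x 0 * s₀ + x 1 * m 0 := by
    intro x
    rw [hM]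
    change x 0 * (s₀ * 1) + x 1 * m 0 + x 2 * (s₂ * 0) = _
    ring
  have hM1 : ∀ x, M x 1 = x 1 * m 1 := by
    intro x
    rw [hM]
    change x 0 * (s₀ * 0) + x 1 * m 1 + x 2 * (s₂ * 0) = _
    ring
  have hM2 : ∀ x, M x 2 = x 1 * m 2 + x 2 * s₂ := by
    intro x
    rw [hM]
    change x 0 * (s₀ * 0) + x 1 * m 2 + x 2 * (s₂ * 1) = _
    ring
  have hpt : ∀ t ∈ UI, t ^ 2 * (1 - t) ^ 2 * m 1 ^ 2 =
      ((1 - t) ^ 2 * s₀ + t * (1 - t) * m 0) * (t * (1 - t) * m 2 + t ^ 2 * s₂) := by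
    intro t ht
    obtain ⟨t', ht', s, hs, he⟩ := h t ht
    have e0 := congrFun he 0
    have e1 := congrFun he 1
    have e2 := congrFun he 2
    simp only [hM0, hM1, hM2, Pi.smul_apply, smul_eq_mul, ver_apply_zero, ver_apply_one,
      ver_apply_two] at e0 e1 e2
    rw [e0, show t * (1 - t) * m 2 + t ^ 2 * s₂ = s * t' ^ 2 by linarith,
      show t ^ 2 * (1 - t) ^ 2 * m 1 ^ 2 = (t * (1 - t) * m 1) ^ 2 by ring, e1]
    ring
  -- That image points satisfy the equation of the conic is needed at three inner parameters only:
  -- the three resulting relations force the outer entries of the middle column to vanish.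
  have p1 := hpt (1/2) (by constructor <;> norm_num)
  have p2 := hpt (1/3) (by constructor <;> norm_num)
  have p3 := hpt (2/3) (by constructor <;> norm_num)
  norm_num at p1 p2 p3
  have q1 : m 1 ^ 2 = s₀ * s₂ + s₀ * m 2 + m 0 * s₂ + m 0 * m 2 := by linear_combination 16 * p1
  have q2 : 2 * m 1 ^ 2 = 2 * s₀ * s₂ + 4 * s₀ * m 2 + m 0 * s₂ + 2 * m 0 * m 2 := by
    linear_combination (81/2 : ℝ) * p2
  have q3 : 2 * m 1 ^ 2 = 2 * s₀ * s₂ + s₀ * m 2 + 4 * m 0 * s₂ + 2 * m 0 * m 2 := by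
    linear_combination (81/2 : ℝ) * p3
  have hm2 : s₀ * m 2 = 0 := by linarith
  have hm0 : m 0 * s₂ = 0 := by linarith
  have hs₂ : s₂ ≠ 0 := by
    obtain ⟨t', ht', s, hs, he⟩ := h 1 one_mem_UI
    rintro rfl
    rw [ver_one, h2, zero_smul] at he
    exact smul_ne_zero hs (ver_ne_zero t') he.symm
  have k2 : m 2 = 0 := by simpa [hs₀] using hm2
  have k0 : m 0 = 0 := by simpa [hs₂] using hm0
  have k1 : m 1 ^ 2 = s₀ * s₂ := by rw [q1, k0, k2]; ring
  -- A diagonal map with negative middle entry would exchange the two arcs between the end points;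
  -- one inner point of the arc decides the sign.
  obtain ⟨t', ht', s, hs, he⟩ := h (1/2) (by constructor <;> norm_num)
  have e0 := congrFun he 0
  have e1 := congrFun he 1
  simp only [hM0, hM1, k0, Pi.smul_apply, smul_eq_mul, ver_apply_zero, ver_apply_one] at e0 e1
  have hpos : 0 < m 1 / s₀ := by
    have hne : m 1 ≠ 0 := by
      intro h; rw [h] at k1; simp [hs₀, hs₂] at k1
    have : m 1 / s₀ = m 1 * s₀ / (s₀ ^ 2) := by field_simp
    rw [this]
    refine div_pos (lt_of_le_of_ne ?_ (mul_ne_zero hne hs₀).symm) (by positivity)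
    have e3 : m 1 * s₀ = 16 * s ^ 2 * (t' * (1 - t')) * (1 - t') ^ 2 := by
      have a0 : s₀ = 4 * (s * (1 - t') ^ 2) := by linarith
      have a1 : m 1 = 4 * (s * (t' * (1 - t'))) := by linarith
      rw [a0, a1]; ring
    rw [e3]
    have := ht'.1
    have : 0 ≤ 1 - t' := by linarith [ht'.2]
    positivity
  refine ⟨m 1 / s₀, hpos, fun x => ?_⟩
  apply ext3
  · rw [hM0, k0]
    change _ = s₀ * x 0
    ring
  · rw [hM1]
    change _ = s₀ * (m 1 / s₀ * x 1)
    field_simp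
  · rw [hM2, k2]
    change _ = s₀ * ((m 1 / s₀) ^ 2 * x 2)
    rw [div_pow, k1]
    field_simp
    ring

/-! ### Conic arcs -/

/-- The arc `c` is the image of the standard arc under the linear map `Γ`, as a set of points
with distinguished end points. -/
structure IsArcOf (Γ : R3 →ₗ[ℝ] V4) (c : ℝ → RP3) : Prop where
  start : Represents (Γ (ver 0)) (c 0)
  finish : Represents (Γ (ver 1)) (c 1)
  exists_param : ∀ t ∈ UI, ∃ t' ∈ UI, Represents (Γ (ver t')) (c t)
  exists_point : ∀ t' ∈ UI, ∃ t ∈ UI, Represents (Γ (ver t')) (c t)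

theorem exists_left_inverse {Γ : R3 →ₗ[ℝ] V4} (hΓ : Function.Injective Γ) :
    ∃ G : V4 →ₗ[ℝ] R3, ∀ x, G (Γ x) = x := by
  obtain ⟨G, hG⟩ := Γ.exists_leftInverse_of_injective (LinearMap.ker_eq_bot.2 hΓ)
  exact ⟨G, fun x => LinearMap.congr_fun hG x⟩

theorem finrank_range_of_injective {Γ : R3 →ₗ[ℝ] V4} (hΓ : Function.Injective Γ) :
    Module.finrank ℝ (LinearMap.range Γ) = 3 := by
  rw [LinearMap.finrank_range_of_inj hΓ]
  simp

theorem IsArcOf.of_smul {Γ : R3 →ₗ[ℝ] V4} {c : ℝ → RP3} (h : IsArcOf Γ c) {a : ℝ} (ha : a ≠ 0) :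
    IsArcOf (a • Γ) c where
  start := h.start.smul ha
  finish := h.finish.smul ha
  exists_param t ht := (h.exists_param t ht).imp fun _ h => ⟨h.1, h.2.smul ha⟩
  exists_point t ht := (h.exists_point t ht).imp fun _ h => ⟨h.1, h.2.smul ha⟩

theorem IsArcOf.congr_image {Γ : R3 →ₗ[ℝ] V4} {c d : ℝ → RP3} (h : IsArcOf Γ c)
    (h0 : d 0 = c 0) (h1 : d 1 = c 1) (him : d '' UI = c '' UI) : IsArcOf Γ d where
  start := h0 ▸ h.start
  finish := h1 ▸ h.finish
  exists_param t ht := by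
    obtain ⟨s, hs, hst⟩ : d t ∈ c '' UI := him ▸ ⟨t, ht, rfl⟩
    obtain ⟨t', ht', hr⟩ := h.exists_param s hs
    exact ⟨t', ht', hst ▸ hr⟩
  exists_point t' ht' := by
    obtain ⟨s, hs, hr⟩ := h.exists_point t' ht'
    obtain ⟨t, ht, hst⟩ : c s ∈ d '' UI := him ▸ ⟨s, hs, rfl⟩
    exact ⟨t, ht, hst ▸ hr⟩

/-- A parametrization through a change of parameter yields an arc. -/
theorem IsArcOf.of_reparam {Γ : R3 →ₗ[ℝ] V4} {c : ℝ → RP3} {r : ℝ → ℝ} (hr : IsReparam r)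
    (h : ∀ t ∈ UI, Represents (Γ (ver (r t))) (c t)) : IsArcOf Γ c where
  start := by simpa [hr.2.1] using h 0 zero_mem_UI
  finish := by simpa [hr.2.2.1] using h 1 one_mem_UI
  exists_param t ht := ⟨r t, hr.mem_UI ht, h t ht⟩
  exists_point t' ht' := by
    obtain ⟨t, ht, rfl⟩ := hr.surjOn ht'
    exact ⟨t, ht, h t ht⟩

theorem isReparam_id : IsReparam id :=
  ⟨contDiff_id, rfl, rfl, fun t _ => by simp⟩

theorem contDiff_lin_comp {F : Type*} [NormedAddCommGroup F] [NormedSpace ℝ F]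
    (G : V4 →ₗ[ℝ] F) {γ : ℝ → V4} (hγ : ContDiff ℝ ∞ γ) : ContDiff ℝ ∞ fun t => G (γ t) :=
  G.contDiff_of_finite.comp hγ

/-- Two smooth lifts of a curve differ by a smooth factor. -/
theorem exists_smooth_factor {c : ℝ → RP3} {γ δ : ℝ → V4} (hγ : ContDiff ℝ ∞ γ)
    (hδ : ContDiff ℝ ∞ δ) (h : ∀ t ∈ UI, Represents (γ t) (c t))
    (h' : ∀ t ∈ UI, Represents (δ t) (c t)) :
    ∃ m : ℝ → ℝ, ContDiff ℝ ∞ m ∧ ∀ t ∈ UI, m t ≠ 0 ∧ δ t = m t • γ t := by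
  have hd : ContDiff ℝ ∞ fun t => ∑ i, γ t i * γ t i :=
    ContDiff.sum fun i _ => ((contDiff_pi.1 hγ i).mul (contDiff_pi.1 hγ i))
  have hn : ContDiff ℝ ∞ fun t => ∑ i, δ t i * γ t i :=
    ContDiff.sum fun i _ => ((contDiff_pi.1 hδ i).mul (contDiff_pi.1 hγ i))
  have hd0 : ∀ t ∈ UI, ∑ i, γ t i * γ t i ≠ 0 := by
    intro t ht h0
    apply (h t ht).ne_zero
    funext i
    have := (Finset.sum_eq_zero_iff_of_nonneg fun i _ => mul_self_nonneg (γ t i)).1 h0 i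
      (Finset.mem_univ i)
    exact mul_self_eq_zero.1 this
  obtain ⟨k, hk, hk'⟩ := exists_smooth_inv hd hd0
  refine ⟨fun t => (∑ i, δ t i * γ t i) * k t, hn.mul hk, fun t ht => ?_⟩
  obtain ⟨a, ha, hda⟩ := (h t ht).exists_smul (h' t ht)
  have : (∑ i, δ t i * γ t i) * k t = a := by
    rw [hda]
    simp only [Pi.smul_apply, smul_eq_mul, mul_assoc, ← Finset.mul_sum]
    rw [mul_comm (∑ i, _), hk' t ht, mul_one]
  beta_reduce
  rw [this]
  exact ⟨ha, hda⟩

theorem linearIndependent_pair_of_smul {γ δ : ℝ → V4} {m : ℝ → ℝ} {t : ℝ}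
    (hm : DifferentiableAt ℝ m t) (hγ : DifferentiableAt ℝ γ t)
    (hd : deriv δ t = deriv (fun s => m s • γ s) t) (h : δ t = m t • γ t) (hm0 : m t ≠ 0)
    (hli : LinearIndependent ℝ ![γ t, deriv γ t]) : LinearIndependent ℝ ![δ t, deriv δ t] := by
  rw [deriv_fun_smul hm hγ] at hd
  rw [LinearIndependent.pair_iff] at hli ⊢
  intro a b hab
  rw [hd, h] at hab
  have := hli (a * m t + b * deriv m t) (b * m t) (by rw [← hab]; module)
  have hb : b = 0 := by simpa [hm0] using this.2
  have ha := this.1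
  rw [hb] at ha
  exact ⟨by simpa [hm0] using ha, hb⟩

/-- Every smooth lift of a conic arc is regular. -/
theorem IsConicArc.regular {c : ℝ → RP3} {W : Submodule ℝ V4} (h : IsConicArc c W) {δ : ℝ → V4}
    (hδ : ContDiff ℝ ∞ δ) (h' : ∀ t ∈ UI, Represents (δ t) (c t)) :
    ∀ t ∈ UI, LinearIndependent ℝ ![δ t, deriv δ t] := by
  obtain ⟨_, _, ⟨γ, hγ, hr⟩, _⟩ := h
  obtain ⟨m, hm, hm'⟩ := exists_smooth_factor hγ hδ (fun t ht => (hr t ht).1) h'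
  intro t ht
  refine linearIndependent_pair_of_smul (hm.differentiable (by simp) t)
    (hγ.differentiable (by simp) t) ?_ (hm' t ht).2 (hm' t ht).1 (hr t ht).2
  exact deriv_eq_of_eq_on_UI hδ (hm.smul hγ) (fun s hs => (hm' s hs).2) t ht

theorem IsConicArc.mem {c : ℝ → RP3} {W : Submodule ℝ V4} (h : IsConicArc c W) {t : ℝ}
    (ht : t ∈ UI) {v : V4} (hv : Represents v (c t)) : v ∈ W := by
  obtain ⟨_, _, _, Q, _, hQ⟩ := h
  refine (hQ t ht v ?_).1
  rw [hv.submodule]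
  exact Submodule.mem_span_singleton_self v

/-- The image of the standard conic under an injective linear map is a conic arc. -/
theorem isConicArc_of_param {Γ : R3 →ₗ[ℝ] V4} (hΓ : Function.Injective Γ) {c : ℝ → RP3}
    (h : ∀ t ∈ UI, Represents (Γ (ver t)) (c t)) : IsConicArc c (LinearMap.range Γ) := by
  obtain ⟨G, hG⟩ := exists_left_inverse hΓ
  refine ⟨finrank_range_of_injective hΓ, ?_, ⟨fun t => Γ (ver t), contDiff_lin_ver Γ, ?_⟩,
    cq.comp G, ?_, ?_⟩
  · intro s hs t ht hst
    have h1 := h s hs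
    rw [show c s = c t from hst] at h1
    obtain ⟨a, _, ha⟩ := (h t ht).exists_smul h1
    rw [← map_smul] at ha
    exact ver_injective (hΓ ha)
  · intro t ht
    refine ⟨h t ht, ?_⟩
    rw [(hasDerivAt_lin_ver Γ t).deriv, LinearIndependent.pair_iff]
    intro a b hab
    rw [← map_smul, ← map_smul, ← map_add, map_eq_zero_iff Γ hΓ] at hab
    exact smul_ver_add_smul_dver hab
  · rintro _ ⟨x, rfl⟩ hx
    have : x = 0 := by
      refine eq_zero_of_polar_cq fun y => ?_
      have := hx (Γ y) ⟨y, rfl⟩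
      simpa [QuadraticMap.polar, ← map_add, hG] using this
    rw [this, map_zero]
  · intro t ht x hx
    rw [(h t ht).submodule, Submodule.mem_span_singleton] at hx
    obtain ⟨a, rfl⟩ := hx
    refine ⟨⟨a • ver t, map_smul _ _ _⟩, ?_⟩
    rw [QuadraticMap.comp_apply, map_smul, hG, QuadraticMap.map_smul, cq_ver, smul_zero]

/-- A plane that contains infinitely many points of a conic contains its plane. -/
theorem range_le_of_infinite {Γ : R3 →ₗ[ℝ] V4} {W : Submodule ℝ V4} {S : Set ℝ}
    (hS : S.Infinite) (h : ∀ t ∈ S, Γ (ver t) ∈ W) : LinearMap.range Γ ≤ W := by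
  rintro _ ⟨x, rfl⟩
  by_contra hx
  obtain ⟨f, hf, hfW⟩ := Submodule.exists_le_ker_of_notMem hx
  have hz : f ∘ₗ Γ = 0 := lin_eq_zero_of_infinite hS fun t ht => hfW (h t ht)
  exact hf (LinearMap.congr_fun hz x)

theorem UI_infinite : UI.Infinite := Set.Icc_infinite zero_lt_one

theorem IsConicArc.eq_range {c : ℝ → RP3} {W : Submodule ℝ V4} (h : IsConicArc c W)
    {Γ : R3 →ₗ[ℝ] V4} (hΓ : Function.Injective Γ) (ha : IsArcOf Γ c) :
    W = LinearMap.range Γ := by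
  refine (Submodule.eq_of_le_of_finrank_eq (range_le_of_infinite UI_infinite fun t ht => ?_)
    ?_).symm
  · obtain ⟨s, hs, hr⟩ := ha.exists_point t ht
    exact h.mem hs hr
  · rw [finrank_range_of_injective hΓ, h.1]

/-- A smooth lift of an arc of the conic `Γ` is a reparametrization of `Γ`. -/
theorem IsConicArc.exists_reparam {c : ℝ → RP3} {W : Submodule ℝ V4} (h : IsConicArc c W)
    {Γ : R3 →ₗ[ℝ] V4} (hΓ : Function.Injective Γ) (ha : IsArcOf Γ c) :
    ∃ r, IsReparam r ∧ ∀ t ∈ UI, Represents (Γ (ver (r t))) (c t) := by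
  obtain ⟨G, hG⟩ := exists_left_inverse hΓ
  obtain ⟨_, hinj, ⟨γ, hγ, hr⟩, _⟩ := id h
  have hy : ContDiff ℝ ∞ fun t => G (γ t) := contDiff_lin_comp G hγ
  have hc := contDiff_pi.1 hy
  have hs : ∀ t ∈ UI, ∃ t' ∈ UI, ∃ s : ℝ, s ≠ 0 ∧ G (γ t) = s • ver t' ∧
      Represents (Γ (ver t')) (c t) ∧ γ t = s • Γ (ver t') := by
    intro t ht
    obtain ⟨t', ht', hrt⟩ := ha.exists_param t ht
    obtain ⟨s, hs, he⟩ := hrt.exists_smul (hr t ht).1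
    exact ⟨t', ht', s, hs, by rw [he, map_smul, hG], hrt, he⟩
  -- For x = s • ver t the sum x₀ + 2x₁ + x₂ is s, and x₁ + x₂ is st. Their quotient recovers the
  -- parameter smoothly.
  have hd : ContDiff ℝ ∞ fun t => G (γ t) 0 + 2 * G (γ t) 1 + G (γ t) 2 :=
    ((hc 0).add (contDiff_const.mul (hc 1))).add (hc 2)
  have hsum : ∀ s t : ℝ, (s • ver t) 0 + 2 * (s • ver t) 1 + (s • ver t) 2 = s := by
    intro s t
    simp; ring
  have hd0 : ∀ t ∈ UI, G (γ t) 0 + 2 * G (γ t) 1 + G (γ t) 2 ≠ 0 := by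
    intro t ht
    obtain ⟨t', ht', s, hs, he, -⟩ := hs t ht
    rwa [he, hsum]
  obtain ⟨k, hk, hk'⟩ := exists_smooth_inv hd hd0
  set r : ℝ → ℝ := fun t => (G (γ t) 1 + G (γ t) 2) * k t with hrdef
  have hrs : ContDiff ℝ ∞ r := ((hc 1).add (hc 2)).mul hk
  have hrt : ∀ t ∈ UI, r t ∈ UI ∧ Represents (Γ (ver (r t))) (c t) ∧ ∃ s : ℝ, s ≠ 0 ∧
      γ t = s • Γ (ver (r t)) := by
    intro t ht
    obtain ⟨t', ht', s, hs, he, hre, hg⟩ := hs t ht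
    have h1 := hk' t ht
    rw [he, hsum] at h1
    have : r t = t' := by
      rw [hrdef]
      simp only [he, Pi.smul_apply, smul_eq_mul, ver_apply_one, ver_apply_two]
      linear_combination t' * h1
    rw [this]
    exact ⟨ht', hre, s, hs, hg⟩
  have huniq : ∀ t ∈ UI, ∀ t', Represents (Γ (ver t')) (c t) → r t = t' := by
    intro t ht t' h'
    obtain ⟨a, _, h2⟩ := h'.exists_smul (hrt t ht).2.1
    rw [← map_smul] at h2
    exact ver_injective (hΓ h2)
  have h0 : r 0 = 0 := huniq 0 zero_mem_UI 0 ha.start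
  have h1 : r 1 = 1 := huniq 1 one_mem_UI 1 ha.finish
  -- A critical point of r would make the derivative of the lift γ a multiple of γ, against
  -- regularity. The sign then follows from r 0 = 0 and r 1 = 1 by the intermediate value theorem.
  have hd' : ∀ t ∈ UI, deriv r t ≠ 0 := by
    intro t ht hz
    have hd1 := deriv_eq_of_eq_on_UI hγ
      (hd.smul ((contDiff_lin_ver Γ).comp hrs)) (fun s hs => by
        obtain ⟨_, _, a, _, hg⟩ := hrt s hs
        have hG' : G (γ s) = a • ver (r s) := by rw [hg, map_smul, hG]
        change γ s = (G (γ s) 0 + 2 * G (γ s) 1 + G (γ s) 2) • Γ (ver (r s))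
        rw [hG', hsum]
        exact hg) t ht
    have hder : HasDerivAt (fun s => Γ (ver (r s))) 0 t := by
      have := (hasDerivAt_lin_ver Γ (r t)).scomp t (hrs.differentiable (by simp) t).hasDerivAt
      rw [hz, zero_smul] at this
      exact this
    have hd2 := ((hd.differentiable (by simp) t).hasDerivAt.fun_smul hder).deriv
    have hd3 : deriv γ t = deriv (fun t => G (γ t) 0 + 2 * G (γ t) 1 + G (γ t) 2) t •
        Γ (ver (r t)) := by
      rw [hd1]
      refine Eq.trans hd2 ?_
      rw [smul_zero, zero_add]
    obtain ⟨_, _, a, ha0, hg⟩ := hrt t ht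
    have := (LinearIndependent.pair_iff.1 (hr t ht).2)
      (deriv (fun t => G (γ t) 0 + 2 * G (γ t) 1 + G (γ t) 2) t) (-a)
      (by rw [hd3, hg]; module)
    exact ha0 (by simpa using this.2)
  have hdpos : ∀ t ∈ UI, 0 < deriv r t := by
    have hcd : ContinuousOn (deriv r) UI := (contDiff_deriv hrs).continuous.continuousOn
    obtain ⟨t₀, ht₀, hsl⟩ := exists_deriv_eq_slope r zero_lt_one hrs.continuous.continuousOn
      (hrs.differentiable (by simp)).differentiableOn
    rw [h0, h1] at hsl
    norm_num at hsl
    intro t ht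
    by_contra hneg
    push Not at hneg
    have hpc : IsPreconnected UI := isPreconnected_Icc
    have hiv := hpc.intermediate_value ht (Ioo_subset_UI ht₀) hcd
    obtain ⟨u, hu, hu0⟩ := hiv (show (0 : ℝ) ∈ Set.Icc _ _ from ⟨hneg, by rw [hsl]; norm_num⟩)
    exact hd' u hu hu0
  exact ⟨r, ⟨hrs, h0, h1, hdpos⟩, fun t ht => (hrt t ht).2.1⟩

/-- A linear form that does not vanish on the plane of a conic has finitely many zeros on it. -/
theorem IsConicArc.finite_zeros {c : ℝ → RP3} {W : Submodule ℝ V4} (h : IsConicArc c W)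
    {Γ : R3 →ₗ[ℝ] V4} (hΓ : Function.Injective Γ) (ha : IsArcOf Γ c) {γ : ℝ → V4}
    (hγ : ∀ t ∈ UI, Represents (γ t) (c t)) (f : V4 →ₗ[ℝ] ℝ) (hf : ∃ x ∈ W, f x ≠ 0) :
    {t | t ∈ UI ∧ f (γ t) = 0}.Finite := by
  obtain ⟨r, hr, hrc⟩ := h.exists_reparam hΓ ha
  rw [h.eq_range hΓ ha] at hf
  obtain ⟨_, ⟨x, rfl⟩, hx⟩ := hf
  have hne : f ∘ₗ Γ ≠ 0 := fun h0 => hx (LinearMap.congr_fun h0 x)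
  refine Set.Finite.of_finite_image ((lin_ver_finite hne).subset ?_)
    (f := r) (hr.strictMonoOn.injOn.mono fun t ht => ht.1)
  rintro _ ⟨t, ⟨ht, h0⟩, rfl⟩
  obtain ⟨a, ha, he⟩ := (hγ t ht).exists_smul (hrc t ht)
  change f (Γ (ver (r t))) = 0
  rw [he, map_smul, h0, smul_zero]

/-- An adapted basis of a conic with two distinguished points. -/
theorem exists_adapted_basis {W : Submodule ℝ V4} (hW : Module.finrank ℝ W = 3)
    {Q : QuadraticForm ℝ V4}
    (hQ : ∀ x ∈ W, (∀ y ∈ W, QuadraticMap.polar Q x y = 0) → x = 0) {x x' : V4}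
    (hx : x ∈ W) (hx' : x' ∈ W) (hQx : Q x = 0) (hQx' : Q x' = 0)
    (hli : LinearIndependent ℝ ![x, x']) :
    ∃ (Γ : R3 →ₗ[ℝ] V4) (b : ℝ), Function.Injective Γ ∧ LinearMap.range Γ = W ∧ b ≠ 0 ∧
      Γ (ver 0) = x ∧ (∃ a : ℝ, a ≠ 0 ∧ Γ (ver 1) = a • x') ∧ ∀ y, Q (Γ y) = b * cq y := by
  set B := QuadraticMap.polar Q with hB
  have hadd : ∀ x y z, B (x + y) z = B x z + B y z :=
    fun x y z => QuadraticMap.polar_add_left Q x y z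
  have hsm : ∀ (a : ℝ) x z, B (a • x) z = a * B x z :=
    fun a x z => QuadraticMap.polar_smul_left Q a x z
  have hcomm : ∀ x y, B x y = B y x := fun x y => QuadraticMap.polar_comm Q x y
  have hself : ∀ x, B x x = 2 * Q x := fun x => by
    simp [hB, QuadraticMap.polar_self]
  have hxx : B x x = 0 := by rw [hself, hQx, mul_zero]
  have hxx' : B x' x' = 0 := by rw [hself, hQx', mul_zero]
  obtain ⟨y, hyW, hy⟩ : ∃ y ∈ W, y ∉ Submodule.span ℝ (Set.range ![x, x']) := by
    by_contra hcon
    push Not at hcon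
    have h1 : W ≤ Submodule.span ℝ (Set.range ![x, x']) := hcon
    have h2 := Submodule.finrank_mono h1
    have h3 := finrank_range_le_card (R := ℝ) ![x, x']
    rw [Set.finrank] at h3
    simp at h3
    omega
  have hnot : ∀ a b : ℝ, y ≠ a • x + b • x' := by
    rintro a b rfl
    apply hy
    refine Submodule.add_mem _ (Submodule.smul_mem _ _ (Submodule.subset_span ⟨0, rfl⟩))
      (Submodule.smul_mem _ _ (Submodule.subset_span ⟨1, rfl⟩))
  have hspan : ∀ z ∈ W, ∃ a b c : ℝ, z = a • x + b • x' + c • y := by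
    have hli3 : LinearIndependent ℝ ![y, x, x'] := linearIndependent_finCons.2 ⟨hli, hy⟩
    have hle : Submodule.span ℝ (Set.range ![y, x, x']) ≤ W := by
      rw [Submodule.span_le]
      rintro _ ⟨i, rfl⟩
      fin_cases i
      · exact hyW
      · exact hx
      · exact hx'
    have heq := Submodule.eq_of_le_of_finrank_eq hle (by
      rw [finrank_span_eq_card hli3, hW]; rfl)
    intro z hz
    rw [← heq, Submodule.mem_span_range_iff_exists_fun] at hz
    obtain ⟨c, hc⟩ := hz
    refine ⟨c 1, c 2, c 0, ?_⟩
    rw [← hc, Fin.sum_univ_three]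
    simp
    abel
  have hzero : ∀ z ∈ W, B z x = 0 → B z x' = 0 → B z y = 0 → z = 0 := by
    intro z hz h1 h2 h3
    refine hQ z hz fun w hw => ?_
    obtain ⟨a, b, c, rfl⟩ := hspan w hw
    rw [hcomm, hadd, hadd, hsm, hsm, hsm, hcomm x, hcomm x', hcomm y, h1, h2, h3]
    ring
  -- Two conjugate points of the conic would span a line inside it. Some point of that line would
  -- then be conjugate to y as well, hence to the whole plane.
  have hd : B x x' ≠ 0 := by
    intro hd
    have hz := hzero (B x' y • x + (-B x y) • x')
      (W.add_mem (W.smul_mem _ hx) (W.smul_mem _ hx'))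
      (by rw [hadd, hsm, hsm, hxx, hcomm x' x, hd]; ring)
      (by rw [hadd, hsm, hsm, hxx', hd]; ring)
      (by rw [hadd, hsm, hsm]; ring)
    have h1 := (LinearIndependent.pair_iff.1 hli) _ _ hz
    have hx0 := hzero x hx hxx hd (by linarith [h1.2])
    exact hli.ne_zero 0 hx0
  -- The middle basis vector is the pole of the chord through x and x', i.e. y made orthogonal to
  -- both.
  obtain ⟨m, hm⟩ : ∃ m, m = y + (-(B y x' / B x x')) • x + (-(B y x / B x x')) • x' := ⟨_, rfl⟩
  have hmW : m ∈ W := hm ▸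
    W.add_mem (W.add_mem hyW (W.smul_mem _ hx)) (W.smul_mem _ hx')
  have hmx : B m x = 0 := by
    rw [hm, hadd, hadd, hsm, hsm, hxx, hcomm x' x]
    field_simp
    ring
  have hmx' : B m x' = 0 := by
    rw [hm, hadd, hadd, hsm, hsm, hxx']
    field_simp
    ring
  have hQm : Q m ≠ 0 := by
    intro h0
    have hmy : B m y = 0 := by
      have h1 : B m m = 0 := by rw [hself, h0, mul_zero]
      have h2 : m = y + (-(B y x' / B x x')) • x + (-(B y x / B x x')) • x' := hm
      have h3 : B m m = B m y := by
        conv_lhs => rw [hcomm, h2]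
        rw [hadd, hadd, hsm, hsm, ← h2, hcomm x m, hcomm x' m, hmx, hmx', hcomm y m]
        ring
      rw [← h3, h1]
    have h1 := hzero m hmW hmx hmx' hmy
    apply hnot (B y x' / B x x') (B y x / B x x')
    rw [hm] at h1
    rw [← sub_eq_zero, ← h1]
    module
  -- This scaling of x' turns the equation Q into the multiple Q m of the standard one.
  set κ := -(Q m / B x x') with hκ
  have hκ0 : κ ≠ 0 := neg_ne_zero.2 (div_ne_zero hQm hd)
  set Γ : R3 →ₗ[ℝ] V4 := Fintype.linearCombination ℝ ![x, m, κ • x'] with hΓ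
  have hΓa : ∀ z : R3, Γ z = z 0 • x + z 1 • m + (z 2 * κ) • x' := by
    intro z
    rw [hΓ, Fintype.linearCombination_apply, Fin.sum_univ_three]
    simp [smul_smul]
  have hQΓ : ∀ z, Q (Γ z) = Q m * cq z := by
    intro z
    have h1 : B (Γ z) (Γ z) = 2 * (Q m * cq z) := by
      rw [hΓa, hadd, hadd, hsm, hsm, hsm, hcomm x, hcomm m, hcomm x', hadd, hadd, hsm, hsm, hsm,
        hadd, hadd, hsm, hsm, hsm, hadd, hadd, hsm, hsm, hsm, hxx, hmx, hmx', hxx', hcomm x m, hmx,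
        hcomm x' m, hmx', hcomm x' x, hself, cq_apply, hκ]
      field_simp
      ring
    rw [hself] at h1
    linarith
  have hinj : Function.Injective Γ := by
    rw [injective_iff_map_eq_zero]
    intro z hz
    rw [hΓa] at hz
    have e : ∀ w, z 0 * B x w + z 1 * B m w + z 2 * κ * B x' w = 0 := by
      intro w
      rw [← hsm, ← hsm, ← hsm, ← hadd, ← hadd, hz, hB, QuadraticMap.polar_zero_left]
    have e1 := e x'
    have e2 := e m
    have e3 := e x
    rw [hmx', hxx'] at e1
    rw [hcomm x m, hcomm x' m, hmx, hmx', hself] at e2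
    rw [hxx, hmx, hcomm x' x] at e3
    exact ext3 (by simpa [hd] using e1) (by simpa [hQm] using e2) (by simpa [hd, hκ0] using e3)
  refine ⟨Γ, Q m, hinj, ?_, hQm, ?_, ⟨κ, hκ0, ?_⟩, hQΓ⟩
  · refine Submodule.eq_of_le_of_finrank_eq ?_ ?_
    · rintro _ ⟨z, rfl⟩
      rw [hΓa]
      exact W.add_mem (W.add_mem (W.smul_mem _ hx) (W.smul_mem _ hmW)) (W.smul_mem _ hx')
    · rw [finrank_range_of_injective hinj, hW]
  · rw [hΓa, ver_zero]
    simp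
  · rw [hΓa, ver_one]
    simp

/-- Every conic arc is a linear image of the standard arc. -/
theorem IsConicArc.exists_isArcOf {c : ℝ → RP3} {W : Submodule ℝ V4} (h : IsConicArc c W) :
    ∃ Γ : R3 →ₗ[ℝ] V4, Function.Injective Γ ∧ LinearMap.range Γ = W ∧ IsArcOf Γ c := by
  obtain ⟨hW, hinj, ⟨γ, hγ, hr⟩, Q, hQ, hc⟩ := id h
  have hmem : ∀ t ∈ UI, γ t ∈ W ∧ Q (γ t) = 0 := fun t ht =>
    hc t ht _ (by rw [(hr t ht).1.submodule]; exact Submodule.mem_span_singleton_self _)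
  have hne : ∀ s ∈ UI, ∀ t ∈ UI, ∀ a : ℝ, γ s = a • γ t → s = t := by
    intro s hs t ht a ha
    refine hinj hs ht ?_
    exact (hr s hs).1.eq ((hr t ht).1.of_eq_smul (hr s hs).1.ne_zero ha)
  have hli : LinearIndependent ℝ ![γ 0, γ 1] := by
    rw [LinearIndependent.pair_iff' (hr 0 zero_mem_UI).1.ne_zero]
    intro a ha
    exact one_ne_zero (hne 1 one_mem_UI 0 zero_mem_UI a ha.symm)
  obtain ⟨Γ₀, b, hi₀, hra₀, hb, h0₀, ⟨a, ha, h1₀⟩, hq₀⟩ := exists_adapted_basis hW hQ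
    (hmem 0 zero_mem_UI).1 (hmem 1 one_mem_UI).1 (hmem 0 zero_mem_UI).2 (hmem 1 one_mem_UI).2 hli
  -- The end points divide the conic into two arcs, distinguished by the sign of y₀y₁. Injectivity
  -- keeps the curve away from its end points at inner parameters, so the sign is constant; a
  -- reflection of the middle coordinate makes it positive.
  have hpos : ∃ (Γ : R3 →ₗ[ℝ] V4) (G : V4 →ₗ[ℝ] R3), Function.Injective Γ ∧
      LinearMap.range Γ = W ∧ Γ (ver 0) = γ 0 ∧ Γ (ver 1) = a • γ 1 ∧ (∀ y, Q (Γ y) = b * cq y) ∧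
      (∀ x, G (Γ x) = x) ∧ ∀ t ∈ Set.Ioo (0 : ℝ) 1, 0 < G (γ t) 0 * G (γ t) 1 := by
    obtain ⟨G, hG⟩ := exists_left_inverse hi₀
    have hy : ContDiff ℝ ∞ fun t => G (γ t) := contDiff_lin_comp G hγ
    have hcont : Continuous fun t => G (γ t) 0 * G (γ t) 1 :=
      ((contDiff_pi.1 hy 0).mul (contDiff_pi.1 hy 1)).continuous
    have hnz : ∀ t ∈ Set.Ioo (0 : ℝ) 1, G (γ t) 0 * G (γ t) 1 ≠ 0 := by
      intro t ht h0
      have htU := Ioo_subset_UI ht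
      obtain ⟨y, hy⟩ : γ t ∈ LinearMap.range Γ₀ := hra₀ ▸ (hmem t htU).1
      have hq := hq₀ y
      rw [hy, (hmem t htU).2, cq_apply] at hq
      rw [← hy, hG] at h0
      have hq' : y 1 * y 1 - y 0 * y 2 = 0 := by simpa [hb] using hq.symm
      have hy1 : y 1 = 0 := by
        rcases mul_eq_zero.1 h0 with h | h
        · rw [h] at hq'; simpa using hq'
        · exact h
      have hy02 : y 0 * y 2 = 0 := by rw [hy1] at hq'; linarith
      rcases mul_eq_zero.1 hy02 with h | h
      · have e : y = y 2 • ver 1 := by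
          rw [ver_one]; exact ext3 (by simp [h]) (by simp [hy1]) (by simp)
        rw [e, map_smul, h1₀, smul_smul] at hy
        exact ht.2.ne (hne t htU 1 one_mem_UI _ hy.symm)
      · have e : y = y 0 • ver 0 := by
          rw [ver_zero]; exact ext3 (by simp) (by simp [hy1]) (by simp [h])
        rw [e, map_smul, h0₀] at hy
        exact ht.1.ne' (hne t htU 0 zero_mem_UI _ hy.symm)
    have hsign : (∀ t ∈ Set.Ioo (0 : ℝ) 1, 0 < G (γ t) 0 * G (γ t) 1) ∨
        ∀ t ∈ Set.Ioo (0 : ℝ) 1, G (γ t) 0 * G (γ t) 1 < 0 := by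
      by_contra hcon
      push Not at hcon
      obtain ⟨⟨s, hs, hs'⟩, t, ht, ht'⟩ := hcon
      obtain ⟨u, hu, hu0⟩ := isPreconnected_Ioo.intermediate_value hs ht hcont.continuousOn
        (show (0 : ℝ) ∈ Set.Icc _ _ from ⟨hs', ht'⟩)
      exact hnz u hu hu0
    rcases hsign with hsign | hsign
    · exact ⟨Γ₀, G, hi₀, hra₀, h0₀, h1₀, hq₀, hG, hsign⟩
    · let F : R3 →ₗ[ℝ] R3 := LinearMap.pi
        ![LinearMap.proj 0, -LinearMap.proj 1, LinearMap.proj 2]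
      have hF0 : ∀ x, F x 0 = x 0 := fun x => rfl
      have hF1 : ∀ x, F x 1 = - x 1 := fun x => rfl
      have hF2 : ∀ x, F x 2 = x 2 := fun x => rfl
      have hFF : ∀ x, F (F x) = x := fun x =>
        ext3 (by rw [hF0, hF0]) (by rw [hF1, hF1, neg_neg]) (by rw [hF2, hF2])
      have hFv0 : F (ver 0) = ver 0 :=
        ext3 (hF0 _) (by rw [hF1]; simp) (hF2 _)
      have hFv1 : F (ver 1) = ver 1 :=
        ext3 (hF0 _) (by rw [hF1]; simp) (hF2 _)
      refine ⟨Γ₀ ∘ₗ F, F ∘ₗ G, ?_, ?_, ?_, ?_, ?_, ?_, ?_⟩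
      · intro x y hxy
        have := congrArg F (hi₀ hxy)
        rwa [hFF, hFF] at this
      · rw [LinearMap.range_comp_of_range_eq_top, hra₀]
        exact LinearMap.range_eq_top.2 fun x => ⟨F x, hFF x⟩
      · rw [LinearMap.comp_apply, hFv0, h0₀]
      · rw [LinearMap.comp_apply, hFv1, h1₀]
      · intro y
        rw [LinearMap.comp_apply, hq₀, cq_apply, cq_apply, hF0, hF1, hF2]
        ring
      · intro x
        rw [LinearMap.comp_apply, LinearMap.comp_apply, hG, hFF]
      · intro t ht
        have := hsign t ht
        rw [LinearMap.comp_apply, hF0, hF1]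
        linarith
  obtain ⟨Γ, G, hi, hra, h0, h1, hq, hG, hp⟩ := hpos
  have hy : ContDiff ℝ ∞ fun t => G (γ t) := contDiff_lin_comp G hγ
  have hcy := contDiff_pi.1 hy
  have hΓG : ∀ t ∈ UI, Γ (G (γ t)) = γ t ∧ G (γ t) 1 * G (γ t) 1 = G (γ t) 0 * G (γ t) 2 := by
    intro t ht
    obtain ⟨y, hy⟩ : γ t ∈ LinearMap.range Γ := hra ▸ (hmem t ht).1
    have hqy := hq y
    rw [hy, (hmem t ht).2, cq_apply] at hqy
    rw [← hy, hG]
    have hq' : y 1 * y 1 - y 0 * y 2 = 0 := by simpa [hb] using hqy.symm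
    exact ⟨rfl, by linarith⟩
  have hG0 : G (γ 0) = ver 0 := by rw [← h0, hG]
  have hG1 : a • G (γ 1) = ver 1 := by rw [← map_smul, ← h1, hG]
  have hG1' : G (γ 1) = a⁻¹ • ver 1 := by rw [← hG1, smul_smul, inv_mul_cancel₀ ha, one_smul]
  -- On the conic y₀(y₀ + 2y₁ + y₂) = (y₀ + y₁)², and y₀, y₁ have the same sign.
  have hsne : ∀ t ∈ UI, G (γ t) 0 + 2 * G (γ t) 1 + G (γ t) 2 ≠ 0 := by
    intro t ht
    rcases eq_or_lt_of_le ht.1 with rfl | ht0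
    · rw [hG0]; simp
    rcases eq_or_lt_of_le ht.2 with rfl | ht1
    · rw [hG1']; simp [ha]
    have hpt := hp t ⟨ht0, ht1⟩
    obtain ⟨_, hct⟩ := hΓG t ht
    intro hz
    have h2 : (G (γ t) 0 + G (γ t) 1) ^ 2 = 0 := by
      linear_combination G (γ t) 0 * hz + hct
    have h3 : G (γ t) 0 + G (γ t) 1 = 0 := by simpa using h2
    have h4 : G (γ t) 1 = - G (γ t) 0 := by linarith
    rw [h4] at hpt
    nlinarith [mul_self_nonneg (G (γ t) 0)]
  have hparam : ∀ t ∈ UI, (G (γ t) 1 + G (γ t) 2) / (G (γ t) 0 + 2 * G (γ t) 1 + G (γ t) 2) ∈ UI ∧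
      Represents (Γ (ver ((G (γ t) 1 + G (γ t) 2) /
        (G (γ t) 0 + 2 * G (γ t) 1 + G (γ t) 2)))) (c t) := by
    intro t ht
    have hs := hsne t ht
    obtain ⟨hg, hct⟩ := hΓG t ht
    have hve : G (γ t) = (G (γ t) 0 + 2 * G (γ t) 1 + G (γ t) 2) •
        ver ((G (γ t) 1 + G (γ t) 2) / (G (γ t) 0 + 2 * G (γ t) 1 + G (γ t) 2)) := by
      apply ext3
      · simp only [Pi.smul_apply, smul_eq_mul, ver_apply_zero]
        field_simp
        linear_combination -hct
      · simp only [Pi.smul_apply, smul_eq_mul, ver_apply_one]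
        have hq := div_mul_cancel₀ (G (γ t) 1 + G (γ t) 2) hs
        apply mul_left_cancel₀ hs
        generalize (G (γ t) 1 + G (γ t) 2) / (G (γ t) 0 + 2 * G (γ t) 1 + G (γ t) 2) = q at hq ⊢
        linear_combination hct - ((1 - q) * (G (γ t) 0 + 2 * G (γ t) 1 + G (γ t) 2)
          - (G (γ t) 1 + G (γ t) 2)) * hq
      · simp only [Pi.smul_apply, smul_eq_mul, ver_apply_two]
        field_simp
        linear_combination -hct
    constructor
    · rcases eq_or_lt_of_le ht.1 with rfl | ht0
      · rw [hG0]; simp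
      rcases eq_or_lt_of_le ht.2 with rfl | ht1
      · rw [hG1']; simp [ha]
      have hpt := hp t ⟨ht0, ht1⟩
      set y := G (γ t)
      have hy0 : y 0 ≠ 0 := fun h => by rw [h, zero_mul] at hpt; exact lt_irrefl _ hpt
      have hs' : 0 < y 0 * (y 0 + 2 * y 1 + y 2) := by
        have : y 0 * (y 0 + 2 * y 1 + y 2) = (y 0 + y 1) ^ 2 := by linear_combination -hct
        rw [this]
        have : y 0 + y 1 ≠ 0 := by
          intro h
          have h4 : y 1 = - y 0 := by linarith
          rw [h4] at hpt
          nlinarith [mul_self_nonneg (y 0)]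
        positivity
      have hn : 0 ≤ y 0 * (y 1 + y 2) := by nlinarith [mul_self_nonneg (y 1)]
      have hn' : y 0 * (y 1 + y 2) ≤ y 0 * (y 0 + 2 * y 1 + y 2) := by
        nlinarith [mul_self_nonneg (y 0)]
      have hdiv : (y 1 + y 2) / (y 0 + 2 * y 1 + y 2) =
          (y 0 * (y 1 + y 2)) / (y 0 * (y 0 + 2 * y 1 + y 2)) := by
        rw [mul_div_mul_left _ _ hy0]
      rw [hdiv]
      exact ⟨div_nonneg hn hs'.le, (div_le_one hs').2 hn'⟩
    · refine (hr t ht).1.of_smul_eq hs ?_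
      rw [← map_smul, ← hve, hg]
  refine ⟨Γ, hi, hra, ?_, ?_, fun t ht => ⟨_, (hparam t ht).1, (hparam t ht).2⟩, ?_⟩
  · rw [h0]; exact (hr 0 zero_mem_UI).1
  · rw [h1]; exact (hr 1 one_mem_UI).1.smul ha
  · have hcr : ContinuousOn (fun t => (G (γ t) 1 + G (γ t) 2) /
        (G (γ t) 0 + 2 * G (γ t) 1 + G (γ t) 2)) UI :=
      ((hcy 1).add (hcy 2)).continuous.continuousOn.div
        (((hcy 0).add (contDiff_const.mul (hcy 1))).add (hcy 2)).continuous.continuousOn hsne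
    have hiv := intermediate_value_Icc zero_le_one hcr
    intro t' ht'
    have e0 : (G (γ 0) 1 + G (γ 0) 2) / (G (γ 0) 0 + 2 * G (γ 0) 1 + G (γ 0) 2) = 0 := by
      rw [hG0]; simp
    have e1 : (G (γ 1) 1 + G (γ 1) 2) / (G (γ 1) 0 + 2 * G (γ 1) 1 + G (γ 1) 2) = 1 := by
      rw [hG1']; simp [ha]
    rw [e0, e1] at hiv
    obtain ⟨t, ht, hte⟩ := hiv ht'
    refine ⟨t, ht, ?_⟩
    have := (hparam t ht).2
    rwa [show (G (γ t) 1 + G (γ t) 2) / (G (γ t) 0 + 2 * G (γ t) 1 + G (γ t) 2) = t' from hte]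
      at this

/-! ### Partial derivatives of a lift -/

theorem hasDerivAt_partial₁ {F : ℝ → ℝ → V4}
    (hF : ContDiff ℝ ∞ fun p : ℝ × ℝ => F p.1 p.2) (u v : ℝ) :
    HasDerivAt (fun s => F s v) (partial₁ F u v) u := by
  have : ContDiff ℝ ∞ fun s => F s v := hF.comp (contDiff_id.prodMk contDiff_const)
  exact (this.differentiable (by simp) u).hasDerivAt

theorem hasDerivAt_partial₂ {F : ℝ → ℝ → V4}
    (hF : ContDiff ℝ ∞ fun p : ℝ × ℝ => F p.1 p.2) (u v : ℝ) :
    HasDerivAt (fun s => F u s) (partial₂ F u v) v := by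
  have : ContDiff ℝ ∞ fun s => F u s := hF.comp (contDiff_const.prodMk contDiff_id)
  exact (this.differentiable (by simp) v).hasDerivAt

theorem partial₁_eq {F : ℝ → ℝ → V4}
    (hF : ContDiff ℝ ∞ fun p : ℝ × ℝ => F p.1 p.2) (u v : ℝ) :
    partial₁ F u v = fderiv ℝ (fun p : ℝ × ℝ => F p.1 p.2) (u, v) (1, 0) := by
  have h := (hF.differentiable (by simp) (u, v)).hasFDerivAt.comp_hasDerivAt u
    ((hasDerivAt_id u).prodMk (hasDerivAt_const u v))
  exact h.deriv

theorem partial₂_eq {F : ℝ → ℝ → V4}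
    (hF : ContDiff ℝ ∞ fun p : ℝ × ℝ => F p.1 p.2) (u v : ℝ) :
    partial₂ F u v = fderiv ℝ (fun p : ℝ × ℝ => F p.1 p.2) (u, v) (0, 1) := by
  have h := (hF.differentiable (by simp) (u, v)).hasFDerivAt.comp_hasDerivAt v
    ((hasDerivAt_const v u).prodMk (hasDerivAt_id v))
  exact h.deriv

theorem contDiff_fderiv_lift {F : ℝ → ℝ → V4}
    (hF : ContDiff ℝ ∞ fun p : ℝ × ℝ => F p.1 p.2) :
    ContDiff ℝ ∞ (fderiv ℝ fun p : ℝ × ℝ => F p.1 p.2) :=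
  hF.fderiv_right (by simp)

theorem contDiff_partial₁ {F : ℝ → ℝ → V4}
    (hF : ContDiff ℝ ∞ fun p : ℝ × ℝ => F p.1 p.2) :
    ContDiff ℝ ∞ fun p : ℝ × ℝ => partial₁ F p.1 p.2 := by
  simp only [partial₁_eq hF]
  exact (contDiff_fderiv_lift hF).clm_apply contDiff_const

theorem partial₁₂_eq {F : ℝ → ℝ → V4}
    (hF : ContDiff ℝ ∞ fun p : ℝ × ℝ => F p.1 p.2) (u v : ℝ) : partial₁₂ F u v =
    fderiv ℝ (fderiv ℝ fun p : ℝ × ℝ => F p.1 p.2) (u, v) (1, 0) (0, 1) := by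
  have h := ((contDiff_fderiv_lift hF).differentiable (by simp) (u, v)).hasFDerivAt.comp_hasDerivAt
    u ((hasDerivAt_id u).prodMk (hasDerivAt_const u v))
  have h2 := h.clm_apply (hasDerivAt_const u ((0 : ℝ), (1 : ℝ)))
  simp only [map_zero, add_zero] at h2
  rw [partial₁₂]
  simp only [partial₂_eq hF]
  exact h2.deriv

theorem hasDerivAt_partial₁₂ {F : ℝ → ℝ → V4}
    (hF : ContDiff ℝ ∞ fun p : ℝ × ℝ => F p.1 p.2) (u v : ℝ) :
    HasDerivAt (fun s => partial₁ F u s) (partial₁₂ F u v) v := by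
  have h := ((contDiff_fderiv_lift hF).differentiable (by simp) (u, v)).hasFDerivAt.comp_hasDerivAt
    v ((hasDerivAt_const v u).prodMk (hasDerivAt_id v))
  have h2 := h.clm_apply (hasDerivAt_const v ((1 : ℝ), (0 : ℝ)))
  simp only [map_zero, add_zero] at h2
  simp only [partial₁_eq hF]
  have hsymm : IsSymmSndFDerivAt ℝ (fun p : ℝ × ℝ => F p.1 p.2) (u, v) :=
    hF.contDiffAt.isSymmSndFDerivAt (by simpa using WithTop.coe_le_coe.2 (le_top : (2 : ℕ∞) ≤ ⊤))
  rw [partial₁₂_eq hF, hsymm.eq (1, 0) (0, 1)]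
  exact h2

theorem linearIndependent_swap₄ {a b c d : V4} (h : LinearIndependent ℝ ![a, b, c, d]) :
    LinearIndependent ℝ ![a, c, b, d] := by
  have : ![a, c, b, d] = ![a, b, c, d] ∘ (Equiv.swap (1 : Fin 4) 2) := by
    funext i
    fin_cases i <;> rfl
  rw [this]
  exact h.comp _ (Equiv.injective _)

theorem linearIndependent_swap₃ {a b c : V4} (h : LinearIndependent ℝ ![a, b, c]) :
    LinearIndependent ℝ ![a, c, b] := by
  have : ![a, c, b] = ![a, b, c] ∘ (Equiv.swap (1 : Fin 3) 2) := by
    funext i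
    fin_cases i <;> rfl
  rw [this]
  exact h.comp _ (Equiv.injective _)

/-! ### Smooth lifts of supercyclidic patches -/

/-- `F` and `S` witness that `f` is a supercyclidic patch. -/
structure IsSCLift (F : ℝ → ℝ → V4) (S : Set ℝ) (f : ℝ → ℝ → RP3) : Prop where
  smooth : ContDiff ℝ ∞ fun p : ℝ × ℝ => F p.1 p.2
  rep : ∀ u ∈ UI, ∀ v ∈ UI, Represents (F u v) (f u v)
  conj : IsConjugate F
  line₂ : ∀ u ∈ UI, (∃ W, IsConicArc (fun v => f u v) W) ∨ IsCollapsed (fun v => f u v)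
  line₁ : ∀ v ∈ UI, (∃ W, IsConicArc (fun u => f u v) W) ∨ IsCollapsed (fun u => f u v)
  fin : S.Finite
  reg : ∀ u ∈ UI \ S, ∀ v ∈ UI \ S, LinearIndependent ℝ ![F u v, partial₁ F u v, partial₂ F u v]
  cone₂ : ∀ u ∈ UI \ S, (∃ W, IsConicArc (fun v => f u v) W) ∧
    EnvelopQuadraticCone (fun v => F u v) (fun v => partial₁ F u v)
  cone₁ : ∀ v ∈ UI \ S, (∃ W, IsConicArc (fun u => f u v) W) ∧
    EnvelopQuadraticCone (fun u => F u v) (fun u => partial₂ F u v)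

theorem IsSCPatch.exists_lift {f : ℝ → ℝ → RP3} (h : IsSCPatch f) : ∃ F S, IsSCLift F S f := by
  obtain ⟨F, h1, h2, h3, h4, S, h5, h6, h7, h8⟩ := h
  exact ⟨F, S, h1.1, h1.2, h2, h3, h4, h5, h6, h7, h8⟩

theorem IsSCLift.swap {F : ℝ → ℝ → V4} {S : Set ℝ} {f : ℝ → ℝ → RP3} (h : IsSCLift F S f) :
    IsSCLift (fun u v => F v u) S (fun u v => f v u) where
  smooth := h.smooth.comp (contDiff_snd.prodMk contDiff_fst)
  rep u hu v hv := h.rep v hv u hu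
  conj u hu v hv hli := by
    have e : partial₁₂ (fun u v => F v u) u v = partial₁₂ F v u :=
      (hasDerivAt_partial₁₂ h.smooth v u).deriv
    rw [e] at hli
    exact h.conj v hv u hu (linearIndependent_swap₄ hli)
  line₂ := h.line₁
  line₁ := h.line₂
  fin := h.fin
  reg u hu v hv := linearIndependent_swap₃ (h.reg v hv u hu)
  cone₂ := h.cone₁
  cone₁ := h.cone₂

/-! ### The apex of a tangent cone -/

theorem polar_ver_eq_zero {t : ℝ} {q : R3} (h : QuadraticMap.polar cq (ver t) q = 0) :
    ∃ a b : ℝ, q = a • ver t + b • dver t := by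
  rw [polar_cq] at h
  simp at h
  refine ⟨q 0 + 2 * q 1 + q 2, -t * q 0 + (1 - 2 * t) * q 1 + (1 - t) * q 2, ?_⟩
  apply ext3
  · simp
    linear_combination (-1 : ℝ) * h
  · simp
    linear_combination (1 : ℝ) * h
  · simp
    linear_combination (-1 : ℝ) * h

/-- Both vectors lie on the tangent at `ver t`. There the polar form has radical `ver t`, because
the polar value of `dver t` with itself is 2; so only multiples of the point of contact are
conjugate to a second tangent vector. -/
theorem eq_smul_ver_of_polar {t : ℝ} {p q : R3} (hp : LinearIndependent ℝ ![ver t, p])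
    (h1 : QuadraticMap.polar cq (ver t) p = 0) (h2 : QuadraticMap.polar cq (ver t) q = 0)
    (h3 : QuadraticMap.polar cq p q = 0) : ∃ a : ℝ, q = a • ver t := by
  obtain ⟨c, d, rfl⟩ := polar_ver_eq_zero h1
  obtain ⟨a, b, rfl⟩ := polar_ver_eq_zero h2
  have hd : d ≠ 0 := by
    rintro rfl
    have := (LinearIndependent.pair_iff.1 hp) c (-1) (by simp)
    norm_num at this
  have hb : 2 * d * b = 0 := by
    rw [polar_cq] at h3
    simp at h3
    linear_combination h3
  have : b = 0 := by simpa [hd] using hb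
  exact ⟨a, by rw [this, zero_smul, add_zero]⟩

theorem finrank_V4 : Module.finrank ℝ V4 = 4 := by simp

theorem span_singleton_isCompl {V : Submodule ℝ V4} (hV : Module.finrank ℝ V = 3) {B : V4}
    (hB : B ∉ V) : IsCompl V (Submodule.span ℝ {B}) := by
  have hB0 : B ≠ 0 := fun h => hB (h ▸ V.zero_mem)
  have hd : Disjoint V (Submodule.span ℝ {B}) := by
    rw [Submodule.disjoint_def]
    intro x hx hxB
    obtain ⟨a, rfl⟩ := Submodule.mem_span_singleton.1 hxB
    by_contra hne
    have ha : a ≠ 0 := fun h => hne (by rw [h, zero_smul])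
    exact hB ((V.smul_mem_iff ha).1 hx)
  refine ⟨hd, codisjoint_iff.2 ?_⟩
  apply Submodule.eq_top_of_finrank_eq
  have := Submodule.finrank_sup_add_finrank_inf_eq V (Submodule.span ℝ {B})
  rw [hd.eq_bot, finrank_bot, hV, finrank_span_singleton hB0] at this
  rw [finrank_V4]
  omega

/-- The apex of a quadratic cone enveloped along a conic, together with the fact that the cone
restricts to a non-degenerate conic. -/
theorem IsConicArc.exists_apex {c : ℝ → RP3} {V : Submodule ℝ V4} (h : IsConicArc c V)
    {γ : ℝ → V4} (hγ : ∀ t ∈ UI, Represents (γ t) (c t)) {K : QuadraticForm ℝ V4}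
    (hK : Module.finrank ℝ (LinearMap.ker K.polarBilin) = 1) (hK0 : ∀ t ∈ UI, K (γ t) = 0) :
    ∃ B : V4, B ∉ V ∧ (∀ x, QuadraticMap.polar K B x = 0) ∧
      ∃ (Γ : R3 →ₗ[ℝ] V4) (b : ℝ), LinearMap.range Γ = V ∧ b ≠ 0 ∧ Function.Injective Γ ∧
        (∀ x y, QuadraticMap.polar K (Γ x) (Γ y) = b * QuadraticMap.polar cq x y) ∧
        ∀ t ∈ UI, ∃ (t' : ℝ) (s : ℝ), s ≠ 0 ∧ γ t = s • Γ (ver t') := by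
  obtain ⟨Γ, hi, hr, ha⟩ := h.exists_isArcOf
  have hz : ∀ t ∈ UI, (K.comp Γ) (ver t) = 0 := by
    intro t ht
    obtain ⟨s, hs, hst⟩ := ha.exists_point t ht
    obtain ⟨a, _, he⟩ := (hγ s hs).exists_smul hst
    rw [QuadraticMap.comp_apply, he, QuadraticMap.map_smul, hK0 s hs, smul_zero]
  obtain ⟨b, hb⟩ := quadraticForm_eq_of_infinite UI_infinite hz
  have hpol : ∀ x y, QuadraticMap.polar K (Γ x) (Γ y) = b * QuadraticMap.polar cq x y := by
    intro x y
    have e : ∀ x, K (Γ x) = b * cq x := hb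
    simp only [QuadraticMap.polar, ← map_add, e]
    ring
  obtain ⟨⟨B, hBk⟩, hB0, hB⟩ := finrank_eq_one_iff'.1 hK
  have hBne : B ≠ 0 := fun h => hB0 (by simp [h])
  have hBpol : ∀ x, QuadraticMap.polar K B x = 0 := by
    intro x
    rw [← QuadraticMap.polarBilin_apply_apply, LinearMap.mem_ker.1 hBk, LinearMap.zero_apply]
  -- If the cone contained the whole plane V, its polar form would pair V only with a complementary
  -- vector e. The kernel of that pairing is at least two-dimensional and would lie in the radical,
  -- which is only one point.
  have hb0 : b ≠ 0 := by
    rintro rfl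
    obtain ⟨e, he⟩ : ∃ e, e ∉ V := by
      by_contra hcon
      push Not at hcon
      have : V = ⊤ := eq_top_iff.2 fun x _ => hcon x
      have h3 := h.1
      rw [this, finrank_top, finrank_V4] at h3
      norm_num at h3
    have hc := span_singleton_isCompl h.1 he
    let ℓ : R3 →ₗ[ℝ] ℝ := (K.polarBilin.flip e) ∘ₗ Γ
    have hker : ∀ x, ℓ x = 0 → Γ x ∈ LinearMap.ker K.polarBilin := by
      intro x hx
      rw [LinearMap.mem_ker]
      apply LinearMap.ext
      intro w
      have hw : w ∈ V ⊔ Submodule.span ℝ {e} := by rw [hc.sup_eq_top]; trivial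
      obtain ⟨w1, hw1, w2, hw2, rfl⟩ := Submodule.mem_sup.1 hw
      rw [← hr] at hw1
      obtain ⟨y, rfl⟩ := hw1
      obtain ⟨a, rfl⟩ := Submodule.mem_span_singleton.1 hw2
      have hx' : QuadraticMap.polar K (Γ x) e = 0 := hx
      rw [map_add, map_smul, QuadraticMap.polarBilin_apply_apply,
        QuadraticMap.polarBilin_apply_apply, hpol, hx', zero_mul, smul_zero, add_zero,
        LinearMap.zero_apply]
    have hk : ∃ x y : R3, LinearIndependent ℝ ![x, y] ∧ ℓ x = 0 ∧ ℓ y = 0 := by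
      set p := ℓ ![1, 0, 0]
      set q := ℓ ![0, 1, 0]
      set r := ℓ ![0, 0, 1]
      have hl : ∀ x, ℓ x = x 0 * p + x 1 * q + x 2 * r := fun x => sum_basis3 ℓ x
      by_cases hp : p = 0
      · by_cases hq : q = 0
        · refine ⟨![1, 0, 0], ![0, 1, 0], ?_, by simp [hl, hp], by simp [hl, hq]⟩
          rw [LinearIndependent.pair_iff]
          intro s t hst
          have h0 := congrFun hst 0
          have h1 := congrFun hst 1
          simp at h0 h1
          exact ⟨h0, h1⟩
        · refine ⟨![1, 0, 0], ![0, -r, q], ?_, by simp [hl, hp], by simp [hl]; ring⟩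
          rw [LinearIndependent.pair_iff]
          intro s t hst
          have h0 := congrFun hst 0
          have h1 := congrFun hst 2
          simp [hq] at h0 h1
          exact ⟨h0, h1⟩
      · refine ⟨![-q, p, 0], ![-r, 0, p], ?_, by simp [hl]; ring, by simp [hl]; ring⟩
        rw [LinearIndependent.pair_iff]
        intro s t hst
        have h0 := congrFun hst 1
        have h1 := congrFun hst 2
        simp [hp] at h0 h1
        exact ⟨h0, h1⟩
    obtain ⟨x, y, hxy, hx, hy⟩ := hk
    obtain ⟨a, ha'⟩ := hB ⟨Γ x, hker x hx⟩
    obtain ⟨a', ha''⟩ := hB ⟨Γ y, hker y hy⟩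
    have e1 : a • B = Γ x := congrArg Subtype.val ha'
    have e2 : a' • B = Γ y := congrArg Subtype.val ha''
    have h0 : a' • x + (-a) • y = 0 := by
      apply hi
      rw [map_add, map_smul, map_smul, ← e1, ← e2, map_zero]
      module
    have := (LinearIndependent.pair_iff.1 hxy) _ _ h0
    have ha0 : a = 0 := by linarith [this.2]
    rw [ha0, zero_smul] at e1
    have hx0 : x = 0 := hi (by rw [← e1, map_zero])
    exact hxy.ne_zero 0 hx0
  refine ⟨B, ?_, hBpol, Γ, b, hr, hb0, hi, hpol, ?_⟩
  · intro hBV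
    rw [← hr] at hBV
    obtain ⟨x, rfl⟩ := hBV
    have : x = 0 := eq_zero_of_polar_cq fun y => by
      have := hBpol (Γ y)
      rw [hpol] at this
      simpa [hb0] using this
    exact hBne (by rw [this, map_zero])
  · intro t ht
    obtain ⟨t', ht', hrt⟩ := ha.exists_param t ht
    obtain ⟨s, hs, he⟩ := hrt.exists_smul (hγ t ht)
    exact ⟨t', s, hs, he⟩

theorem isClosed_not_linearIndependent {n : ℕ} {f : ℝ → Fin n → V4} (hf : Continuous f) :
    IsClosed {t | ¬ LinearIndependent ℝ (f t)} :=
  ((isOpen_setOfPred_linearIndependent (𝕜 := ℝ) (E := V4) (ι := Fin n)).preimage hf).isClosed_compl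

theorem continuous_vec2 {f g : ℝ → V4} (hf : Continuous f) (hg : Continuous g) :
    Continuous fun t => ![f t, g t] := by
  refine continuous_pi fun i => ?_
  fin_cases i
  · exact hf
  · exact hg

theorem exists_smul_of_not_linearIndependent {x y : V4} (hx : x ≠ 0)
    (h : ¬ LinearIndependent ℝ ![x, y]) : ∃ a : ℝ, y = a • x := by
  rw [LinearIndependent.pair_iff' hx] at h
  push Not at h
  obtain ⟨a, ha⟩ := h
  exact ⟨a, ha.symm⟩

theorem not_linearIndependent_smul {x : V4} (a : ℝ) : ¬ LinearIndependent ℝ ![x, a • x] := by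
  intro h
  have := (LinearIndependent.pair_iff.1 h) a (-1) (by simp)
  norm_num at this

theorem exists_projection {p q : Submodule ℝ V4} (h : IsCompl p q) :
    ∃ π : V4 →ₗ[ℝ] V4, (∀ x, π x ∈ p) ∧ (∀ x, x - π x ∈ q) ∧ (∀ x ∈ p, π x = x) ∧
      ∀ x ∈ q, π x = 0 :=
  ⟨p.projection q h, Submodule.projection_apply_mem h, Submodule.sub_projection_mem h,
    fun _ hx => Submodule.projection_apply_of_mem_left h hx,
    fun _ hx => (Submodule.projection_apply_eq_zero_iff h).2 hx⟩

/-- Along a regular parameter line the transversal tangents pass through one point, the apex of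
the tangent cone. -/
theorem IsSCLift.exists_apex {F : ℝ → ℝ → V4} {S : Set ℝ} {f : ℝ → ℝ → RP3} (h : IsSCLift F S f)
    {u : ℝ} (hu : u ∈ UI) (huS : u ∉ S) :
    ∃ B : V4, B ≠ 0 ∧ ∀ v ∈ UI, ∃ a b : ℝ, partial₁ F u v = a • F u v + b • B := by
  obtain ⟨⟨V, hV⟩, K, hK, hcone⟩ := h.cone₂ u ⟨hu, huS⟩
  obtain ⟨B, hBV, hB, Γ, b, hr, hb0, hi, hpol, hpar⟩ :=
    hV.exists_apex (γ := fun v => F u v) (h.rep u hu) hK (fun v hv => (hcone v hv).1)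
  obtain ⟨π, hπV, hπB, hπid, hπ0⟩ := exists_projection (span_singleton_isCompl hV.1 hBV)
  have hreg := hV.regular (δ := fun v => F u v)
    (h.smooth.comp (contDiff_const.prodMk contDiff_id)) (h.rep u hu)
  have hFV : ∀ v ∈ UI, F u v ∈ V := fun v hv => hV.mem hv (h.rep u hu v hv)
  have hcF₁ : Continuous fun v => partial₁ F u v :=
    ((contDiff_partial₁ h.smooth).comp (contDiff_const.prodMk contDiff_id)).continuous
  have hcF : Continuous fun v => F u v :=
    (h.smooth.comp (contDiff_const.prodMk contDiff_id)).continuous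
  have hderV : ∀ v ∈ Set.Ioo (0 : ℝ) 1, partial₂ F u v ∈ V := by
    intro v hv
    by_contra hcon
    obtain ⟨g, hg, hgV⟩ := Submodule.exists_le_ker_of_notMem hcon
    have h1 := hasDerivAt_lin g (hasDerivAt_partial₂ h.smooth u v)
    have h2 : (fun v => g (F u v)) =ᶠ[nhds v] fun _ => 0 := by
      filter_upwards [isOpen_Ioo.mem_nhds hv] with w hw using hgV (hFV w (Ioo_subset_UI hw))
    have h3 := h2.deriv_eq
    rw [h1.deriv, deriv_const] at h3
    exact hg h3
  -- Modulo the apex, the transversal derivative is conjugate to F and to the derivative along the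
  -- line. In the plane of the conic this leaves only the point of contact.
  have hkey : ∀ v ∈ UI, ¬ LinearIndependent ℝ ![F u v, π (partial₁ F u v)] := by
    refine forall_UI_of_cofinite (isClosed_not_linearIndependent (continuous_vec2 hcF
      (π.continuous_of_finiteDimensional.comp hcF₁))) h.fin ?_
    intro v hv hvS
    have hvU := Ioo_subset_UI hv
    have hreg3 := h.reg u ⟨hu, huS⟩ v ⟨hvU, hvS⟩
    obtain ⟨hc1, hc2, hc3⟩ := hcone v hvU
    have hc2' : QuadraticMap.polar K (F u v) (partial₂ F u v) = 0 := hc2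
    -- Conjugacy puts the mixed derivative into the tangent plane, which is the polar plane of F.
    have hmix : QuadraticMap.polar K (F u v) (partial₁₂ F u v) = 0 := by
      have hnl := h.conj u hu v hvU
      have hmem : partial₁₂ F u v ∈
          Submodule.span ℝ (Set.range ![F u v, partial₁ F u v, partial₂ F u v]) := by
        by_contra hcon
        apply hnl
        have h4 : LinearIndependent ℝ
            ![partial₁₂ F u v, F u v, partial₁ F u v, partial₂ F u v] :=
          linearIndependent_finCons.2 ⟨hreg3, hcon⟩
        have e : ![F u v, partial₁ F u v, partial₂ F u v, partial₁₂ F u v] =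
            ![partial₁₂ F u v, F u v, partial₁ F u v, partial₂ F u v] ∘ ![1, 2, 3, 0] := by
          funext i
          fin_cases i <;> rfl
        rw [e]
        exact h4.comp _ (by decide)
      obtain ⟨w, hw⟩ := Submodule.mem_span_range_iff_exists_fun ℝ |>.1 hmem
      rw [Fin.sum_univ_three] at hw
      rw [← hw]
      change QuadraticMap.polar K (F u v)
        (w 0 • F u v + w 1 • partial₁ F u v + w 2 • partial₂ F u v) = 0
      rw [QuadraticMap.polar_add_right, QuadraticMap.polar_add_right,
        QuadraticMap.polar_smul_right, QuadraticMap.polar_smul_right,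
        QuadraticMap.polar_smul_right, QuadraticMap.polar_self, hc1, hc3, hc2']
      simp
    -- Differentiation of the tangency condition along the line leaves this term, since the term
    -- with the mixed derivative has just been shown to vanish.
    have hd : QuadraticMap.polar K (partial₂ F u v) (partial₁ F u v) = 0 := by
      have h1 : HasDerivAt (fun w => QuadraticMap.polar K (F u w) (partial₁ F u w))
          (QuadraticMap.polar K (F u v) (partial₁₂ F u v) +
            QuadraticMap.polar K (partial₂ F u v) (partial₁ F u v)) v := by
        exact ContinuousLinearMap.hasDerivAt_of_bilinear
          (B := LinearMap.toContinuousBilinearMap K.polarBilin)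
          (fun _ => hasDerivAt_partial₂ h.smooth u v) (fun _ => hasDerivAt_partial₁₂ h.smooth u v)
      have h2 : (fun w => QuadraticMap.polar K (F u w) (partial₁ F u w)) =ᶠ[nhds v]
          fun _ => (0 : ℝ) := by
        filter_upwards [isOpen_Ioo.mem_nhds hv] with w hw using (hcone w (Ioo_subset_UI hw)).2.2
      have h3 := h2.deriv_eq
      rw [h1.deriv, deriv_const, hmix, zero_add] at h3
      exact h3
    have hπpol : ∀ x y, QuadraticMap.polar K x (π y) = QuadraticMap.polar K x y := by
      intro x y
      obtain ⟨a, ha⟩ := Submodule.mem_span_singleton.1 (hπB y)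
      have : π y = y - a • B := by rw [ha]; abel
      rw [this, QuadraticMap.polar_sub_right, QuadraticMap.polar_smul_right,
        QuadraticMap.polar_comm K x B, hB, smul_zero, sub_zero]
    obtain ⟨t', s, hs, hst⟩ := hpar v hvU
    have hst' : F u v = s • Γ (ver t') := hst
    obtain ⟨p, hp⟩ : partial₂ F u v ∈ LinearMap.range Γ := hr ▸ hderV v hv
    obtain ⟨q, hq⟩ : π (partial₁ F u v) ∈ LinearMap.range Γ := hr ▸ hπV _
    have e1 : QuadraticMap.polar cq (ver t') p = 0 := by
      have := hc2'
      rw [hst', ← hp, QuadraticMap.polar_smul_left, hpol] at this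
      simpa [hs, hb0] using this
    have e2 : QuadraticMap.polar cq (ver t') q = 0 := by
      have : QuadraticMap.polar K (F u v) (π (partial₁ F u v)) = 0 := by rw [hπpol]; exact hc3
      rw [hst', ← hq, QuadraticMap.polar_smul_left, hpol] at this
      simpa [hs, hb0] using this
    have e3 : QuadraticMap.polar cq p q = 0 := by
      have : QuadraticMap.polar K (partial₂ F u v) (π (partial₁ F u v)) = 0 := by
        rw [hπpol]; exact hd
      rw [← hp, ← hq, hpol] at this
      simpa [hb0] using this
    have hli : LinearIndependent ℝ ![ver t', p] := by
      rw [LinearIndependent.pair_iff]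
      intro a c hac
      have hregv := LinearIndependent.pair_iff.1 (hreg v hvU) (a * s⁻¹) c (by
        change (a * s⁻¹) • F u v + c • partial₂ F u v = 0
        rw [hst', ← hp, smul_smul, mul_assoc, inv_mul_cancel₀ hs, mul_one, ← map_smul, ← map_smul,
          ← map_add, hac, map_zero])
      exact ⟨by simpa [hs] using hregv.1, hregv.2⟩
    obtain ⟨a, ha⟩ := eq_smul_ver_of_polar hli e1 e2 e3
    have : π (partial₁ F u v) = (a * s⁻¹) • F u v := by
      rw [← hq, ha, hst', smul_smul, mul_assoc, inv_mul_cancel₀ hs, mul_one, map_smul]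
    rw [this]
    exact not_linearIndependent_smul _
  refine ⟨B, fun h => hBV (h ▸ V.zero_mem), fun v hv => ?_⟩
  obtain ⟨a, ha⟩ := exists_smul_of_not_linearIndependent (h.rep u hu v hv).ne_zero (hkey v hv)
  obtain ⟨b', hb'⟩ := Submodule.mem_span_singleton.1 (hπB (partial₁ F u v))
  exact ⟨a, b', by rw [hb', ← ha]; abel⟩

/-! ### Characteristic lines -/

theorem deriv_mem_of_mem {γ : ℝ → V4} {γ' : V4} {u : ℝ} {W : Submodule ℝ V4}
    (hu : u ∈ Set.Ioo (0 : ℝ) 1) (hd : HasDerivAt γ γ' u) (h : ∀ t ∈ UI, γ t ∈ W) : γ' ∈ W := by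
  by_contra hcon
  obtain ⟨g, hg, hgV⟩ := Submodule.exists_le_ker_of_notMem hcon
  have h1 := hasDerivAt_lin g hd
  have h2 : (fun v => g (γ v)) =ᶠ[nhds u] fun _ => 0 := by
    filter_upwards [isOpen_Ioo.mem_nhds hu] with w hw using hgV (h w (Ioo_subset_UI hw))
  have h3 := h2.deriv_eq
  rw [h1.deriv, deriv_const] at h3
  exact hg h3

theorem finrank_inf_of_ne {W W' : Submodule ℝ V4} (hW : Module.finrank ℝ W = 3)
    (hW' : Module.finrank ℝ W' = 3) (h : W ≠ W') :
    Module.finrank ℝ (W ⊓ W' : Submodule ℝ V4) = 2 := by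
  have h1 := Submodule.finrank_sup_add_finrank_inf_eq W W'
  have h2 : Module.finrank ℝ (W ⊔ W' : Submodule ℝ V4) ≤ 4 := by
    have := Submodule.finrank_le (W ⊔ W')
    rwa [finrank_V4] at this
  have h3 : Module.finrank ℝ (W ⊓ W' : Submodule ℝ V4) ≠ 3 := by
    intro h4
    have e1 := Submodule.eq_of_le_of_finrank_eq (inf_le_left : W ⊓ W' ≤ W) (by rw [h4, hW])
    have e2 := Submodule.eq_of_le_of_finrank_eq (inf_le_right : W ⊓ W' ≤ W') (by rw [h4, hW'])
    exact h (e1.symm.trans e2)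
  have h4 := Submodule.finrank_mono (inf_le_left : W ⊓ W' ≤ W)
  omega

/-- The apex is on the tangent of the crossing conic, hence in its plane. The coefficient of the
apex cannot vanish because every smooth lift of a conic arc is regular. -/
theorem IsSCLift.apex_mem {F : ℝ → ℝ → V4} {S : Set ℝ} {f : ℝ → ℝ → RP3} (h : IsSCLift F S f)
    {u : ℝ} (hu : u ∈ Set.Ioo (0 : ℝ) 1) {B : V4}
    (hB : ∀ v ∈ UI, ∃ a b : ℝ, partial₁ F u v = a • F u v + b • B) {v : ℝ} (hv : v ∈ UI)
    {W : Submodule ℝ V4} (hW : IsConicArc (fun u => f u v) W) :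
    B ∈ W ∧ ∃ a b : ℝ, b ≠ 0 ∧ partial₁ F u v = a • F u v + b • B := by
  obtain ⟨a, b, hab⟩ := hB v hv
  have hrep : ∀ t ∈ UI, Represents (F t v) (f t v) := fun t ht => h.rep t ht v hv
  have hreg := hW.regular (δ := fun u => F u v)
    (h.smooth.comp (contDiff_id.prodMk contDiff_const)) hrep u (Ioo_subset_UI hu)
  have hmem : ∀ t ∈ UI, F t v ∈ W := fun t ht => hW.mem ht (hrep t ht)
  have hder := deriv_mem_of_mem hu (hasDerivAt_partial₁ h.smooth u v) hmem
  have hb : b ≠ 0 := by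
    rintro rfl
    have := (LinearIndependent.pair_iff.1 hreg) a (-1) (by
      change a • F u v + (-1 : ℝ) • partial₁ F u v = 0
      rw [hab]; module)
    norm_num at this
  refine ⟨?_, a, b, hb, hab⟩
  rw [← W.smul_mem_iff hb, show b • B = partial₁ F u v - a • F u v by rw [hab]; abel]
  exact W.sub_mem hder (W.smul_mem _ (hmem u (Ioo_subset_UI hu)))

/-- The apices of the tangent cones along the other family lie in all planes of the present one.
Once two of them are distinct, they span the intersection of the two boundary planes, and every
further plane contains it. -/
theorem IsSCLift.inf_le_plane {F : ℝ → ℝ → V4} {S : Set ℝ} {f : ℝ → ℝ → RP3}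
    (h : IsSCLift F S f) {W₀ W₁ : Submodule ℝ V4} (h₀ : IsConicArc (fun u => f u 0) W₀)
    (h₁ : IsConicArc (fun u => f u 1) W₁) (hne : W₀ ≠ W₁) {v : ℝ} (hv : v ∈ UI)
    {W : Submodule ℝ V4} (hW : IsConicArc (fun u => f u v) W) : W₀ ⊓ W₁ ≤ W := by
  have hinf := infinite_Ioo_diff h.fin
  have hap : ∀ u : ℝ, ∃ B : V4, u ∈ Set.Ioo (0 : ℝ) 1 \ S → B ≠ 0 ∧
      ∀ v ∈ UI, ∃ a b : ℝ, partial₁ F u v = a • F u v + b • B := by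
    intro u
    by_cases hu : u ∈ Set.Ioo (0 : ℝ) 1 \ S
    · obtain ⟨B, hB⟩ := h.exists_apex (Ioo_subset_UI hu.1) hu.2
      exact ⟨B, fun _ => hB⟩
    · exact ⟨0, fun h => absurd h hu⟩
  choose B hB using hap
  have hmem : ∀ u ∈ Set.Ioo (0 : ℝ) 1 \ S, ∀ v ∈ UI, ∀ W, IsConicArc (fun u => f u v) W →
      B u ∈ W := fun u hu v hv W hW => (h.apex_mem hu.1 (hB u hu).2 hv hW).1
  -- If all apices coincided, infinitely many tangents of the first boundary conic would pass
  -- through one point; but the polar line of that point meets the conic in finitely many points.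
  have hli : ∃ u ∈ Set.Ioo (0 : ℝ) 1 \ S, ∃ u' ∈ Set.Ioo (0 : ℝ) 1 \ S,
      LinearIndependent ℝ ![B u, B u'] := by
    by_contra hcon
    push Not at hcon
    obtain ⟨u₀, hu₀⟩ := hinf.nonempty
    have hrep : ∀ t ∈ UI, Represents (F t 0) (f t 0) := fun t ht => h.rep t ht 0 zero_mem_UI
    obtain ⟨Γ, hi, -, ha⟩ := h₀.exists_isArcOf
    obtain ⟨-, -, -, Q, hQ, hQ0⟩ := id h₀
    have hQF : ∀ t ∈ UI, Q (F t 0) = 0 := fun t ht =>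
      (hQ0 t ht _ (by rw [(hrep t ht).submodule]; exact Submodule.mem_span_singleton_self _)).2
    have hBW := hmem u₀ hu₀ 0 zero_mem_UI W₀ h₀
    have hfin := h₀.finite_zeros hi ha (γ := fun t => F t 0) hrep (Q.polarBilin (B u₀)) (by
      by_contra hno
      push Not at hno
      exact (hB u₀ hu₀).1 (hQ _ hBW hno))
    refine hinf (hfin.subset fun u hu => ⟨Ioo_subset_UI hu.1, ?_⟩)
    obtain ⟨-, a, b, hb, hab⟩ := h.apex_mem hu.1 (hB u hu).2 zero_mem_UI h₀
    obtain ⟨c, hc⟩ := exists_smul_of_not_linearIndependent (hB u₀ hu₀).1 (hcon u₀ hu₀ u hu)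
    have hc0 : c ≠ 0 := by
      rintro rfl
      exact (hB u hu).1 (by rw [hc, zero_smul])
    have hd : QuadraticMap.polar Q (F u 0) (partial₁ F u 0) = 0 := by
      have h1 : HasDerivAt (fun w => QuadraticMap.polar Q (F w 0) (F w 0))
          (QuadraticMap.polar Q (F u 0) (partial₁ F u 0) +
            QuadraticMap.polar Q (partial₁ F u 0) (F u 0)) u :=
        ContinuousLinearMap.hasDerivAt_of_bilinear
          (B := LinearMap.toContinuousBilinearMap Q.polarBilin)
          (fun _ => hasDerivAt_partial₁ h.smooth u 0) (fun _ => hasDerivAt_partial₁ h.smooth u 0)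
      have h2 : (fun w => QuadraticMap.polar Q (F w 0) (F w 0)) =ᶠ[nhds u] fun _ => (0 : ℝ) := by
        filter_upwards [isOpen_Ioo.mem_nhds hu.1] with w hw
        rw [QuadraticMap.polar_self, hQF w (Ioo_subset_UI hw), smul_zero]
      have h3 := h2.deriv_eq
      rw [h1.deriv, deriv_const, QuadraticMap.polar_comm Q (partial₁ F u 0)] at h3
      linarith
    change QuadraticMap.polar Q (B u₀) (F u 0) = 0
    rw [hab, QuadraticMap.polar_add_right, QuadraticMap.polar_smul_right,
      QuadraticMap.polar_self, hQF u (Ioo_subset_UI hu.1), hc, QuadraticMap.polar_smul_right,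
      QuadraticMap.polar_smul_right, QuadraticMap.polar_comm] at hd
    simpa [hb, hc0] using hd
  obtain ⟨u, hu, u', hu', hBB⟩ := hli
  have hle : Submodule.span ℝ (Set.range ![B u, B u']) ≤ W₀ ⊓ W₁ := by
    rw [Submodule.span_le]
    rintro _ ⟨i, rfl⟩
    fin_cases i
    · exact ⟨hmem u hu 0 zero_mem_UI _ h₀, hmem u hu 1 one_mem_UI _ h₁⟩
    · exact ⟨hmem u' hu' 0 zero_mem_UI _ h₀, hmem u' hu' 1 one_mem_UI _ h₁⟩
  have heq := Submodule.eq_of_le_of_finrank_eq hle (by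
    rw [finrank_span_eq_card hBB, finrank_inf_of_ne h₀.1 h₁.1 hne]; rfl)
  rw [← heq, Submodule.span_le]
  rintro _ ⟨i, rfl⟩
  fin_cases i
  · exact hmem u hu v hv _ hW
  · exact hmem u' hu' v hv _ hW

theorem IsSCLift.charLine₁_eq {F : ℝ → ℝ → V4} {S : Set ℝ} {f : ℝ → ℝ → RP3}
    (h : IsSCLift F S f) {W₀ W₁ : Submodule ℝ V4} (h₀ : IsConicArc (fun u => f u 0) W₀)
    (h₁ : IsConicArc (fun u => f u 1) W₁) (hne : W₀ ≠ W₁) : charLine₁ f = W₀ ⊓ W₁ := by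
  apply le_antisymm
  · exact le_inf (sInf_le ⟨0, zero_mem_UI, h₀⟩) (sInf_le ⟨1, one_mem_UI, h₁⟩)
  · refine le_sInf ?_
    rintro W ⟨v, hv, hW⟩
    exact h.inf_le_plane h₀ h₁ hne hv hW

/-! ### Frames of generic patches -/

/-- A generic patch with its two characteristic lines. -/
structure IsSCFrame (F : ℝ → ℝ → V4) (S : Set ℝ) (f : ℝ → ℝ → RP3) (L₁ L₂ : Submodule ℝ V4) :
    Prop where
  lift : IsSCLift F S f
  rank₁ : Module.finrank ℝ L₁ = 2
  rank₂ : Module.finrank ℝ L₂ = 2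
  disj : Disjoint L₁ L₂
  edges₁ : ∃ W₀ W₁, IsConicArc (fun u => f u 0) W₀ ∧ IsConicArc (fun u => f u 1) W₁ ∧ W₀ ≠ W₁ ∧
    L₁ = W₀ ⊓ W₁
  edges₂ : ∃ W₀ W₁, IsConicArc (fun v => f 0 v) W₀ ∧ IsConicArc (fun v => f 1 v) W₁ ∧ W₀ ≠ W₁ ∧
    L₂ = W₀ ⊓ W₁

theorem IsSCFrame.swap {F : ℝ → ℝ → V4} {S : Set ℝ} {f : ℝ → ℝ → RP3} {L₁ L₂ : Submodule ℝ V4}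
    (h : IsSCFrame F S f L₁ L₂) : IsSCFrame (fun u v => F v u) S (fun u v => f v u) L₂ L₁ where
  lift := h.lift.swap
  rank₁ := h.rank₂
  rank₂ := h.rank₁
  disj := h.disj.symm
  edges₁ := h.edges₂
  edges₂ := h.edges₁

theorem IsSCLift.exists_frame {F : ℝ → ℝ → V4} {S : Set ℝ} {f : ℝ → ℝ → RP3}
    (h : IsSCLift F S f) (hg : IsGenericPatch f) :
    IsSCFrame F S f (charLine₁ f) (charLine₂ f) := by
  obtain ⟨⟨V₀, V₁, hV₀, hV₁, hV⟩, ⟨W₀, W₁, hW₀, hW₁, hW⟩, hd⟩ := hg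
  have e1 := h.charLine₁_eq hW₀ hW₁ hW
  have e2 : charLine₂ f = V₀ ⊓ V₁ := h.swap.charLine₁_eq hV₀ hV₁ hV
  exact ⟨h, by rw [e1]; exact finrank_inf_of_ne hW₀.1 hW₁.1 hW,
    by rw [e2]; exact finrank_inf_of_ne hV₀.1 hV₁.1 hV, hd, ⟨W₀, W₁, hW₀, hW₁, hW, e1⟩,
    ⟨V₀, V₁, hV₀, hV₁, hV, e2⟩⟩

theorem isCompl_of_disjoint {p q : Submodule ℝ V4} (hp : Module.finrank ℝ p = 2)
    (hq : Module.finrank ℝ q = 2) (h : Disjoint p q) : IsCompl p q := by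
  refine ⟨h, codisjoint_iff.2 (Submodule.eq_top_of_finrank_eq ?_)⟩
  have := Submodule.finrank_sup_add_finrank_inf_eq p q
  rw [h.eq_bot, finrank_bot, hp, hq] at this
  rw [finrank_V4]
  omega

/-- Coordinates in a plane through the first of two complementary lines. -/
theorem exists_plane_coord {L₁ L₂ W : Submodule ℝ V4} (h1 : Module.finrank ℝ L₁ = 2)
    (h : IsCompl L₁ L₂) (hW : Module.finrank ℝ W = 3) (hL : L₁ ≤ W) {π : V4 →ₗ[ℝ] V4}
    (hπ1 : ∀ x, π x ∈ L₁) (hπ2 : ∀ x, x - π x ∈ L₂) (hπid : ∀ x ∈ L₁, π x = x)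
    (hπ0 : ∀ x ∈ L₂, π x = 0) :
    ∃ (w : V4) (φ : V4 →ₗ[ℝ] ℝ), w ∈ L₂ ∧ w ∈ W ∧ φ w = 1 ∧ (∀ x ∈ L₁, φ x = 0) ∧
      ∀ x ∈ W, x = π x + φ x • w := by
  obtain ⟨y, hy, hyL⟩ : ∃ y ∈ W, y ∉ L₁ := by
    by_contra hcon
    push Not at hcon
    have := Submodule.finrank_mono (show W ≤ L₁ from hcon)
    omega
  set w := y - π y with hw
  have hwW : w ∈ W := W.sub_mem hy (hL (hπ1 y))
  have hw0 : w ≠ 0 := by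
    intro h0
    rw [sub_eq_zero.1 h0] at hyL
    exact hyL (hπ1 y)
  have hwL : w ∉ L₁ := fun hm => hw0 (Submodule.disjoint_def.1 h.disjoint w hm (hπ2 y))
  obtain ⟨g, hg, hgL⟩ := Submodule.exists_le_ker_of_notMem hwL
  have hspan : L₁ ⊔ Submodule.span ℝ {w} = W := by
    refine Submodule.eq_of_le_of_finrank_eq (sup_le hL ?_) ?_
    · rwa [Submodule.span_singleton_le_iff_mem]
    · have h2 := Submodule.finrank_sup_add_finrank_inf_eq L₁ (Submodule.span ℝ {w})
      have h3 : L₁ ⊓ Submodule.span ℝ {w} = ⊥ := by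
        rw [← disjoint_iff, Submodule.disjoint_span_singleton' hw0]
        exact hwL
      rw [h3, finrank_bot, h1, finrank_span_singleton hw0] at h2
      omega
  refine ⟨w, (g w)⁻¹ • g, hπ2 y, hwW, by simp [hg], fun x hx => ?_, fun x hx => ?_⟩
  · rw [LinearMap.smul_apply, LinearMap.mem_ker.1 (hgL hx), smul_zero]
  · rw [← hspan] at hx
    obtain ⟨a, ha, b, hb, rfl⟩ := Submodule.mem_sup.1 hx
    obtain ⟨c, rfl⟩ := Submodule.mem_span_singleton.1 hb
    rw [map_add, hπid a ha, map_smul, hπ0 w (hπ2 y), smul_zero, add_zero, map_add,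
      LinearMap.smul_apply, LinearMap.mem_ker.1 (hgL ha), smul_zero, zero_add, map_smul,
      LinearMap.smul_apply, smul_eq_mul, smul_eq_mul, inv_mul_cancel₀ hg, mul_one]

/-! ### Ratios of curves -/

theorem dot_self_ne_zero {x : V4} (hx : x ≠ 0) : ∑ i, x i * x i ≠ 0 := by
  intro h0
  apply hx
  funext i
  have := (Finset.sum_eq_zero_iff_of_nonneg fun i _ => mul_self_nonneg (x i)).1 h0 i
    (Finset.mem_univ i)
  exact mul_self_eq_zero.1 this

theorem dot_smul (a : ℝ) (x y : V4) : ∑ i, (a • x) i * y i = a * ∑ i, x i * y i := by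
  simp only [Pi.smul_apply, smul_eq_mul, mul_assoc, ← Finset.mul_sum]

/-- Parallel curves whose ratio has vanishing derivative are proportional. -/
theorem exists_const_ratio {E G : ℝ → V4} (hE : ContDiff ℝ ∞ E) (hG : ContDiff ℝ ∞ G)
    {x y : ℝ} (hxy : x < y) (hE0 : ∀ u ∈ Set.Ioo x y, E u ≠ 0)
    (hpar : ∀ u ∈ Set.Ioo x y, ∃ ρ : ℝ, G u = ρ • E u)
    (hder : ∀ u ∈ Set.Ioo x y, ∀ ρ r : ℝ, G u = ρ • E u →
      deriv G u = ρ • deriv E u + r • E u → r = 0) :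
    ∃ c : ℝ, ∀ u ∈ Set.Ioo x y, G u = c • E u := by
  set ρ : ℝ → ℝ := fun u => (∑ i, G u i * E u i) / ∑ i, E u i * E u i with hρ
  have hn : ContDiff ℝ ∞ fun u => ∑ i, G u i * E u i :=
    ContDiff.sum fun i _ => (contDiff_pi.1 hG i).mul (contDiff_pi.1 hE i)
  have hd : ContDiff ℝ ∞ fun u => ∑ i, E u i * E u i :=
    ContDiff.sum fun i _ => (contDiff_pi.1 hE i).mul (contDiff_pi.1 hE i)
  have hρG : ∀ u ∈ Set.Ioo x y, G u = ρ u • E u := by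
    intro u hu
    obtain ⟨r, hr⟩ := hpar u hu
    have : ρ u = r := by
      rw [hρ]
      simp only [hr, dot_smul]
      exact mul_div_cancel_right₀ _ (dot_self_ne_zero (hE0 u hu))
    rw [this, hr]
  have hρd : ∀ u ∈ Set.Ioo x y, DifferentiableAt ℝ ρ u := fun u hu =>
    (hn.differentiable (by simp) u).div (hd.differentiable (by simp) u)
      (dot_self_ne_zero (hE0 u hu))
  have hρ0 : ∀ u ∈ Set.Ioo x y, deriv ρ u = 0 := by
    intro u hu
    refine hder u hu (ρ u) _ (hρG u hu) ?_
    have h1 : G =ᶠ[nhds u] fun u => ρ u • E u := by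
      filter_upwards [isOpen_Ioo.mem_nhds hu] with w hw using hρG w hw
    rw [h1.deriv_eq, deriv_fun_smul (hρd u hu) (hE.differentiable (by simp) u)]
  obtain ⟨m, hm⟩ := Set.nonempty_Ioo.2 hxy
  refine ⟨ρ m, fun u hu => ?_⟩
  rw [hρG u hu]
  congr 1
  exact isOpen_Ioo.is_const_of_deriv_eq_zero isPreconnected_Ioo
    (fun w hw => (hρd w hw).differentiableWithinAt) (fun w hw => hρ0 w hw) hu hm

/-- Continuity excludes jumps at the exceptional points; the fundamental theorem of calculus
tolerates countably many of them. -/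
theorem const_of_deriv_eq_zero_off_finite {k : ℝ → ℝ} (hk : ContinuousOn k UI) {Z : Set ℝ}
    (hZ : Z.Finite) (h : ∀ u ∈ Set.Ioo (0 : ℝ) 1, u ∉ Z → HasDerivAt k 0 u) :
    ∀ u ∈ UI, k u = k 0 := by
  intro u hu
  have := MeasureTheory.integral_eq_of_hasDerivAt_off_countable_of_le k (fun _ => 0) hu.1
    hZ.countable (hk.mono (Set.Icc_subset_Icc_right hu.2))
    (fun x hx => h x ⟨hx.1.1, hx.1.2.trans_le hu.2⟩ hx.2) (by simp)
  simp at this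
  linarith

/-- Two functions that are proportional near all but finitely many points are proportional,
if the second one has only zeros of order at most two. -/
theorem proportional_of_locally {N D : ℝ → ℝ} (hN : ContDiff ℝ ∞ N) (hD : ContDiff ℝ ∞ D)
    {Z : Set ℝ} (hZ : Z.Finite)
    (hloc : ∀ u ∈ Set.Ioo (0 : ℝ) 1, u ∉ Z → ∃ c : ℝ, N =ᶠ[nhds u] fun t => c * D t)
    (hjet : ∀ u ∈ UI, ¬ (D u = 0 ∧ deriv D u = 0 ∧ deriv (deriv D) u = 0)) :
    ∃ k : ℝ, ∀ u ∈ UI, N u = k * D u := by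
  have hN1 := contDiff_deriv hN
  have hN2 := contDiff_deriv hN1
  have hD1 := contDiff_deriv hD
  have hD2 := contDiff_deriv hD1
  -- The quotient of N and D is replaced by the quotient of inner products of 2-jets. It equals the
  -- local factor wherever N is locally a multiple of D, and it stays continuous at the zeros of D,
  -- since the 2-jet of D never vanishes.
  set d : ℝ → ℝ := fun u => D u * D u + deriv D u * deriv D u +
    deriv (deriv D) u * deriv (deriv D) u with hd
  set n : ℝ → ℝ := fun u => N u * D u + deriv N u * deriv D u +
    deriv (deriv N) u * deriv (deriv D) u with hn
  have hd0 : ∀ u ∈ UI, d u ≠ 0 := by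
    intro u hu h0
    apply hjet u hu
    have h1 := mul_self_nonneg (D u)
    have h2 := mul_self_nonneg (deriv D u)
    have h3 := mul_self_nonneg (deriv (deriv D) u)
    have h4 : D u * D u + deriv D u * deriv D u + deriv (deriv D) u * deriv (deriv D) u = 0 := h0
    exact ⟨mul_self_eq_zero.1 (by linarith), mul_self_eq_zero.1 (by linarith),
      mul_self_eq_zero.1 (by linarith)⟩
  have hnc : Continuous n := ((hN.mul hD).add (hN1.mul hD1)).add (hN2.mul hD2) |>.continuous
  have hdc : Continuous d := ((hD.mul hD).add (hD1.mul hD1)).add (hD2.mul hD2) |>.continuous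
  have hloc2 : ∀ u ∈ Set.Ioo (0 : ℝ) 1, u ∉ Z → ∃ c : ℝ, N u = c * D u ∧
      (fun t => n t / d t) =ᶠ[nhds u] fun _ => c := by
    intro u hu huZ
    obtain ⟨c, hc⟩ := hloc u hu huZ
    refine ⟨c, hc.self_of_nhds, ?_⟩
    have hc1 : deriv N =ᶠ[nhds u] fun t => c * deriv D t := by
      refine hc.deriv.trans (Filter.Eventually.of_forall fun t => ?_)
      exact deriv_const_mul c (hD.differentiable (by simp) t)
    have hc2 : deriv (deriv N) =ᶠ[nhds u] fun t => c * deriv (deriv D) t := by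
      refine hc1.deriv.trans (Filter.Eventually.of_forall fun t => ?_)
      exact deriv_const_mul c (hD1.differentiable (by simp) t)
    filter_upwards [hc, hc1, hc2, isOpen_Ioo.mem_nhds hu] with t h1 h2 h3 h4
    rw [div_eq_iff (hd0 t (Ioo_subset_UI h4))]
    simp only [hn, hd, h1, h2, h3]
    ring
  have hconst := const_of_deriv_eq_zero_off_finite (hnc.continuousOn.div hdc.continuousOn hd0) hZ
    (fun u hu huZ => by
      obtain ⟨c, -, hc⟩ := hloc2 u hu huZ
      exact (hasDerivAt_const u c).congr_of_eventuallyEq hc)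
  refine ⟨n 0 / d 0, forall_UI_of_cofinite (isClosed_eq hN.continuous
    (continuous_const.mul hD.continuous)) hZ fun u hu huZ => ?_⟩
  obtain ⟨c, hc, hc'⟩ := hloc2 u hu huZ
  have h1 : n u / d u = c := hc'.self_of_nhds
  have h2 : n u / d u = n 0 / d 0 := hconst u (Ioo_subset_UI hu)
  rw [hc, ← h1, h2]

/-! ### Projections along the characteristic lines -/

/-- `π` is the projection onto `L₁` along `L₂`. -/
structure IsProjAlong (π : V4 →ₗ[ℝ] V4) (L₁ L₂ : Submodule ℝ V4) : Prop where
  mem : ∀ x, π x ∈ L₁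
  sub_mem : ∀ x, x - π x ∈ L₂
  fix : ∀ x ∈ L₁, π x = x
  kill : ∀ x ∈ L₂, π x = 0

theorem IsProjAlong.swap {π : V4 →ₗ[ℝ] V4} {L₁ L₂ : Submodule ℝ V4} (h : IsProjAlong π L₁ L₂) :
    IsProjAlong (LinearMap.id - π) L₂ L₁ where
  mem := h.sub_mem
  sub_mem x := by simpa using h.mem x
  fix x hx := by simp [h.kill x hx]
  kill x hx := by simp [h.fix x hx]

/-- `φ` and `π` are coordinates in the plane `W`, which contains `L₁` and the point `w` of `L₂`. -/
structure IsPlaneCoord (π : V4 →ₗ[ℝ] V4) (L₁ L₂ W : Submodule ℝ V4) (w : V4) (φ : V4 →ₗ[ℝ] ℝ) :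
    Prop where
  mem_line : w ∈ L₂
  mem_plane : w ∈ W
  one : φ w = 1
  kill : ∀ x ∈ L₁, φ x = 0
  eq : ∀ x ∈ W, x = π x + φ x • w

theorem IsPlaneCoord.scale {π : V4 →ₗ[ℝ] V4} {L₁ L₂ W : Submodule ℝ V4} {w : V4}
    {φ : V4 →ₗ[ℝ] ℝ} (h : IsPlaneCoord π L₁ L₂ W w φ) {c : ℝ} (hc : c ≠ 0) :
    IsPlaneCoord π L₁ L₂ W (c • w) (c⁻¹ • φ) where
  mem_line := L₂.smul_mem _ h.mem_line
  mem_plane := W.smul_mem _ h.mem_plane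
  one := by simp [h.one, hc]
  kill x hx := by simp [h.kill x hx]
  eq x hx := by
    rw [LinearMap.smul_apply, smul_smul, smul_eq_mul, mul_right_comm, inv_mul_cancel₀ hc, one_mul]
    exact h.eq x hx

theorem IsPlaneCoord.ne_zero {π : V4 →ₗ[ℝ] V4} {L₁ L₂ W : Submodule ℝ V4} {w : V4}
    {φ : V4 →ₗ[ℝ] ℝ} (h : IsPlaneCoord π L₁ L₂ W w φ) : w ≠ 0 := by
  rintro rfl
  simpa using h.one

namespace IsSCFrame

variable {F : ℝ → ℝ → V4} {S : Set ℝ} {f : ℝ → ℝ → RP3} {L₁ L₂ : Submodule ℝ V4}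
  {π : V4 →ₗ[ℝ] V4}

theorem isCompl (h : IsSCFrame F S f L₁ L₂) : IsCompl L₁ L₂ :=
  isCompl_of_disjoint h.rank₁ h.rank₂ h.disj

theorem exists_proj (h : IsSCFrame F S f L₁ L₂) : ∃ π, IsProjAlong π L₁ L₂ := by
  obtain ⟨π, h1, h2, h3, h4⟩ := exists_projection h.isCompl
  exact ⟨π, h1, h2, h3, h4⟩

theorem le_plane (h : IsSCFrame F S f L₁ L₂) {v : ℝ} (hv : v ∈ UI) {W : Submodule ℝ V4}
    (hW : IsConicArc (fun u => f u v) W) : L₁ ≤ W := by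
  obtain ⟨W₀, W₁, h₀, h₁, hne, rfl⟩ := h.edges₁
  exact h.lift.inf_le_plane h₀ h₁ hne hv hW

theorem exists_coord (h : IsSCFrame F S f L₁ L₂) (hπ : IsProjAlong π L₁ L₂) {v : ℝ} (hv : v ∈ UI)
    {W : Submodule ℝ V4} (hW : IsConicArc (fun u => f u v) W) :
    ∃ w φ, IsPlaneCoord π L₁ L₂ W w φ := by
  obtain ⟨w, φ, h1, h2, h3, h4, h5⟩ := exists_plane_coord h.rank₁ h.isCompl hW.1 (h.le_plane hv hW)
    hπ.mem hπ.sub_mem hπ.fix hπ.kill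
  exact ⟨w, φ, h1, h2, h3, h4, h5⟩

theorem mem (h : IsSCFrame F S f L₁ L₂) {u v : ℝ} (hu : u ∈ UI) (hv : v ∈ UI)
    {W : Submodule ℝ V4} (hW : IsConicArc (fun u => f u v) W) : F u v ∈ W :=
  hW.mem hu (h.lift.rep u hu v hv)

/-- The conic with parameter u lies in a plane through L₂, and projection along L₂ maps that plane
to a one-dimensional space. -/
theorem ruling (h : IsSCFrame F S f L₁ L₂) (hπ : IsProjAlong π L₁ L₂) {u : ℝ} (hu : u ∈ UI)
    (huS : u ∉ S) : ∃ z, ∀ v ∈ UI, ∃ a : ℝ, π (F u v) = a • z := by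
  obtain ⟨⟨V, hV⟩, -⟩ := h.lift.cone₂ u ⟨hu, huS⟩
  obtain ⟨z, φ, hz⟩ := h.swap.exists_coord hπ.swap hu hV
  refine ⟨z, fun v hv => ⟨φ (F u v), ?_⟩⟩
  have := hz.eq _ (h.swap.mem hv hu hV)
  simp only [LinearMap.sub_apply, LinearMap.id_apply] at this
  have h2 := congrArg (fun y => y - F u v + π (F u v)) this
  rw [sub_self, zero_add] at h2
  rw [h2]; abel

end IsSCFrame

theorem IsConicArc.finite_zeros' {c : ℝ → RP3} {W : Submodule ℝ V4} (h : IsConicArc c W)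
    {γ : ℝ → V4} (hγ : ∀ t ∈ UI, Represents (γ t) (c t)) (f : V4 →ₗ[ℝ] ℝ)
    (hf : ∃ x ∈ W, f x ≠ 0) : {t | t ∈ UI ∧ f (γ t) = 0}.Finite := by
  obtain ⟨Γ, hi, -, ha⟩ := h.exists_isArcOf
  exact h.finite_zeros hi ha hγ f hf

/-- Any point of the unit interval is adjacent to an interval that avoids a given finite set. -/
theorem exists_adjacent_Ioo {Z : Set ℝ} (hZ : Z.Finite) {u : ℝ} (hu : u ∈ UI) :
    ∃ x y : ℝ, x < y ∧ Set.Ioo x y ⊆ Set.Ioo 0 1 \ Z ∧ u ∈ closure (Set.Ioo x y) := by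
  have hZ' : IsClosed (Z \ {u}) := (hZ.subset Set.sdiff_subset).isClosed
  obtain ⟨ε, hε, hball⟩ := Metric.isOpen_iff.1 hZ'.isOpen_compl u (by simp)
  have key : ∀ t, |t - u| < ε → t ≠ u → t ∉ Z := fun t ht htu hZt =>
    hball (by rwa [Metric.mem_ball, Real.dist_eq]) ⟨hZt, htu⟩
  rcases lt_or_ge u 1 with h1 | h1
  · refine ⟨u, min (u + ε) 1, lt_min (by linarith) h1, fun t ht => ?_, ?_⟩
    · have := (lt_min_iff.1 ht.2)
      have h0 := ht.1
      exact ⟨⟨hu.1.trans_lt ht.1, this.2⟩, key t (by rw [abs_of_pos] <;> linarith) ht.1.ne'⟩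
    · rw [closure_Ioo (lt_min (by linarith) h1).ne]
      exact Set.left_mem_Icc.2 (lt_min (by linarith) h1).le
  · obtain rfl : u = 1 := le_antisymm hu.2 h1
    have hlt : max (1 - ε) 0 < (1 : ℝ) := max_lt (by linarith) one_pos
    refine ⟨max (1 - ε) 0, 1, hlt, fun t ht => ?_, ?_⟩
    · have := (max_lt_iff.1 ht.1)
      have h0 := ht.2
      exact ⟨⟨this.2, ht.2⟩, key t (by rw [abs_of_neg] <;> linarith) ht.2.ne⟩
    · rw [closure_Ioo hlt.ne]
      exact Set.right_mem_Icc.2 hlt.le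

theorem exists_Ioo_avoiding {Z : Set ℝ} (hZ : Z.Finite) {u : ℝ} (hu : u ∈ Set.Ioo (0 : ℝ) 1)
    (huZ : u ∉ Z) : ∃ x y : ℝ, u ∈ Set.Ioo x y ∧ Set.Ioo x y ⊆ Set.Ioo 0 1 \ Z := by
  have hopen : IsOpen (Set.Ioo (0 : ℝ) 1 \ Z) := isOpen_Ioo.sdiff hZ.isClosed
  obtain ⟨ε, hε, hball⟩ := Metric.isOpen_iff.1 hopen u ⟨hu, huZ⟩
  rw [Real.ball_eq_Ioo] at hball
  exact ⟨u - ε, u + ε, ⟨by linarith, by linarith⟩, hball⟩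

/-- A linear coordinate along a conic arc has zeros of order at most two. -/
theorem IsConicArc.jet_ne_zero {c : ℝ → RP3} {W : Submodule ℝ V4} (h : IsConicArc c W)
    {γ : ℝ → V4} (hγs : ContDiff ℝ ∞ γ) (hγ : ∀ t ∈ UI, Represents (γ t) (c t)) (f : V4 →ₗ[ℝ] ℝ)
    (hf : ∃ x ∈ W, f x ≠ 0) {u : ℝ} (hu : u ∈ UI) :
    ¬ (f (γ u) = 0 ∧ deriv (fun t => f (γ t)) u = 0 ∧
      deriv (deriv fun t => f (γ t)) u = 0) := by
  rintro ⟨z0, z1, z2⟩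
  obtain ⟨Γ, hi, hΓW, ha⟩ := h.exists_isArcOf
  obtain ⟨r, hr, hrep⟩ := h.exists_reparam hi ha
  have hvr : ContDiff ℝ ∞ fun t => ver (r t) := contDiff_ver.comp hr.1
  have hΓr : ContDiff ℝ ∞ fun t => Γ (ver (r t)) := (LinearMap.contDiff_of_finite Γ).comp hvr
  obtain ⟨m, hm, hmγ⟩ := exists_smooth_factor hγs hΓr hγ hrep
  set g : ℝ → ℝ := fun t => f (γ t) with hg
  have hgs : ContDiff ℝ ∞ g := contDiff_lin_comp f hγs
  set ℓ : R3 →ₗ[ℝ] ℝ := f ∘ₗ Γ with hℓ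
  have hr1 := contDiff_deriv hr.1
  have e0 : ∀ t ∈ UI, ℓ (ver (r t)) = m t * g t := fun t ht => by
    simp [hℓ, (hmγ t ht).2, hg]
  set ddver : R3 := ![2, -2, 2] with hdd
  have hddver : ∀ t, HasDerivAt dver ddver t := by
    intro t
    rw [hasDerivAt_pi]
    intro i
    fin_cases i
    · change HasDerivAt (fun t : ℝ => -2 * (1 - t)) 2 t
      simpa using! ((hasDerivAt_id t).const_sub 1).const_mul (-2)
    · change HasDerivAt (fun t : ℝ => 1 - 2 * t) (-2) t
      simpa using! ((hasDerivAt_id t).const_mul 2).const_sub 1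
    · change HasDerivAt (fun t : ℝ => 2 * t) 2 t
      simpa using! ((hasDerivAt_id t).const_mul 2)
  have hd0 : ∀ t, HasDerivAt (fun t => ℓ (ver (r t))) (deriv r t * ℓ (dver (r t))) t := fun t => by
    have := hasDerivAt_lin ℓ ((hasDerivAt_ver (r t)).scomp t (hr.1.differentiable (by simp) t).hasDerivAt)
    simpa [Function.comp_def] using this
  have hd1 : ∀ t, HasDerivAt (fun t => deriv r t * ℓ (dver (r t)))
      (deriv (deriv r) t * ℓ (dver (r t)) + deriv r t * (deriv r t * ℓ ddver)) t := fun t => by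
    have := hasDerivAt_lin ℓ ((hddver (r t)).scomp t (hr.1.differentiable (by simp) t).hasDerivAt)
    have h2 := (hr1.differentiable (by simp) t).hasDerivAt.mul this
    simpa [Function.comp_def] using! h2
  have hlhs : ContDiff ℝ ∞ fun t => ℓ (ver (r t)) := (LinearMap.contDiff_of_finite ℓ).comp hvr
  have hrhs : ContDiff ℝ ∞ fun t => m t * g t := hm.mul hgs
  have e1 := deriv_eq_of_eq_on_UI hlhs hrhs e0
  have e2 := deriv_eq_of_eq_on_UI (contDiff_deriv hlhs) (contDiff_deriv hrhs) e1
  have hl : deriv (fun t => ℓ (ver (r t))) = fun t => deriv r t * ℓ (dver (r t)) :=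
    funext fun t => (hd0 t).deriv
  have hm1 := contDiff_deriv hm
  have hg1 := contDiff_deriv hgs
  have hR : deriv (fun t => m t * g t) = fun t => deriv m t * g t + m t * deriv g t :=
    funext fun t => ((hm.differentiable (by simp) t).hasDerivAt.mul
      (hgs.differentiable (by simp) t).hasDerivAt).deriv
  have hR2 : deriv (fun t => deriv m t * g t + m t * deriv g t) u =
      (deriv (deriv m) u * g u + deriv m u * deriv g u) +
        (deriv m u * deriv g u + m u * deriv (deriv g) u) :=
    (((hm1.differentiable (by simp) u).hasDerivAt.mul
      (hgs.differentiable (by simp) u).hasDerivAt).add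
      ((hm.differentiable (by simp) u).hasDerivAt.mul
      (hg1.differentiable (by simp) u).hasDerivAt)).deriv
  have f0 := e0 u hu
  have f1 := e1 u hu
  have f2 := e2 u hu
  rw [hl, hR] at f1 f2
  rw [hR2, (hd1 u).deriv] at f2
  beta_reduce at f1
  have z0' : g u = 0 := z0
  rw [z0'] at f0 f1 f2
  rw [z1] at f1 f2
  rw [z2] at f2
  simp only [mul_zero, add_zero] at f0 f1 f2
  have hr0 := (hr.2.2.2 u hu).ne'
  have g1 : ℓ (dver (r u)) = 0 := by simpa [hr0] using f1
  have g2 : ℓ ddver = 0 := by simpa [hr0, g1] using f2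
  -- The standard conic is its own Taylor polynomial of degree two, so a linear form with vanishing
  -- 2-jet vanishes on all of it.
  have hz : ℓ = 0 := by
    apply lin_eq_zero_of_infinite Set.infinite_univ
    intro t _
    have : ver t = ver (r u) + (t - r u) • dver (r u) + ((t - r u) ^ 2 / 2) • ddver := by
      apply ext3 <;> simp [hdd] <;> ring
    rw [this, map_add, map_add, map_smul, map_smul, f0, g1, g2]
    simp
  obtain ⟨x, hx, hfx⟩ := hf
  rw [← hΓW] at hx
  obtain ⟨y, rfl⟩ := hx
  exact hfx (LinearMap.congr_fun hz y)

/-! ### Ratios of the projections of two conics of a family -/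

namespace IsSCFrame

variable {F : ℝ → ℝ → V4} {S : Set ℝ} {f : ℝ → ℝ → RP3} {L₁ L₂ : Submodule ℝ V4}
  {π : V4 →ₗ[ℝ] V4}

theorem exists_ne_zero_mem (h : IsSCFrame F S f L₁ L₂) : ∃ x ∈ L₁, x ≠ 0 := by
  by_contra hcon
  push Not at hcon
  have : L₁ = ⊥ := (Submodule.eq_bot_iff _).2 hcon
  have h2 := h.rank₁
  rw [this, finrank_bot] at h2
  omega

theorem finite_proj_zeros (h : IsSCFrame F S f L₁ L₂) (hπ : IsProjAlong π L₁ L₂) {v : ℝ}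
    (hv : v ∈ UI) {W : Submodule ℝ V4} (hW : IsConicArc (fun u => f u v) W) :
    {u | u ∈ UI ∧ π (F u v) = 0}.Finite := by
  obtain ⟨x, hx, hx0⟩ := h.exists_ne_zero_mem
  obtain ⟨i, hi⟩ := Function.ne_iff.1 hx0
  refine (hW.finite_zeros' (γ := fun u => F u v) (fun u hu => h.lift.rep u hu v hv)
    (LinearMap.proj i ∘ₗ π) ⟨x, h.le_plane hv hW hx, ?_⟩).subset ?_
  · simpa [hπ.fix x hx] using hi
  · rintro u ⟨hu, hu0⟩
    exact ⟨hu, by simp [hu0]⟩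

theorem finite_coord_zeros (h : IsSCFrame F S f L₁ L₂) {v : ℝ}
    (hv : v ∈ UI) {W : Submodule ℝ V4} (hW : IsConicArc (fun u => f u v) W) {w : V4}
    {φ : V4 →ₗ[ℝ] ℝ} (hc : IsPlaneCoord π L₁ L₂ W w φ) :
    {u | u ∈ UI ∧ φ (F u v) = 0}.Finite :=
  hW.finite_zeros' (γ := fun u => F u v) (fun u hu => h.lift.rep u hu v hv) φ
    ⟨w, hc.mem_plane, by simp [hc.one]⟩

theorem contDiff_line (h : IsSCFrame F S f L₁ L₂) (v : ℝ) : ContDiff ℝ ∞ fun u => F u v :=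
  h.lift.smooth.comp (contDiff_id.prodMk contDiff_const)

theorem apex_mem_line (h : IsSCFrame F S f L₁ L₂) {u : ℝ} (hu : u ∈ Set.Ioo (0 : ℝ) 1) {B : V4}
    (hB : ∀ v ∈ UI, ∃ a b : ℝ, partial₁ F u v = a • F u v + b • B) : B ∈ L₁ := by
  obtain ⟨W₀, W₁, h₀, h₁, hne, rfl⟩ := h.edges₁
  exact ⟨(h.lift.apex_mem hu hB zero_mem_UI h₀).1, (h.lift.apex_mem hu hB one_mem_UI h₁).1⟩

/-- The projections of corresponding points are parallel by `ruling`; weighted by transversal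
coordinates their ratio has derivative zero. The reason is that both tangents pass through the same
apex, which lies on L₁: a varying ratio would put the apex at the projection of the point itself,
and this happens only at finitely many parameters. -/
theorem local_ratio (h : IsSCFrame F S f L₁ L₂) (hπ : IsProjAlong π L₁ L₂) {v v' : ℝ}
    (hv : v ∈ UI) (hv' : v' ∈ UI) {W W' : Submodule ℝ V4} (hW : IsConicArc (fun u => f u v) W)
    (hW' : IsConicArc (fun u => f u v') W') {w w' : V4} {φ φ' : V4 →ₗ[ℝ] ℝ}
    (hc : IsPlaneCoord π L₁ L₂ W w φ) (hc' : IsPlaneCoord π L₁ L₂ W' w' φ') :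
    ∃ Z : Set ℝ, Z.Finite ∧
      (∀ u ∈ Set.Ioo (0 : ℝ) 1 \ Z, π (F u v) ≠ 0 ∧ φ' (F u v') ≠ 0) ∧
      ∀ x y : ℝ, x < y → Set.Ioo x y ⊆ Set.Ioo 0 1 \ Z →
        ∃ c : ℝ, c ≠ 0 ∧ ∀ u ∈ Set.Ioo x y,
          φ (F u v) • π (F u v') = c • (φ' (F u v') • π (F u v)) := by
  obtain ⟨-, -, -, Q, hQ, hQ0⟩ := id hW
  have hrep : ∀ t ∈ UI, Represents (F t v) (f t v) := fun t ht => h.lift.rep t ht v hv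
  have hQF : ∀ t ∈ UI, Q (F t v) = 0 := fun t ht =>
    (hQ0 t ht _ (by rw [(hrep t ht).submodule]; exact Submodule.mem_span_singleton_self _)).2
  have hQfin : {u | u ∈ UI ∧ Q.polarBilin w (F u v) = 0}.Finite :=
    hW.finite_zeros' (γ := fun u => F u v) hrep (Q.polarBilin w) (by
      by_contra hno
      push Not at hno
      exact hc.ne_zero (hQ _ hc.mem_plane hno))
  have hfa := h.finite_proj_zeros hπ hv hW
  have hfa' := h.finite_proj_zeros hπ hv' hW'
  have hfφ := h.finite_coord_zeros hv hW hc
  have hfφ' := h.finite_coord_zeros hv' hW' hc'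
  refine ⟨S ∪ ({u | u ∈ UI ∧ Q.polarBilin w (F u v) = 0} ∪ ({u | u ∈ UI ∧ π (F u v) = 0} ∪
    ({u | u ∈ UI ∧ π (F u v') = 0} ∪ ({u | u ∈ UI ∧ φ (F u v) = 0} ∪
      {u | u ∈ UI ∧ φ' (F u v') = 0})))),
    h.lift.fin.union (hQfin.union (hfa.union (hfa'.union (hfφ.union hfφ')))), ?_, ?_⟩
  · rintro u ⟨hu, huZ⟩
    simp only [Set.mem_union, Set.mem_ofPred_eq, not_or, not_and] at huZ
    exact ⟨huZ.2.2.1 (Ioo_subset_UI hu), huZ.2.2.2.2.2 (Ioo_subset_UI hu)⟩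
  intro x y hxy hsub
  have hZ : ∀ u ∈ Set.Ioo x y, u ∈ Set.Ioo (0 : ℝ) 1 ∧ u ∉ S ∧ QuadraticMap.polar Q w (F u v) ≠ 0 ∧
      π (F u v) ≠ 0 ∧ π (F u v') ≠ 0 ∧ φ (F u v) ≠ 0 ∧ φ' (F u v') ≠ 0 := by
    intro u hu
    obtain ⟨hu1, hu2⟩ := hsub hu
    have hU := Ioo_subset_UI hu1
    simp only [Set.mem_union, Set.mem_ofPred_eq, not_or, not_and] at hu2
    exact ⟨hu1, hu2.1, hu2.2.1 hU, hu2.2.2.1 hU, hu2.2.2.2.1 hU, hu2.2.2.2.2.1 hU,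
      hu2.2.2.2.2.2 hU⟩
  have hs := h.contDiff_line v
  have hs' := h.contDiff_line v'
  have hd : ∀ u, HasDerivAt (fun u => F u v) (partial₁ F u v) u := fun u =>
    hasDerivAt_partial₁ h.lift.smooth u v
  have hd' : ∀ u, HasDerivAt (fun u => F u v') (partial₁ F u v') u := fun u =>
    hasDerivAt_partial₁ h.lift.smooth u v'
  obtain ⟨c, hcE⟩ := exists_const_ratio (E := fun u => φ' (F u v') • π (F u v))
    (G := fun u => φ (F u v) • π (F u v'))
    ((contDiff_lin_comp φ' hs').smul (contDiff_lin_comp π hs))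
    ((contDiff_lin_comp φ hs).smul (contDiff_lin_comp π hs')) hxy
    (fun u hu => by
      obtain ⟨-, -, -, h1, -, -, h2⟩ := hZ u hu
      exact smul_ne_zero h2 h1)
    (fun u hu => by
      obtain ⟨hu1, hu2, -, h1, -, -, h2⟩ := hZ u hu
      obtain ⟨z, hz⟩ := h.ruling hπ (Ioo_subset_UI hu1) hu2
      obtain ⟨a, ha⟩ := hz v hv
      obtain ⟨a', ha'⟩ := hz v' hv'
      have ha0 : a ≠ 0 := by
        rintro rfl
        exact h1 (by rw [ha, zero_smul])
      refine ⟨φ (F u v) * a' / (φ' (F u v') * a), ?_⟩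
      rw [ha, ha', smul_smul, smul_smul, smul_smul]
      congr 1
      field_simp)
    (fun u hu ρ r hG hGd => by
      obtain ⟨hu1, hu2, hQ1, h1, -, h3, h2⟩ := hZ u hu
      have hU := Ioo_subset_UI hu1
      obtain ⟨B, hB0, hB⟩ := h.lift.exists_apex hU hu2
      have hBL := h.apex_mem_line hu1 hB
      obtain ⟨-, α, β, hβ, hαβ⟩ := h.lift.apex_mem hu1 hB hv hW
      obtain ⟨-, α', β', hβ', hαβ'⟩ := h.lift.apex_mem hu1 hB hv' hW'
      by_contra hr
      -- The apex is killed by the transversal coordinates and fixed by π, so both derivatives are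
      -- the same multiple of the curve plus a multiple of B. Comparison leaves a multiple of π (F u
      -- v) equal to a multiple of B.
      have dE : deriv (fun u => φ' (F u v') • π (F u v)) u =
          (α + α') • (φ' (F u v') • π (F u v)) + (φ' (F u v') * β) • B := by
        rw [((hasDerivAt_lin φ' (hd' u)).fun_smul (hasDerivAt_lin π (hd u))).deriv, hαβ, hαβ']
        simp only [map_add, map_smul, hc'.kill B hBL, hπ.fix B hBL, smul_eq_mul]
        module
      have dG : deriv (fun u => φ (F u v) • π (F u v')) u =
          (α + α') • (φ (F u v) • π (F u v')) + (φ (F u v) * β') • B := by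
        rw [((hasDerivAt_lin φ (hd u)).fun_smul (hasDerivAt_lin π (hd' u))).deriv, hαβ, hαβ']
        simp only [map_add, map_smul, hc.kill B hBL, hπ.fix B hBL, smul_eq_mul]
        module
      rw [dE, dG] at hGd
      have hG' : φ (F u v) • π (F u v') = ρ • (φ' (F u v') • π (F u v)) := hG
      rw [hG'] at hGd
      have key : (r * φ' (F u v')) • π (F u v) =
          (φ (F u v) * β' - ρ * (φ' (F u v') * β)) • B := by
        refine sub_eq_zero.1 (Eq.trans ?_ (sub_eq_zero.2 hGd.symm))
        module
      set κ := φ (F u v) * β' - ρ * (φ' (F u v') * β) with hκ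
      have hκ0 : κ ≠ 0 := by
        intro h0
        rw [h0, zero_smul] at key
        exact smul_ne_zero (mul_ne_zero hr h2) h1 key
      have hBa : B = (κ⁻¹ * (r * φ' (F u v'))) • π (F u v) := by
        rw [mul_smul, key, smul_smul, inv_mul_cancel₀ hκ0, one_smul]
      set σ := κ⁻¹ * (r * φ' (F u v')) with hσ
      have hσ0 : σ ≠ 0 := mul_ne_zero (inv_ne_zero hκ0) (mul_ne_zero hr h2)
      have hpd : QuadraticMap.polar Q (F u v) (partial₁ F u v) = 0 := by
        have h1 : HasDerivAt (fun w => QuadraticMap.polar Q (F w v) (F w v))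
            (QuadraticMap.polar Q (F u v) (partial₁ F u v) +
              QuadraticMap.polar Q (partial₁ F u v) (F u v)) u :=
          ContinuousLinearMap.hasDerivAt_of_bilinear
            (B := LinearMap.toContinuousBilinearMap Q.polarBilin) (fun _ => hd u) (fun _ => hd u)
        have h2 : (fun w => QuadraticMap.polar Q (F w v) (F w v)) =ᶠ[nhds u] fun _ => (0 : ℝ) := by
          filter_upwards [isOpen_Ioo.mem_nhds hu1] with w hw
          rw [QuadraticMap.polar_self, hQF w (Ioo_subset_UI hw), smul_zero]
        have h3 := h2.deriv_eq
        rw [h1.deriv, deriv_const, QuadraticMap.polar_comm Q (partial₁ F u v)] at h3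
        linarith
      rw [hαβ, hBa, QuadraticMap.polar_add_right, QuadraticMap.polar_smul_right,
        QuadraticMap.polar_self, hQF u hU, QuadraticMap.polar_smul_right,
        QuadraticMap.polar_smul_right] at hpd
      -- With B parallel to π (F u v), the tangent joins the point to its projection. As F u v = π
      -- (F u v) + φ (F u v) • w, the point w of L₂ would be conjugate to F u v too, and the choice
      -- of the exceptional set excludes that.
      have hpa : QuadraticMap.polar Q (F u v) (π (F u v)) = 0 := by
        simpa [hβ, hσ0] using hpd
      have hself : QuadraticMap.polar Q (F u v) (F u v) = 0 := by
        rw [QuadraticMap.polar_self, hQF u hU, smul_zero]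
      have hsplit : QuadraticMap.polar Q (F u v) (F u v) =
          QuadraticMap.polar Q (F u v) (π (F u v) + φ (F u v) • w) := by
        rw [← hc.eq _ (h.mem hU hv hW)]
      rw [hself, QuadraticMap.polar_add_right, hpa, QuadraticMap.polar_smul_right, zero_add,
        QuadraticMap.polar_comm] at hsplit
      exact (mul_ne_zero h3 hQ1) hsplit.symm)
  refine ⟨c, ?_, hcE⟩
  rintro rfl
  obtain ⟨m, hm⟩ := Set.nonempty_Ioo.2 hxy
  obtain ⟨-, -, -, -, h1, h2, -⟩ := hZ m hm
  have := hcE m hm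
  rw [zero_smul] at this
  exact smul_ne_zero h2 h1 this

/-- The base line does not meet the characteristic line of the other family. -/
theorem proj_base_ne_zero (h : IsSCFrame F S f L₁ L₂) (hπ : IsProjAlong π L₁ L₂) {u : ℝ}
    (hu : u ∈ UI) : π (F u 0) ≠ 0 := by
  intro h0
  obtain ⟨W₀, W₁, h₀, h₁, hne, hL⟩ := id h.edges₁
  obtain ⟨w, φ, hc⟩ := h.exists_coord hπ zero_mem_UI h₀
  have hφ0 : φ (F u 0) ≠ 0 := by
    intro h1
    have := hc.eq _ (h.mem hu zero_mem_UI h₀)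
    rw [h0, h1, zero_smul, zero_add] at this
    exact (h.lift.rep u hu 0 zero_mem_UI).ne_zero this
  -- The ratio relation extends by continuity from an adjacent interval to u. Its right side
  -- vanishes there and φ (F u 0) does not, so the whole transversal line at u lies in L₂.
  have hall : ∀ v ∈ UI, (∃ W, IsConicArc (fun u => f u v) W) → π (F u v) = 0 := by
    rintro v hv ⟨W, hW⟩
    obtain ⟨w', φ', hc'⟩ := h.exists_coord hπ hv hW
    obtain ⟨Z, hZ, -, hloc⟩ := h.local_ratio hπ zero_mem_UI hv h₀ hW hc hc'
    obtain ⟨x, y, hxy, hsub, hcl⟩ := exists_adjacent_Ioo hZ hu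
    obtain ⟨c, -, hcE⟩ := hloc x y hxy hsub
    have hs := h.contDiff_line 0
    have hs' := h.contDiff_line v
    have hclosed : IsClosed {t | φ (F t 0) • π (F t v) = c • (φ' (F t v) • π (F t 0))} :=
      isClosed_eq ((contDiff_lin_comp φ hs).smul (contDiff_lin_comp π hs')).continuous
        (((contDiff_lin_comp φ' hs').smul (contDiff_lin_comp π hs)).continuous.const_smul c)
    have := closure_minimal (fun t ht => hcE t ht) hclosed hcl
    have h2 : φ (F u 0) • π (F u v) = c • (φ' (F u v) • π (F u 0)) := this
    rw [h0, smul_zero, smul_zero] at h2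
    exact (smul_eq_zero.1 h2).resolve_left hφ0
  have hall' : ∀ v ∈ UI, π (F u v) = 0 := by
    refine forall_UI_of_cofinite (isClosed_eq (contDiff_lin_comp π (h.swap.contDiff_line u)).continuous
      continuous_const) h.lift.fin fun v hv hvS => ?_
    exact hall v (Ioo_subset_UI hv) (h.lift.cone₁ v ⟨Ioo_subset_UI hv, hvS⟩).1
  have hmem : ∀ v ∈ UI, F u v ∈ L₂ := fun v hv => by
    have := hπ.sub_mem (F u v)
    rwa [hall' v hv, sub_zero] at this
  -- A conic arc spans a plane and does not fit into L₂; a collapsed line is a point in both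
  -- boundary planes, hence on L₁ and L₂ at once.
  rcases h.lift.line₂ u hu with ⟨V, hV⟩ | hcol
  · obtain ⟨Γ, hi, hr, ha⟩ := hV.exists_isArcOf
    have : LinearMap.range Γ ≤ L₂ := by
      refine range_le_of_infinite UI_infinite fun t ht => ?_
      obtain ⟨s, hs, hst⟩ := ha.exists_point t ht
      obtain ⟨a, -, hax⟩ := (h.lift.rep u hu s hs).exists_smul hst
      rw [hax]
      exact L₂.smul_mem _ (hmem s hs)
    have h2 := Submodule.finrank_mono this
    rw [hr, hV.1, h.rank₂] at h2
    omega
  · obtain ⟨a, ha0, ha⟩ := (h.lift.rep u hu 0 zero_mem_UI).exists_smul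
      ((show f u 1 = f u 0 from hcol 1 one_mem_UI) ▸ h.lift.rep u hu 1 one_mem_UI)
    have m0 : F u 0 ∈ W₀ := h.mem hu zero_mem_UI h₀
    have m1 : F u 0 ∈ W₁ := by
      have := h.mem hu one_mem_UI h₁
      rwa [ha, W₁.smul_mem_iff ha0] at this
    exact (h.lift.rep u hu 0 zero_mem_UI).ne_zero
      (Submodule.disjoint_def.1 h.disj _ (hL ▸ ⟨m0, m1⟩) (hmem 0 zero_mem_UI))

/-- The projections of two conics of a family onto its characteristic line are related by the
coordinates transversal to it. -/
theorem global_ratio (h : IsSCFrame F S f L₁ L₂) (hπ : IsProjAlong π L₁ L₂) {v' : ℝ}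
    (hv' : v' ∈ UI) {W W' : Submodule ℝ V4} (hW : IsConicArc (fun u => f u 0) W)
    (hW' : IsConicArc (fun u => f u v') W') {w w' : V4} {φ φ' : V4 →ₗ[ℝ] ℝ}
    (hc : IsPlaneCoord π L₁ L₂ W w φ) (hc' : IsPlaneCoord π L₁ L₂ W' w' φ') :
    ∃ k : ℝ, k ≠ 0 ∧ ∀ u ∈ UI, φ (F u 0) • π (F u v') = k • (φ' (F u v') • π (F u 0)) := by
  obtain ⟨Z, hZ, hne, hloc⟩ := h.local_ratio hπ zero_mem_UI hv' hW hW' hc hc'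
  have hs := h.contDiff_line 0
  have hs' := h.contDiff_line v'
  set a : ℝ → V4 := fun u => π (F u 0) with ha
  set n : ℝ → ℝ := fun u => ∑ i, a u i * a u i with hn
  set g : ℝ → ℝ := fun u => φ' (F u v') with hg
  have has : ContDiff ℝ ∞ a := contDiff_lin_comp π hs
  have has' : ContDiff ℝ ∞ fun u => π (F u v') := contDiff_lin_comp π hs'
  have hgs : ContDiff ℝ ∞ g := contDiff_lin_comp φ' hs'
  have hns : ContDiff ℝ ∞ n :=
    ContDiff.sum fun i _ => (contDiff_pi.1 has i).mul (contDiff_pi.1 has i)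
  have hn0 : ∀ u ∈ UI, n u ≠ 0 := fun u hu => dot_self_ne_zero (h.proj_base_ne_zero hπ hu)
  -- The vector relation becomes scalar by the inner product with the base projection a. As a has no
  -- zeros, the zeros of the right side are those of a linear coordinate on a conic and have order
  -- at most two.
  have hN : ContDiff ℝ ∞ fun u => φ (F u 0) * ∑ i, π (F u v') i * a u i :=
    (contDiff_lin_comp φ hs).mul
      (ContDiff.sum fun i _ => (contDiff_pi.1 has' i).mul (contDiff_pi.1 has i))
  have hD : ContDiff ℝ ∞ fun u => g u * n u := hgs.mul hns
  have hloc2 : ∀ u ∈ Set.Ioo (0 : ℝ) 1, u ∉ Z → ∃ c : ℝ, c ≠ 0 ∧ ∀ᶠ t in nhds u,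
      φ (F t 0) • π (F t v') = c • (g t • a t) := by
    intro u hu huZ
    obtain ⟨x, y, hm, hsub⟩ := exists_Ioo_avoiding hZ hu huZ
    obtain ⟨c, hc0, hcE⟩ := hloc x y (hm.1.trans hm.2) hsub
    exact ⟨c, hc0, by filter_upwards [isOpen_Ioo.mem_nhds hm] with t ht using hcE t ht⟩
  have hdot : ∀ (t c : ℝ), φ (F t 0) • π (F t v') = c • (g t • a t) →
      φ (F t 0) * ∑ i, π (F t v') i * a t i = c * (g t * n t) := by
    intro t c ht
    rw [← dot_smul, ht, dot_smul, dot_smul]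
  obtain ⟨k, hk⟩ := proportional_of_locally hN hD hZ
    (fun u hu huZ => by
      obtain ⟨c, -, hcE⟩ := hloc2 u hu huZ
      exact ⟨c, hcE.mono fun t ht => hdot t c ht⟩)
    (fun u hu => by
      rintro ⟨z0, z1, z2⟩
      have hg1 := contDiff_deriv hgs
      have hn1 := contDiff_deriv hns
      have hR : deriv (fun t => g t * n t) = fun t => deriv g t * n t + g t * deriv n t :=
        funext fun t => ((hgs.differentiable (by simp) t).hasDerivAt.mul
          (hns.differentiable (by simp) t).hasDerivAt).deriv
      have hR2 : deriv (fun t => deriv g t * n t + g t * deriv n t) u =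
          (deriv (deriv g) u * n u + deriv g u * deriv n u) +
            (deriv g u * deriv n u + g u * deriv (deriv n) u) :=
        (((hg1.differentiable (by simp) u).hasDerivAt.mul
          (hns.differentiable (by simp) u).hasDerivAt).add
          ((hgs.differentiable (by simp) u).hasDerivAt.mul
          (hn1.differentiable (by simp) u).hasDerivAt)).deriv
      rw [hR] at z1 z2
      rw [hR2] at z2
      beta_reduce at z0 z1
      have g0 : g u = 0 := (mul_eq_zero.1 z0).resolve_right (hn0 u hu)
      rw [g0, zero_mul, add_zero] at z1
      have g1 : deriv g u = 0 := (mul_eq_zero.1 z1).resolve_right (hn0 u hu)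
      rw [g0, g1] at z2
      simp only [zero_mul, add_zero] at z2
      have g2 : deriv (deriv g) u = 0 := (mul_eq_zero.1 z2).resolve_right (hn0 u hu)
      exact hW'.jet_ne_zero hs' (fun t ht => h.lift.rep t ht v' hv') φ'
        ⟨w', hc'.mem_plane, by simp [hc'.one]⟩ hu ⟨g0, g1, g2⟩)
  have hkc : ∀ u ∈ Set.Ioo (0 : ℝ) 1, u ∉ Z →
      k ≠ 0 ∧ φ (F u 0) • π (F u v') = k • (g u • a u) := by
    intro u hu huZ
    obtain ⟨c, hc0, hcE⟩ := hloc2 u hu huZ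
    have h1 := hcE.self_of_nhds
    have h2 := hdot u c h1
    rw [hk u (Ioo_subset_UI hu)] at h2
    have h3 : k = c := mul_right_cancel₀
      (mul_ne_zero (hne u ⟨hu, huZ⟩).2 (hn0 u (Ioo_subset_UI hu))) h2
    rw [h3]
    exact ⟨hc0, h1⟩
  refine ⟨k, ?_, forall_UI_of_cofinite (isClosed_eq ?_ ?_) hZ fun u hu huZ => (hkc u hu huZ).2⟩
  · obtain ⟨u, hu⟩ := (infinite_Ioo_diff hZ).nonempty
    exact (hkc u hu.1 hu.2).1
  · exact ((contDiff_lin_comp φ hs).smul has').continuous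
  · exact (hgs.smul has).continuous.const_smul k

end IsSCFrame

theorem IsConicArc.le_of_mem {c : ℝ → RP3} {W : Submodule ℝ V4} (h : IsConicArc c W)
    {V : Submodule ℝ V4} (hV : ∀ t ∈ UI, ∃ x ∈ V, Represents x (c t)) : W ≤ V := by
  obtain ⟨Γ, -, hr, ha⟩ := h.exists_isArcOf
  rw [← hr]
  refine range_le_of_infinite UI_infinite fun t ht => ?_
  obtain ⟨s, hs, hst⟩ := ha.exists_point t ht
  obtain ⟨x, hx, hxs⟩ := hV s hs
  obtain ⟨a, -, hax⟩ := hxs.exists_smul hst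
  rw [hax]
  exact V.smul_mem _ hx

theorem IsConicArc.eq_of_mem {c : ℝ → RP3} {W : Submodule ℝ V4} (h : IsConicArc c W)
    {V : Submodule ℝ V4} (hd : Module.finrank ℝ V = 3)
    (hV : ∀ t ∈ UI, ∃ x ∈ V, Represents x (c t)) : W = V :=
  Submodule.eq_of_le_of_finrank_eq (h.le_of_mem hV) (h.1.trans hd.symm)

theorem IsConicArc.not_const {c : ℝ → RP3} {W : Submodule ℝ V4} (h : IsConicArc c W) :
    c 0 ≠ c 1 := fun h01 => zero_ne_one (h.2.1 zero_mem_UI one_mem_UI h01)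

/-! ### Standard form of supercyclidic patches -/

/-- Data of a patch with the lift `ψ y • p x + φ x • q y`, where `x` and `y` run through the
standard conic arc. -/
structure IsStd (p q : R3 →ₗ[ℝ] V4) (φ ψ : R3 →ₗ[ℝ] ℝ) : Prop where
  disj : Disjoint (LinearMap.range p) (LinearMap.range q)
  inj₁ : ∀ x, p x = 0 → φ x = 0 → x = 0
  inj₂ : ∀ y, q y = 0 → ψ y = 0 → y = 0
  start₁ : φ (ver 0) = 1
  start₂ : ψ (ver 0) = 1
  finish₁ : φ (ver 1) ≠ 0
  finish₂ : ψ (ver 1) ≠ 0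
  ne₁ : ∀ t ∈ UI, p (ver t) ≠ 0
  ne₂ : ∀ t ∈ UI, q (ver t) ≠ 0
  ne : ∀ s ∈ UI, ∀ t ∈ UI, φ (ver s) ≠ 0 ∨ ψ (ver t) ≠ 0
  li₁ : LinearIndependent ℝ ![p (ver 0), p (ver 1)]
  li₂ : LinearIndependent ℝ ![q (ver 0), q (ver 1)]

theorem IsStd.swap {p q : R3 →ₗ[ℝ] V4} {φ ψ : R3 →ₗ[ℝ] ℝ} (h : IsStd p q φ ψ) :
    IsStd q p ψ φ where
  disj := h.disj.symm
  inj₁ := h.inj₂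
  inj₂ := h.inj₁
  start₁ := h.start₂
  start₂ := h.start₁
  finish₁ := h.finish₂
  finish₂ := h.finish₁
  ne₁ := h.ne₂
  ne₂ := h.ne₁
  ne s hs t ht := (h.ne t ht s hs).symm
  li₁ := h.li₂
  li₂ := h.li₁

namespace IsSCFrame

variable {F : ℝ → ℝ → V4} {S : Set ℝ} {f : ℝ → ℝ → RP3} {L₁ L₂ : Submodule ℝ V4}
  {π : V4 →ₗ[ℝ] V4}

theorem exists_coord_at (h : IsSCFrame F S f L₁ L₂) (hπ : IsProjAlong π L₁ L₂) {v : ℝ}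
    (hv : v ∈ UI) {W : Submodule ℝ V4} (hW : IsConicArc (fun u => f u v) W) {o : V4} (ho : o ∈ W)
    (ho0 : o - π o ≠ 0) : ∃ φ, IsPlaneCoord π L₁ L₂ W (o - π o) φ ∧ φ o = 1 := by
  obtain ⟨w, φ, hc⟩ := h.exists_coord hπ hv hW
  have h1 : o - π o = φ o • w := by
    nth_rewrite 1 [hc.eq o ho]
    abel
  have h2 : φ o ≠ 0 := by
    intro h0
    rw [h0, zero_smul] at h1
    exact ho0 h1
  rw [h1]
  exact ⟨_, hc.scale h2, by simp [h2]⟩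

/-- One conic of a patch in terms of the two boundary conics through the first vertex. -/
theorem parallel_of_conic (h : IsSCFrame F S f L₁ L₂) (hπ : IsProjAlong π L₁ L₂)
    {W V : Submodule ℝ V4} (hW : IsConicArc (fun u => f u 0) W)
    {o : V4} (ho : Represents o (f 0 0)) {φ ψ : V4 →ₗ[ℝ] ℝ}
    (hφ : IsPlaneCoord π L₁ L₂ W (o - π o) φ) (hφo : φ o = 1)
    (hψ : IsPlaneCoord (LinearMap.id - π) L₂ L₁ V (π o) ψ) {u v : ℝ} (hu : u ∈ UI) (hv : v ∈ UI)
    {W' : Submodule ℝ V4} (hW' : IsConicArc (fun u => f u v) W')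
    {x y : V4} (hx : Represents x (f u 0)) (hy : Represents y (f 0 v)) (hyV : y ∈ V)
    (hx0 : φ x ≠ 0) : ∃ c : ℝ, F u v = c • (ψ y • π x + φ x • (y - π y)) := by
  obtain ⟨w', φ', hc'⟩ := h.exists_coord hπ hv hW'
  obtain ⟨k, hk, hrat⟩ := h.global_ratio hπ hv hW hW' hφ hc'
  obtain ⟨m, hm, hmx⟩ := hx.exists_smul (h.lift.rep u hu 0 zero_mem_UI)
  obtain ⟨l, hl, hlo⟩ := ho.exists_smul (h.lift.rep 0 zero_mem_UI 0 zero_mem_UI)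
  obtain ⟨n, hn, hny⟩ := hy.exists_smul (h.lift.rep 0 zero_mem_UI v hv)
  -- The ratio at u expresses the L₁-part of F u v through π x. The ratio at the vertex determines
  -- k, because the L₁-part of y is ψ y • π o.
  have r1 := hrat u hu
  rw [hmx, map_smul, map_smul, smul_eq_mul] at r1
  have r1' : φ x • π (F u v) = (k * φ' (F u v)) • π x := by
    have := congrArg (fun z => m⁻¹ • z) r1
    simp only [smul_smul] at this
    convert this using 2 <;> field_simp
  have r0 := hrat 0 zero_mem_UI
  rw [hlo, map_smul, map_smul, smul_eq_mul, hφo] at r0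
  have r0' : π (F 0 v) = (k * φ' (F 0 v)) • π o := by
    have := congrArg (fun z => l⁻¹ • z) r0
    simp only [smul_smul] at this
    rw [mul_one, inv_mul_cancel₀ hl, one_smul] at this
    rw [this]
    congr 1
    field_simp
  have e0 := hc'.eq _ (h.mem zero_mem_UI hv hW')
  have hφ0 : φ' (F 0 v) ≠ 0 := by
    intro h0
    rw [r0', h0, mul_zero, zero_smul, zero_smul, add_zero] at e0
    exact (h.lift.rep 0 zero_mem_UI v hv).ne_zero e0
  have eu := hc'.eq _ (h.mem hu hv hW')
  have q0 : φ' (F 0 v) • w' = n • (y - π y) := by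
    have h1 : F 0 v - π (F 0 v) = φ' (F 0 v) • w' := by
      nth_rewrite 1 [e0]
      abel
    rw [← h1, hny, map_smul, smul_sub]
  have p0 : (n * ψ y) • π o = (k * φ' (F 0 v)) • π o := by
    rw [← r0', hny, map_smul, mul_smul]
    have := hψ.eq y hyV
    simp only [LinearMap.sub_apply, LinearMap.id_apply] at this
    congr 1
    have h2 := congrArg (fun z => z - (y - π y)) this
    rw [add_sub_cancel_left] at h2
    rw [← h2]; abel
  have hπo : π o ≠ 0 := hψ.ne_zero
  have p0' : n * ψ y = k * φ' (F 0 v) := by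
    have := sub_eq_zero.2 p0
    rw [← sub_smul] at this
    exact sub_eq_zero.1 ((smul_eq_zero.1 this).resolve_right hπo)
  refine ⟨(φ x)⁻¹ * φ' (F u v) * (φ' (F 0 v))⁻¹ * n, ?_⟩
  have hw' : w' = ((φ' (F 0 v))⁻¹ * n) • (y - π y) := by
    rw [mul_smul, ← q0, smul_smul, inv_mul_cancel₀ hφ0, one_smul]
  have hπu : π (F u v) = ((φ x)⁻¹ * (k * φ' (F u v))) • π x := by
    rw [mul_smul, ← r1', smul_smul, inv_mul_cancel₀ hx0, one_smul]
  have hk' : k = n * ψ y * (φ' (F 0 v))⁻¹ := by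
    rw [p0']; field_simp
  nth_rewrite 1 [eu]
  rw [hπu, hw', hk', smul_add, smul_smul, smul_smul, smul_smul]
  congr 2 <;> field_simp

end IsSCFrame

/-- If φ vanished at the far end, the opposite boundary curve would be a single point. If p took
parallel values at the two ends, that curve would lie in the plane V₀. -/
theorem std_finish {f : ℝ → ℝ → RP3} {p q : R3 →ₗ[ℝ] V4} {φ ψ : R3 →ₗ[ℝ] ℝ}
    {V₀ V₁ : Submodule ℝ V4} (h₀ : Module.finrank ℝ V₀ = 3)
    (h₁ : IsConicArc (fun v => f 1 v) V₁) (hne : V₀ ≠ V₁) (hq : LinearMap.range q ≤ V₀)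
    (hp : p (ver 0) ∈ V₀) (hp0 : p (ver 0) ≠ 0) {r : ℝ → ℝ}
    (hrep : ∀ v ∈ UI, Represents (ψ (ver (r v)) • p (ver 1) + φ (ver 1) • q (ver (r v))) (f 1 v)) :
    φ (ver 1) ≠ 0 ∧ LinearIndependent ℝ ![p (ver 0), p (ver 1)] := by
  constructor
  · intro h0
    simp only [h0, zero_smul, add_zero] at hrep
    have r0 := hrep 0 zero_mem_UI
    have r1 := hrep 1 one_mem_UI
    have s0 : ψ (ver (r 0)) ≠ 0 := fun h => r0.ne_zero (by rw [h, zero_smul])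
    have s1 : ψ (ver (r 1)) ≠ 0 := fun h => r1.ne_zero (by rw [h, zero_smul])
    refine h₁.not_const (Represents.eq r0 (r1.of_smul_eq (a := ψ (ver (r 1)) / ψ (ver (r 0)))
      (div_ne_zero s1 s0) ?_))
    rw [smul_smul, div_mul_cancel₀ _ s0]
  · by_contra hli
    obtain ⟨a, ha⟩ := exists_smul_of_not_linearIndependent hp0 hli
    refine hne (h₁.eq_of_mem h₀ fun v hv => ⟨_, ?_, hrep v hv⟩).symm
    rw [ha]
    exact V₀.add_mem (V₀.smul_mem _ (V₀.smul_mem _ hp)) (V₀.smul_mem _ (hq ⟨_, rfl⟩))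

/-- The form φ is injective on the kernel of p, so that kernel is at most one-dimensional and p has
rank at least two. -/
theorem range_eq_of_rank {p : R3 →ₗ[ℝ] V4} {φ : R3 →ₗ[ℝ] ℝ} (h : ∀ x, p x = 0 → φ x = 0 → x = 0)
    {L : Submodule ℝ V4} (hL : Module.finrank ℝ L = 2) (hp : ∀ x, p x ∈ L) :
    LinearMap.range p = L := by
  have hle : LinearMap.range p ≤ L := by
    rintro _ ⟨x, rfl⟩
    exact hp x
  refine Submodule.eq_of_le_of_finrank_le hle ?_
  have h1 := LinearMap.finrank_range_add_finrank_ker p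
  have h2 : Module.finrank ℝ (LinearMap.ker p) ≤ 1 := by
    have hinj : Function.Injective (φ ∘ₗ (LinearMap.ker p).subtype) := by
      rw [← LinearMap.ker_eq_bot, LinearMap.ker_eq_bot']
      rintro ⟨x, hx⟩ hx0
      exact Subtype.ext (h x hx hx0)
    simpa using LinearMap.finrank_le_finrank_of_injective hinj
  rw [Module.finrank_fin_fun] at h1
  omega

/-- A generic supercyclidic patch in standard form, for given equations of two adjacent boundary
arcs. -/
theorem IsSCPatch.exists_std {f : ℝ → ℝ → RP3} (hf : IsSCPatch f) (hg : IsGenericPatch f)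
    {Γ₁ Γ₂ : R3 →ₗ[ℝ] V4} (i₁ : Function.Injective Γ₁) (i₂ : Function.Injective Γ₂)
    (a₁ : IsArcOf Γ₁ fun u => f u 0) (a₂ : IsArcOf Γ₂ fun v => f 0 v)
    (ho : Γ₁ (ver 0) = Γ₂ (ver 0)) :
    ∃ (p q : R3 →ₗ[ℝ] V4) (φ ψ : R3 →ₗ[ℝ] ℝ) (r₁ r₂ : ℝ → ℝ), IsStd p q φ ψ ∧
      (∀ x, Γ₁ x = p x + φ x • q (ver 0)) ∧ (∀ y, Γ₂ y = q y + ψ y • p (ver 0)) ∧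
      IsReparam r₁ ∧ IsReparam r₂ ∧
      (∀ u ∈ UI, ∀ v ∈ UI, Represents
        (ψ (ver (r₂ v)) • p (ver (r₁ u)) + φ (ver (r₁ u)) • q (ver (r₂ v))) (f u v)) ∧
      charLine₁ f = LinearMap.range p ∧ charLine₂ f = LinearMap.range q := by
  obtain ⟨F, S, hl⟩ := hf.exists_lift
  have h := hl.exists_frame hg
  obtain ⟨π, hπ⟩ := h.exists_proj
  set L₁ := charLine₁ f
  set L₂ := charLine₂ f
  obtain ⟨W₀, W₁, hW₀, hW₁, hWne, -⟩ := id h.edges₁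
  obtain ⟨V₀, V₁, hV₀, hV₁, hVne, -⟩ := id h.edges₂
  obtain ⟨r₁, hr₁, hrep₁⟩ := hW₀.exists_reparam i₁ a₁
  obtain ⟨r₂, hr₂, hrep₂⟩ := hV₀.exists_reparam i₂ a₂
  set o := Γ₁ (ver 0) with hodef
  have hoR : Represents o (f 0 0) := a₁.start
  obtain ⟨l, hl0, hlo⟩ := hoR.exists_smul (h.lift.rep 0 zero_mem_UI 0 zero_mem_UI)
  have hπo : π o ≠ 0 := by
    intro h0
    apply h.proj_base_ne_zero hπ zero_mem_UI
    rw [hlo, map_smul, h0, smul_zero]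
  have hπo' : o - π o ≠ 0 := by
    intro h0
    apply h.swap.proj_base_ne_zero hπ.swap zero_mem_UI
    simp only [LinearMap.sub_apply, LinearMap.id_apply]
    rw [hlo, map_smul, ← smul_sub, h0, smul_zero]
  have hr₁W : ∀ x, Γ₁ x ∈ W₀ := fun x => by rw [hW₀.eq_range i₁ a₁]; exact ⟨x, rfl⟩
  have hr₂V : ∀ y, Γ₂ y ∈ V₀ := fun y => by rw [hV₀.eq_range i₂ a₂]; exact ⟨y, rfl⟩
  obtain ⟨φ, hφ, hφo⟩ := h.exists_coord_at hπ zero_mem_UI hW₀ (hr₁W (ver 0)) hπo'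
  obtain ⟨ψ, hψ, hψo⟩ := h.swap.exists_coord_at hπ.swap zero_mem_UI hV₀ (hr₂V (ver 0)) (by
    rw [← ho]; simpa using hπo)
  rw [← ho] at hψ hψo
  have hoo : o - (LinearMap.id - π : V4 →ₗ[ℝ] V4) o = π o := by simp
  change IsPlaneCoord (LinearMap.id - π) L₂ L₁ V₀ (o - (LinearMap.id - π : V4 →ₗ[ℝ] V4) o) ψ at hψ
  rw [hoo] at hψ
  set p : R3 →ₗ[ℝ] V4 := π ∘ₗ Γ₁ with hp
  set q : R3 →ₗ[ℝ] V4 := (LinearMap.id - π) ∘ₗ Γ₂ with hq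
  have hp0 : p (ver 0) = π o := rfl
  have hq0 : q (ver 0) = o - π o := by simp [hq, ← ho]
  have e₁ : ∀ x, Γ₁ x = p x + (φ ∘ₗ Γ₁) x • q (ver 0) := fun x => by
    rw [hq0]; exact hφ.eq _ (hr₁W x)
  have e₂ : ∀ y, Γ₂ y = q y + (ψ ∘ₗ Γ₂) y • p (ver 0) := fun y => hψ.eq _ (hr₂V y)
  have j₁ : ∀ x, p x = 0 → (φ ∘ₗ Γ₁) x = 0 → x = 0 := fun x h1 h2 =>
    i₁ (by rw [e₁, h1, h2, zero_smul, add_zero, map_zero])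
  have j₂ : ∀ y, q y = 0 → (ψ ∘ₗ Γ₂) y = 0 → y = 0 := fun y h1 h2 =>
    i₂ (by rw [e₂, h1, h2, zero_smul, add_zero, map_zero])
  have hpR := range_eq_of_rank j₁ h.rank₁ fun x => hπ.mem (Γ₁ x)
  have hqR := range_eq_of_rank j₂ h.rank₂ fun y => hπ.sub_mem (Γ₂ y)
  have n₁ : ∀ t ∈ UI, p (ver t) ≠ 0 := by
    intro t ht h0
    obtain ⟨u, hu, rfl⟩ := hr₁.surjOn ht
    obtain ⟨m, -, hm⟩ := (hrep₁ u hu).exists_smul (h.lift.rep u hu 0 zero_mem_UI)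
    apply h.proj_base_ne_zero hπ hu
    rw [hm, map_smul]
    exact (congrArg (m • ·) h0).trans (smul_zero m)
  have n₂ : ∀ t ∈ UI, q (ver t) ≠ 0 := by
    intro t ht h0
    obtain ⟨v, hv, rfl⟩ := hr₂.surjOn ht
    obtain ⟨m, -, hm⟩ := (hrep₂ v hv).exists_smul (h.lift.rep 0 zero_mem_UI v hv)
    apply h.swap.proj_base_ne_zero hπ.swap hv
    rw [hm, map_smul]
    exact (congrArg (m • ·) h0).trans (smul_zero m)
  set H : ℝ → ℝ → V4 := fun u v => (ψ ∘ₗ Γ₂) (ver (r₂ v)) • p (ver (r₁ u)) +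
    (φ ∘ₗ Γ₁) (ver (r₁ u)) • q (ver (r₂ v)) with hH
  have cv₁ : ∀ {E : Type} [NormedAddCommGroup E] [NormedSpace ℝ E] (Γ : R3 →ₗ[ℝ] E),
      Continuous fun u => Γ (ver (r₁ u)) := fun Γ =>
    ((LinearMap.contDiff_of_finite Γ).comp (contDiff_ver.comp hr₁.1)).continuous
  have cv₂ : ∀ {E : Type} [NormedAddCommGroup E] [NormedSpace ℝ E] (Γ : R3 →ₗ[ℝ] E),
      Continuous fun u => Γ (ver (r₂ u)) := fun Γ =>
    ((LinearMap.contDiff_of_finite Γ).comp (contDiff_ver.comp hr₂.1)).continuous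
  have hz₁ : {u | u ∈ UI ∧ (φ ∘ₗ Γ₁) (ver (r₁ u)) = 0}.Finite := by
    refine (h.finite_coord_zeros zero_mem_UI hW₀ hφ).subset ?_
    rintro u ⟨hu, hu0⟩
    obtain ⟨m, -, hm⟩ := (hrep₁ u hu).exists_smul (h.lift.rep u hu 0 zero_mem_UI)
    refine ⟨hu, ?_⟩
    rw [hm, map_smul]
    exact (congrArg (m • ·) hu0).trans (smul_zero m)
  have hz₂ : {v | v ∈ UI ∧ (ψ ∘ₗ Γ₂) (ver (r₂ v)) = 0}.Finite := by
    refine (h.swap.finite_coord_zeros zero_mem_UI hV₀ hψ).subset ?_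
    rintro u ⟨hu, hu0⟩
    obtain ⟨m, -, hm⟩ := (hrep₂ u hu).exists_smul (h.lift.rep 0 zero_mem_UI u hu)
    refine ⟨hu, ?_⟩
    rw [hm, map_smul]
    exact (congrArg (m • ·) hu0).trans (smul_zero m)
  have hpm : ∀ x, p x ∈ L₁ := fun x => hπ.mem _
  have hqm : ∀ y, q y ∈ L₂ := fun y => hπ.sub_mem _
  have hc₁ : ∀ v, Continuous fun u => H u v := fun v =>
    ((cv₁ p).const_smul ((ψ ∘ₗ Γ₂) (ver (r₂ v)))).add
      ((cv₁ (φ ∘ₗ Γ₁)).smul (continuous_const (y := q (ver (r₂ v)))))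
  have hc₂ : ∀ u, Continuous fun v => H u v := fun u =>
    ((cv₂ (ψ ∘ₗ Γ₂)).smul (continuous_const (y := p (ver (r₁ u))))).add
      ((cv₂ q).const_smul ((φ ∘ₗ Γ₁) (ver (r₁ u))))
  -- The pointwise comparison requires a conic at v and φ ≠ 0 at u. Dependence is a closed
  -- condition, which removes first the exceptional v, then the exceptional u.
  have hpar : ∀ u ∈ UI, ∀ v ∈ UI, ¬ LinearIndependent ℝ ![H u v, F u v] := by
    intro u hu
    refine forall_UI_of_cofinite (isClosed_not_linearIndependent (continuous_vec2 (hc₂ u)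
      (h.swap.contDiff_line u).continuous)) h.lift.fin fun v hv hvS => ?_
    obtain ⟨W', hW'⟩ := (h.lift.cone₁ v ⟨Ioo_subset_UI hv, hvS⟩).1
    revert u
    refine forall_UI_of_cofinite (isClosed_not_linearIndependent (continuous_vec2 (hc₁ v)
      (h.contDiff_line v).continuous)) hz₁ fun u hu huz => ?_
    obtain ⟨c, hc⟩ := h.parallel_of_conic hπ hW₀ hoR hφ hφo hψ (Ioo_subset_UI hu)
      (Ioo_subset_UI hv) hW' (hrep₁ u (Ioo_subset_UI hu)) (hrep₂ v (Ioo_subset_UI hv)) (hr₂V _)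
      (fun h0 => huz ⟨Ioo_subset_UI hu, h0⟩)
    have : F u v = c • H u v := hc
    rw [this]
    exact not_linearIndependent_smul c
  have hF : ∀ u ∈ UI, ∀ v ∈ UI, H u v ≠ 0 → ∃ c : ℝ, F u v = c • H u v := fun u hu v hv h0 =>
    exists_smul_of_not_linearIndependent h0 (hpar u hu v hv)
  -- At a common zero of the two forms, the line u = u₀ would lie in L₁ and the line v = v₀ in L₂,
  -- by continuity from the parameters where H is non-zero. Their common point would then be zero.
  have hne : ∀ u ∈ UI, ∀ v ∈ UI,
      (φ ∘ₗ Γ₁) (ver (r₁ u)) ≠ 0 ∨ (ψ ∘ₗ Γ₂) (ver (r₂ v)) ≠ 0 := by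
    intro u₀ hu₀ v₀ hv₀
    by_contra hcon
    push Not at hcon
    obtain ⟨z1, z2⟩ := hcon
    have k1 : ∀ v ∈ UI, F u₀ v - π (F u₀ v) = 0 := by
      refine forall_UI_of_cofinite (isClosed_eq ((h.swap.contDiff_line u₀).continuous.sub
        (contDiff_lin_comp π (h.swap.contDiff_line u₀)).continuous) continuous_const) hz₂
        fun v hv hvz => ?_
      have hv' := Ioo_subset_UI hv
      have hHv : H u₀ v = (ψ ∘ₗ Γ₂) (ver (r₂ v)) • p (ver (r₁ u₀)) := by
        rw [hH]; simp only [z1, zero_smul, add_zero]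
      obtain ⟨c, hc⟩ := hF u₀ hu₀ v hv' (by
        rw [hHv]
        exact smul_ne_zero (fun h0 => hvz ⟨hv', h0⟩) (n₁ _ (hr₁.mem_UI hu₀)))
      rw [hc, hHv, hπ.fix _ (L₁.smul_mem _ (L₁.smul_mem _ (hpm _))), sub_self]
    have k2 : ∀ u ∈ UI, π (F u v₀) = 0 := by
      refine forall_UI_of_cofinite (isClosed_eq
        (contDiff_lin_comp π (h.contDiff_line v₀)).continuous continuous_const) hz₁
        fun u hu huz => ?_
      have hu' := Ioo_subset_UI hu
      have hHu : H u v₀ = (φ ∘ₗ Γ₁) (ver (r₁ u)) • q (ver (r₂ v₀)) := by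
        rw [hH]; simp only [z2, zero_smul, zero_add]
      obtain ⟨c, hc⟩ := hF u hu' v₀ hv₀ (by
        rw [hHu]
        exact smul_ne_zero (fun h0 => huz ⟨hu', h0⟩) (n₂ _ (hr₂.mem_UI hv₀)))
      rw [hc, hHu, hπ.kill _ (L₂.smul_mem _ (L₂.smul_mem _ (hqm _)))]
    apply (h.lift.rep u₀ hu₀ v₀ hv₀).ne_zero
    have := k1 v₀ hv₀
    rwa [k2 u₀ hu₀, sub_zero] at this
  have hH0 : ∀ u ∈ UI, ∀ v ∈ UI, H u v ≠ 0 := by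
    intro u hu v hv h0
    have hmem : (ψ ∘ₗ Γ₂) (ver (r₂ v)) • p (ver (r₁ u)) = 0 := by
      have h1 := congrArg π h0
      rw [hH] at h1
      simp only [map_add, map_smul, map_zero] at h1
      rwa [hπ.fix _ (hpm _), hπ.kill _ (hqm _), smul_zero, add_zero] at h1
    have h2 : (φ ∘ₗ Γ₁) (ver (r₁ u)) • q (ver (r₂ v)) = 0 := by
      have h1 : (ψ ∘ₗ Γ₂) (ver (r₂ v)) • p (ver (r₁ u)) +
        (φ ∘ₗ Γ₁) (ver (r₁ u)) • q (ver (r₂ v)) = 0 := h0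
      rwa [hmem, zero_add] at h1
    rcases hne u hu v hv with h3 | h3
    · exact smul_ne_zero h3 (n₂ _ (hr₂.mem_UI hv)) h2
    · exact smul_ne_zero h3 (n₁ _ (hr₁.mem_UI hu)) hmem
  have hrep : ∀ u ∈ UI, ∀ v ∈ UI, Represents (H u v) (f u v) := by
    intro u hu v hv
    obtain ⟨c, hc⟩ := hF u hu v hv (hH0 u hu v hv)
    have hR := h.lift.rep u hu v hv
    refine hR.of_smul_eq (a := c) ?_ hc.symm
    rintro rfl
    exact hR.ne_zero (by rw [hc, zero_smul])
  have hst₁ : (φ ∘ₗ Γ₁) (ver 0) = 1 := hφo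
  have hst₂ : (ψ ∘ₗ Γ₂) (ver 0) = 1 := by simpa [← ho] using hψo
  have hqV : LinearMap.range q ≤ V₀ := by
    rw [hqR]; exact h.swap.le_plane zero_mem_UI hV₀
  have hpW : LinearMap.range p ≤ W₀ := by
    rw [hpR]; exact h.le_plane zero_mem_UI hW₀
  have hpV : p (ver 0) ∈ V₀ := by rw [hp0]; exact hψ.mem_plane
  have hqW : q (ver 0) ∈ W₀ := by rw [hq0]; exact hφ.mem_plane
  have f₁ := std_finish (f := f) (p := p) (q := q) (φ := φ ∘ₗ Γ₁) (ψ := ψ ∘ₗ Γ₂) (r := r₂)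
    hV₀.1 hV₁ hVne hqV hpV (by rw [hp0]; exact hπo) fun v hv => by
      have := hrep 1 one_mem_UI v hv
      simp only [hH, hr₁.2.2.1] at this
      exact this
  have f₂ := std_finish (f := fun v u => f u v) (p := q) (q := p) (φ := ψ ∘ₗ Γ₂) (ψ := φ ∘ₗ Γ₁)
    (r := r₁) hW₀.1 hW₁ hWne hpW hqW (by rw [hq0]; exact hπo') fun u hu => by
      have := hrep u hu 1 one_mem_UI
      simp only [hH, hr₂.2.2.1] at this
      rw [add_comm]
      exact this
  refine ⟨p, q, φ ∘ₗ Γ₁, ψ ∘ₗ Γ₂, r₁, r₂, ⟨?_, j₁, j₂, hst₁, hst₂, f₁.1, f₂.1, n₁, n₂, ?_, f₁.2,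
    f₂.2⟩, e₁, e₂, hr₁, hr₂, hrep, hpR.symm, hqR.symm⟩
  · rw [hpR, hqR]; exact h.disj
  · intro s hs t ht
    obtain ⟨u, hu, rfl⟩ := hr₁.surjOn hs
    obtain ⟨v, hv, rfl⟩ := hr₂.surjOn ht
    exact hne u hu v hv

/-- The homogeneous lift given by the data of a patch in standard form. -/
noncomputable def stdLift (p q : R3 →ₗ[ℝ] V4) (φ ψ : R3 →ₗ[ℝ] ℝ) (u v : ℝ) : V4 :=
  ψ (ver v) • p (ver u) + φ (ver u) • q (ver v)

/-- The conic of the first family with second coordinate `y`. -/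
noncomputable def stdConic (p q : R3 →ₗ[ℝ] V4) (φ ψ : R3 →ₗ[ℝ] ℝ) (y : R3) : R3 →ₗ[ℝ] V4 :=
  ψ y • p + φ.smulRight (q y)

section stdLift

variable (p q : R3 →ₗ[ℝ] V4) (φ ψ : R3 →ₗ[ℝ] ℝ)

theorem stdConic_apply (x y : R3) : stdConic p q φ ψ y x = ψ y • p x + φ x • q y := rfl

theorem stdConic_swap_apply (x y : R3) : stdConic q p ψ φ x y = ψ y • p x + φ x • q y :=
  add_comm _ _

theorem stdLift_swap (u v : ℝ) : stdLift q p ψ φ v u = stdLift p q φ ψ u v := add_comm _ _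

theorem stdLift_swap' : (fun u v => stdLift p q φ ψ v u) = stdLift q p ψ φ := by
  funext u v; exact (stdLift_swap p q φ ψ v u).symm

theorem contDiff_stdLift : ContDiff ℝ ∞ fun x : ℝ × ℝ => stdLift p q φ ψ x.1 x.2 :=
  (((contDiff_lin_ver ψ).comp contDiff_snd).smul ((contDiff_lin_ver p).comp contDiff_fst)).add
    (((contDiff_lin_ver φ).comp contDiff_fst).smul ((contDiff_lin_ver q).comp contDiff_snd))

theorem partial₁_stdLift (u v : ℝ) : partial₁ (stdLift p q φ ψ) u v =
    ψ (ver v) • p (dver u) + φ (dver u) • q (ver v) :=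
  (((hasDerivAt_lin_ver p u).const_smul (ψ (ver v))).add
    ((hasDerivAt_lin_ver φ u).smul_const (q (ver v)))).deriv

theorem partial₂_stdLift (u v : ℝ) : partial₂ (stdLift p q φ ψ) u v =
    ψ (dver v) • p (ver u) + φ (ver u) • q (dver v) :=
  (((hasDerivAt_lin_ver ψ v).smul_const (p (ver u))).add
    ((hasDerivAt_lin_ver q v).const_smul (φ (ver u)))).deriv

theorem partial₁₂_stdLift (u v : ℝ) : partial₁₂ (stdLift p q φ ψ) u v =
    ψ (dver v) • p (dver u) + φ (dver u) • q (dver v) := by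
  have : (fun s => partial₂ (stdLift p q φ ψ) s v) = fun s =>
      ψ (dver v) • p (ver s) + φ (ver s) • q (dver v) :=
    funext fun s => partial₂_stdLift p q φ ψ s v
  change deriv (fun s => partial₂ (stdLift p q φ ψ) s v) u = _
  rw [this]
  exact (((hasDerivAt_lin_ver p u).const_smul (ψ (dver v))).add
    ((hasDerivAt_lin_ver φ u).smul_const (q (dver v)))).deriv

end stdLift

theorem not_linearIndependent₄ {a b c d : V4} (x y z w : ℝ)
    (h : x • a + y • b + z • c + w • d = 0) (hne : ¬ (x = 0 ∧ y = 0 ∧ z = 0 ∧ w = 0)) :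
    ¬ LinearIndependent ℝ ![a, b, c, d] := by
  intro hli
  have := Fintype.linearIndependent_iff.1 hli ![x, y, z, w] (by
    simpa [Fin.sum_univ_four] using h)
  exact hne ⟨this 0, this 1, this 2, this 3⟩

theorem linearIndependent₃ {a b c : V4}
    (h : ∀ x y z : ℝ, x • a + y • b + z • c = 0 → x = 0 ∧ y = 0 ∧ z = 0) :
    LinearIndependent ℝ ![a, b, c] := by
  rw [Fintype.linearIndependent_iff]
  intro g hg
  obtain ⟨h0, h1, h2⟩ := h (g 0) (g 1) (g 2) (by simpa [Fin.sum_univ_three] using hg)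
  intro i
  fin_cases i <;> assumption

/-! ### Data in standard form define SC-patches -/

namespace IsStd

variable {p q : R3 →ₗ[ℝ] V4} {φ ψ : R3 →ₗ[ℝ] ℝ}

theorem finrank_range_ge {p : R3 →ₗ[ℝ] V4} (h : LinearIndependent ℝ ![p (ver 0), p (ver 1)]) :
    2 ≤ Module.finrank ℝ (LinearMap.range p) := by
  have h1 := finrank_span_eq_card h
  have h2 : Submodule.span ℝ (Set.range ![p (ver 0), p (ver 1)]) ≤ LinearMap.range p := by
    rw [Submodule.span_le]
    rintro _ ⟨i, rfl⟩
    fin_cases i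
    · exact ⟨ver 0, rfl⟩
    · exact ⟨ver 1, rfl⟩
  have h3 := Submodule.finrank_mono h2
  rwa [h1, Fintype.card_fin] at h3

theorem rank₁ (h : IsStd p q φ ψ) : Module.finrank ℝ (LinearMap.range p) = 2 := by
  have h1 := finrank_range_ge h.li₁
  have h2 := finrank_range_ge h.li₂
  have h3 := Submodule.finrank_sup_add_finrank_inf_eq (LinearMap.range p) (LinearMap.range q)
  have h4 := Submodule.finrank_le (LinearMap.range p ⊔ LinearMap.range q)
  rw [h.disj.eq_bot, finrank_bot] at h3
  rw [finrank_V4] at h4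
  omega

theorem exists_ker (h : IsStd p q φ ψ) :
    ∃ n, p n = 0 ∧ φ n = 1 ∧ ∀ x, p x = 0 → x = φ x • n := by
  have h1 := LinearMap.finrank_range_add_finrank_ker p
  rw [h.rank₁, Module.finrank_fin_fun] at h1
  have h2 : LinearMap.ker p ≠ ⊥ := by
    intro h0
    rw [h0, finrank_bot] at h1
    omega
  obtain ⟨n, hn, hn0⟩ := (Submodule.ne_bot_iff _).1 h2
  have hn' : p n = 0 := hn
  have hφ : φ n ≠ 0 := fun h0 => hn0 (h.inj₁ n hn' h0)
  refine ⟨(φ n)⁻¹ • n, by simp [hn'], by simp [hφ], fun x hx => ?_⟩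
  refine sub_eq_zero.1 (h.inj₁ _ ?_ ?_)
  · simp [hx, hn']
  · simp [hφ]

theorem eq_zero_of_add (h : IsStd p q φ ψ) {x y : R3} (hxy : p x + q y = 0) :
    p x = 0 ∧ q y = 0 := by
  have h1 : p x = 0 := by
    refine Submodule.disjoint_def.1 h.disj _ ⟨x, rfl⟩ ?_
    rw [eq_neg_of_add_eq_zero_left hxy, ← map_neg]
    exact ⟨_, rfl⟩
  rw [h1, zero_add] at hxy
  exact ⟨h1, hxy⟩

theorem lift_ne_zero (h : IsStd p q φ ψ) {u v : ℝ} (hu : u ∈ UI) (hv : v ∈ UI) :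
    stdLift p q φ ψ u v ≠ 0 := by
  intro h0
  rw [stdLift, ← map_smul, ← map_smul] at h0
  obtain ⟨h1, h2⟩ := h.eq_zero_of_add h0
  rw [map_smul] at h1 h2
  rcases h.ne u hu v hv with h3 | h3
  · exact smul_ne_zero h3 (h.ne₂ v hv) h2
  · exact smul_ne_zero h3 (h.ne₁ u hu) h1

theorem conic_injective (h : IsStd p q φ ψ) {y : R3} (hy : ψ y ≠ 0) (hqy : q y ≠ 0) :
    Function.Injective (stdConic p q φ ψ y) := by
  rw [← LinearMap.ker_eq_bot, LinearMap.ker_eq_bot']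
  intro x hx
  rw [stdConic_apply, ← map_smul, ← map_smul] at hx
  obtain ⟨h1, h2⟩ := h.eq_zero_of_add hx
  rw [map_smul] at h1 h2
  exact h.inj₁ x ((smul_eq_zero.1 h1).resolve_left hy) ((smul_eq_zero.1 h2).resolve_right hqy)

theorem range_le_plane (h : IsStd p q φ ψ) {y : R3} (hy : ψ y ≠ 0) :
    LinearMap.range p ≤ LinearMap.range (stdConic p q φ ψ y) ∧
      q y ∈ LinearMap.range (stdConic p q φ ψ y) := by
  obtain ⟨n, hn, hφ, -⟩ := h.exists_ker
  constructor
  · rintro _ ⟨x, rfl⟩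
    refine ⟨(ψ y)⁻¹ • (x - φ x • n), ?_⟩
    rw [map_smul, stdConic_apply]
    simp [hn, hφ, smul_smul, inv_mul_cancel₀ hy]
  · exact ⟨n, by simp [stdConic_apply, hn, hφ]⟩

theorem isConicArc₁ (h : IsStd p q φ ψ) {f : ℝ → ℝ → RP3}
    (hf : ∀ u ∈ UI, ∀ v ∈ UI, Represents (stdLift p q φ ψ u v) (f u v)) {v : ℝ} (hv : v ∈ UI)
    (hψ : ψ (ver v) ≠ 0) :
    IsConicArc (fun u => f u v) (LinearMap.range (stdConic p q φ ψ (ver v))) :=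
  isConicArc_of_param (h.conic_injective hψ (h.ne₂ v hv)) fun u hu => hf u hu v hv

/-- Where ψ vanishes the lift is φ(u) q(v) and the line is a point; elsewhere it is an injective
linear image of the standard conic. -/
theorem line₁ (h : IsStd p q φ ψ) {f : ℝ → ℝ → RP3}
    (hf : ∀ u ∈ UI, ∀ v ∈ UI, Represents (stdLift p q φ ψ u v) (f u v)) {v : ℝ} (hv : v ∈ UI) :
    (∃ W, IsConicArc (fun u => f u v) W) ∨ IsCollapsed (fun u => f u v) := by
  by_cases hψ : ψ (ver v) = 0
  · right
    have key : ∀ u ∈ UI, Represents (q (ver v)) (f u v) := fun u hu => by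
      have h1 := hf u hu v hv
      rw [stdLift, hψ, zero_smul, zero_add] at h1
      have h2 : φ (ver u) ≠ 0 := (h.ne u hu v hv).resolve_right (by simp [hψ])
      have := h1.smul (inv_ne_zero h2)
      rwa [smul_smul, inv_mul_cancel₀ h2, one_smul] at this
    exact fun u hu => (key u hu).eq (key 0 zero_mem_UI)
  · exact Or.inl ⟨_, h.isConicArc₁ hf hv hψ⟩

/-- Division by φ(u) ψ(v) turns the lift into a sum of a function of u and a function of v, whose
mixed derivative is zero. Zeros of one form need separate relations, and both forms never vanish
together. -/
theorem conj (h : IsStd p q φ ψ) : IsConjugate (stdLift p q φ ψ) := by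
  intro u hu v hv
  rw [partial₁_stdLift, partial₂_stdLift, partial₁₂_stdLift, stdLift]
  by_cases hφ : φ (ver u) = 0
  · have hψ := (h.ne u hu v hv).resolve_left (by simp [hφ])
    refine not_linearIndependent₄ (ψ (dver v)) 0 (-ψ (ver v)) 0 ?_ (by simp [hψ])
    rw [hφ]
    module
  by_cases hψ : ψ (ver v) = 0
  · refine not_linearIndependent₄ (φ (dver u)) (-φ (ver u)) 0 0 ?_ (by simp [hφ])
    rw [hψ]
    module
  -- The coefficients come from expanding ∂u∂v (F/(φψ)) = 0 and multiplying by φ²ψ².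
  · refine not_linearIndependent₄ (φ (dver u) * ψ (dver v)) (-(φ (ver u) * ψ (dver v)))
      (-(ψ (ver v) * φ (dver u))) (φ (ver u) * ψ (ver v)) ?_ (by simp [hφ, hψ])
    module

/-- The map p projects the conic from the point n of its kernel. Point and tangent have dependent
images only where the tangent passes through n, and such points of contact lie on the polar line of
n. -/
theorem li_tangent (h : IsStd p q φ ψ) : {u | ¬ ∀ a b : ℝ,
    a • p (ver u) + b • p (dver u) = 0 → a = 0 ∧ b = 0}.Finite := by
  obtain ⟨n, hn, hφ, hker⟩ := h.exists_ker
  have hn0 : n ≠ 0 := by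
    rintro rfl
    simp at hφ
  have hℓ : cq.polarBilin n ≠ 0 := by
    intro h0
    exact hn0 (eq_zero_of_polar_cq fun y => LinearMap.congr_fun h0 y)
  refine (lin_ver_finite hℓ).subset fun u hu => ?_
  simp only [Set.mem_ofPred_eq] at hu ⊢
  by_contra hne
  apply hu
  intro a b hab
  rw [← map_smul, ← map_smul, ← map_add] at hab
  have h1 := hker _ hab
  set c := φ (a • ver u + b • dver u)
  have h2 : QuadraticMap.polar cq (ver u) (a • ver u + b • dver u) = 0 := by
    rw [QuadraticMap.polar_add_right, QuadraticMap.polar_smul_right,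
      QuadraticMap.polar_smul_right, polar_ver_ver, polar_ver_dver, smul_zero, smul_zero, add_zero]
  rw [h1, QuadraticMap.polar_smul_right, QuadraticMap.polar_comm] at h2
  have h3 : c = 0 := (mul_eq_zero.1 h2).resolve_right hne
  rw [h3, zero_smul] at h1
  exact smul_ver_add_smul_dver h1

theorem ne_zero₁ (h : IsStd p q φ ψ) : φ ≠ 0 := by
  rintro rfl
  simpa using h.start₁

/-- The apex of the tangent cone is ψ(v) q'(v) − ψ'(v) q(v), a point of L₂. The map G is the
projection from it to the parameter space of the conic. A transversal derivative projects to a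
multiple of the point of the conic at which it is taken, so the cone over the standard conic is
tangent to the patch. -/
theorem isEquiv_cone (h : IsStd p q φ ψ) {v : ℝ} (hψ : ψ (ver v) ≠ 0)
    (hq : ∀ a b : ℝ, a • q (ver v) + b • q (dver v) = 0 → a = 0 ∧ b = 0) :
    ∃ (G : V4 →ₗ[ℝ] R3), Module.finrank ℝ (LinearMap.ker G) = 1 ∧ Function.Surjective G ∧
      (∀ x, G (stdConic p q φ ψ (ver v) x) = ψ (ver v) • x) ∧
      ∀ x, G (ψ (dver v) • p x + φ x • q (dver v)) = ψ (dver v) • x := by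
  set Q := q (ver v) with hQ
  set Q' := q (dver v) with hQ'
  set s := ψ (ver v) with hs
  set s' := ψ (dver v) with hs'
  -- J parametrizes ℝ⁴ by the plane of the conic and the apex; G is the first component of its
  -- inverse.
  set J : R3 × ℝ →ₗ[ℝ] V4 := LinearMap.coprod (p + φ.smulRight (s⁻¹ • Q))
    (LinearMap.toSpanSingleton ℝ V4 (s • Q' - s' • Q)) with hJ
  have hJa : ∀ x c, J (x, c) = p x + φ x • (s⁻¹ • Q) + c • (s • Q' - s' • Q) := fun x c => by
    simp [hJ]
  have hinj : Function.Injective J := by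
    rw [← LinearMap.ker_eq_bot, LinearMap.ker_eq_bot']
    rintro ⟨x, c⟩ hxc
    have h0 : p x + q ((φ x * s⁻¹ - c * s') • ver v + (c * s) • dver v) = 0 := by
      rw [← hxc, hJa, map_add, map_smul, map_smul, ← hQ, ← hQ']
      module
    obtain ⟨h1, h2⟩ := h.eq_zero_of_add h0
    rw [map_add, map_smul, map_smul] at h2
    obtain ⟨h3, h4⟩ := hq _ _ h2
    have hc : c = 0 := (mul_eq_zero.1 h4).resolve_right hψ
    subst hc
    have hφx : φ x = 0 := by
      simpa [hψ] using h3
    rw [h.inj₁ x h1 hφx]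
    rfl
  set e := LinearEquiv.ofInjectiveOfFinrankEq J hinj (by simp) with he
  have hea : ∀ z, e z = J z := fun z => rfl
  refine ⟨LinearMap.fst ℝ R3 ℝ ∘ₗ e.symm.toLinearMap, ?_, ?_, fun x => ?_, fun x => ?_⟩
  · have hsurj : Function.Surjective (LinearMap.fst ℝ R3 ℝ ∘ₗ e.symm.toLinearMap) := by
      rw [LinearMap.coe_comp]
      exact LinearMap.fst_surjective.comp e.symm.surjective
    have := LinearMap.finrank_range_add_finrank_ker (LinearMap.fst ℝ R3 ℝ ∘ₗ e.symm.toLinearMap)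
    rw [LinearMap.range_eq_top.2 hsurj, finrank_top, finrank_V4, Module.finrank_fin_fun] at this
    omega
  · rw [LinearMap.coe_comp]
    exact LinearMap.fst_surjective.comp e.symm.surjective
  · have : stdConic p q φ ψ (ver v) x = e (s • x, 0) := by
      rw [hea, hJa, stdConic_apply, map_smul, map_smul, smul_eq_mul, zero_smul, add_zero, smul_smul,
        mul_right_comm, mul_inv_cancel₀ hψ, one_mul]
    rw [this]
    simp
  · have : s' • p x + φ x • Q' = e (s' • x, φ x * s⁻¹) := by
      have h1 : φ x = φ x * s⁻¹ * s := by rw [mul_assoc, inv_mul_cancel₀ hψ, mul_one]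
      rw [hea, hJa, map_smul, map_smul, smul_eq_mul]
      nth_rewrite 1 [h1]
      module
    rw [this]
    simp

theorem cone₁ (h : IsStd p q φ ψ) {v : ℝ} (hψ : ψ (ver v) ≠ 0)
    (hq : ∀ a b : ℝ, a • q (ver v) + b • q (dver v) = 0 → a = 0 ∧ b = 0) :
    EnvelopQuadraticCone (fun u => stdLift p q φ ψ u v)
      (fun u => partial₂ (stdLift p q φ ψ) u v) := by
  obtain ⟨G, hker, hsurj, hG1, hG2⟩ := h.isEquiv_cone hψ hq
  have hpol : ∀ x y, QuadraticMap.polar (cq.comp G) x y = QuadraticMap.polar cq (G x) (G y) :=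
    fun x y => by simp [QuadraticMap.polar]
  have hF : ∀ u, G (stdLift p q φ ψ u v) = ψ (ver v) • ver u := fun u => hG1 (ver u)
  refine ⟨cq.comp G, ?_, fun u hu => ⟨?_, ?_, ?_⟩⟩
  · have hk : LinearMap.ker (cq.comp G).polarBilin = LinearMap.ker G := ?_
    · rw [hk, hker]
    ext x
    simp only [LinearMap.mem_ker]
    constructor
    · intro hx
      refine eq_zero_of_polar_cq fun y => ?_
      obtain ⟨z, rfl⟩ := hsurj y
      rw [← hpol]
      exact LinearMap.congr_fun hx z
    · intro hx
      refine LinearMap.ext fun z => ?_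
      change QuadraticMap.polar (cq.comp G) x z = 0
      rw [hpol, hx]
      simp
  · rw [QuadraticMap.comp_apply, hF, QuadraticMap.map_smul, cq_ver, smul_zero]
  · have hd : deriv (fun u => stdLift p q φ ψ u v) u = stdConic p q φ ψ (ver v) (dver u) :=
      partial₁_stdLift p q φ ψ u v
    rw [hd, hpol, hF, hG1, QuadraticMap.polar_smul_left, QuadraticMap.polar_smul_right,
      polar_ver_dver, smul_zero, smul_zero]
  · change QuadraticMap.polar (cq.comp G) (stdLift p q φ ψ u v)
      (partial₂ (stdLift p q φ ψ) u v) = 0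
    rw [partial₂_stdLift, hpol, hF, hG2, QuadraticMap.polar_smul_left,
      QuadraticMap.polar_smul_right, polar_ver_ver, smul_zero, smul_zero]

/-- Data in standard form define a supercyclidic patch. -/
theorem isSCPatch (h : IsStd p q φ ψ) {f : ℝ → ℝ → RP3}
    (hf : ∀ u ∈ UI, ∀ v ∈ UI, Represents (stdLift p q φ ψ u v) (f u v)) : IsSCPatch f := by
  have hf' : ∀ u ∈ UI, ∀ v ∈ UI, Represents (stdLift q p ψ φ u v) (f v u) := fun u hu v hv => by
    rw [stdLift_swap]; exact hf v hv u hu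
  refine ⟨stdLift p q φ ψ, ⟨contDiff_stdLift p q φ ψ, hf⟩, h.conj,
    fun u hu => h.swap.line₁ (f := fun u v => f v u) hf' hu, fun v hv => h.line₁ hf hv,
    ({t | φ (ver t) = 0} ∪ {t | ψ (ver t) = 0}) ∪ ({u | ¬ ∀ a b : ℝ,
      a • p (ver u) + b • p (dver u) = 0 → a = 0 ∧ b = 0} ∪ {u | ¬ ∀ a b : ℝ,
      a • q (ver u) + b • q (dver u) = 0 → a = 0 ∧ b = 0}),
    ((lin_ver_finite h.ne_zero₁).union (lin_ver_finite h.swap.ne_zero₁)).union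
      (h.li_tangent.union h.swap.li_tangent), ?_, ?_, ?_⟩
  · rintro u ⟨hu, huS⟩ v ⟨hv, hvS⟩
    simp only [Set.mem_union, Set.mem_ofPred_eq, not_or, not_not] at huS hvS
    rw [partial₁_stdLift, partial₂_stdLift, stdLift]
    refine linearIndependent₃ fun x y z hxyz => ?_
    have h0 : p ((x * ψ (ver v) + z * ψ (dver v)) • ver u + (y * ψ (ver v)) • dver u) +
        q ((x * φ (ver u) + y * φ (dver u)) • ver v + (z * φ (ver u)) • dver v) = 0 := by
      rw [← hxyz]
      simp only [map_add, map_smul]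
      module
    obtain ⟨h1, h2⟩ := h.eq_zero_of_add h0
    rw [map_add, map_smul, map_smul] at h1 h2
    obtain ⟨h3, h4⟩ := huS.2.1 _ _ h1
    obtain ⟨h5, h6⟩ := hvS.2.2 _ _ h2
    have hy : y = 0 := (mul_eq_zero.1 h4).resolve_right hvS.1.2
    have hz : z = 0 := (mul_eq_zero.1 h6).resolve_right huS.1.1
    rw [hz, zero_mul, add_zero] at h3
    exact ⟨(mul_eq_zero.1 h3).resolve_right hvS.1.2, hy, hz⟩
  · rintro u ⟨hu, huS⟩
    simp only [Set.mem_union, Set.mem_ofPred_eq, not_or, not_not] at huS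
    refine ⟨⟨_, h.swap.isConicArc₁ (f := fun u v => f v u) hf' hu huS.1.1⟩, ?_⟩
    have := h.swap.cone₁ huS.1.1 huS.2.1
    rw [← stdLift_swap'] at this
    exact this
  · rintro v ⟨hv, hvS⟩
    simp only [Set.mem_union, Set.mem_ofPred_eq, not_or, not_not] at hvS
    exact ⟨⟨_, h.isConicArc₁ hf hv hvS.1.2⟩, h.cone₁ hvS.1.2 hvS.2.2⟩

end IsStd

/-! ### Boundary, genericity and uniqueness of patches in standard form -/

namespace IsStd

variable {p q : R3 →ₗ[ℝ] V4} {φ ψ : R3 →ₗ[ℝ] ℝ} {f : ℝ → ℝ → RP3}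

theorem side_ne_zero (h : IsStd p q φ ψ) (ε : Bool) : φ (ver (side ε)) ≠ 0 := by
  cases ε
  · change φ (ver 0) ≠ 0
    rw [h.start₁]
    exact one_ne_zero
  · exact h.finish₁

theorem swap_rep (hf : ∀ u ∈ UI, ∀ v ∈ UI, Represents (stdLift p q φ ψ u v) (f u v)) :
    ∀ u ∈ UI, ∀ v ∈ UI, Represents (stdLift q p ψ φ u v) (f v u) := fun u hu v hv => by
  rw [stdLift_swap]; exact hf v hv u hu

/-- The plane of a boundary conic of the first family. -/
theorem isConicArc_side (h : IsStd p q φ ψ)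
    (hf : ∀ u ∈ UI, ∀ v ∈ UI, Represents (stdLift p q φ ψ u v) (f u v)) (δ : Bool) :
    IsConicArc (fun u => f u (side δ)) (LinearMap.range (stdConic p q φ ψ (ver (side δ)))) :=
  h.isConicArc₁ hf (side_mem_UI δ) (h.swap.side_ne_zero δ)

/-- A common plane would contain the line of p together with two independent points of the line of
q, hence the whole space. -/
theorem side_planes_ne (h : IsStd p q φ ψ) :
    LinearMap.range (stdConic p q φ ψ (ver 0)) ≠ LinearMap.range (stdConic p q φ ψ (ver 1)) := by
  intro heq
  have h0 := h.range_le_plane (y := ver 0) (h.swap.side_ne_zero false)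
  have h1 := h.range_le_plane (y := ver 1) h.finish₂
  rw [← heq] at h1
  set W := LinearMap.range (stdConic p q φ ψ (ver 0))
  have hW : Module.finrank ℝ W = 3 :=
    finrank_range_of_injective (h.conic_injective (h.swap.side_ne_zero false)
      (h.ne₂ 0 zero_mem_UI))
  have hspan : Submodule.span ℝ (Set.range ![q (ver 0), q (ver 1)]) ≤ W ⊓ LinearMap.range q := by
    rw [Submodule.span_le]
    rintro _ ⟨i, rfl⟩
    fin_cases i
    · exact ⟨h0.2, ⟨_, rfl⟩⟩
    · exact ⟨h1.2, ⟨_, rfl⟩⟩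
  have h2 := Submodule.finrank_mono hspan
  rw [finrank_span_eq_card h.li₂, Fintype.card_fin] at h2
  have h3 : W ⊓ LinearMap.range q = LinearMap.range q :=
    Submodule.eq_of_le_of_finrank_le inf_le_right (by rw [h.swap.rank₁]; exact h2)
  have h4 : LinearMap.range p ⊔ LinearMap.range q ≤ W := sup_le h0.1 (inf_eq_right.1 h3)
  have h5 := Submodule.finrank_sup_add_finrank_inf_eq (LinearMap.range p) (LinearMap.range q)
  rw [h.disj.eq_bot, finrank_bot, h.rank₁, h.swap.rank₁] at h5
  have h6 := Submodule.finrank_mono h4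
  omega

theorem inf_side_planes (h : IsStd p q φ ψ) :
    LinearMap.range (stdConic p q φ ψ (ver 0)) ⊓ LinearMap.range (stdConic p q φ ψ (ver 1)) =
      LinearMap.range p := by
  have r0 := finrank_range_of_injective (h.conic_injective (h.swap.side_ne_zero false)
      (h.ne₂ 0 zero_mem_UI))
  have r1 := finrank_range_of_injective (h.conic_injective h.finish₂ (h.ne₂ 1 one_mem_UI))
  refine (Submodule.eq_of_le_of_finrank_eq (le_inf (h.range_le_plane (h.swap.side_ne_zero false)).1
    (h.range_le_plane h.finish₂).1) ?_).symm
  rw [h.rank₁, finrank_inf_of_ne r0 r1 h.side_planes_ne]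

theorem charLine₁_eq (h : IsStd p q φ ψ)
    (hf : ∀ u ∈ UI, ∀ v ∈ UI, Represents (stdLift p q φ ψ u v) (f u v)) :
    charLine₁ f = LinearMap.range p := by
  obtain ⟨F, S, hl⟩ := (h.isSCPatch hf).exists_lift
  rw [hl.charLine₁_eq (h.isConicArc_side hf false) (h.isConicArc_side hf true) h.side_planes_ne]
  exact h.inf_side_planes

theorem charLine₂_eq (h : IsStd p q φ ψ)
    (hf : ∀ u ∈ UI, ∀ v ∈ UI, Represents (stdLift p q φ ψ u v) (f u v)) :
    charLine₂ f = LinearMap.range q :=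
  h.swap.charLine₁_eq (f := fun u v => f v u) (swap_rep hf)

theorem isGenericPatch (h : IsStd p q φ ψ)
    (hf : ∀ u ∈ UI, ∀ v ∈ UI, Represents (stdLift p q φ ψ u v) (f u v)) : IsGenericPatch f := by
  refine ⟨⟨_, _, h.swap.isConicArc_side (f := fun u v => f v u) (swap_rep hf) false,
    h.swap.isConicArc_side (f := fun u v => f v u) (swap_rep hf) true, h.swap.side_planes_ne⟩,
    ⟨_, _, h.isConicArc_side hf false, h.isConicArc_side hf true, h.side_planes_ne⟩, ?_⟩
  rw [h.charLine₁_eq hf, h.charLine₂_eq hf]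
  exact h.disj

theorem lift_notMem (h : IsStd p q φ ψ) {u v : ℝ} (hv : v ∈ UI) (hφ : φ (ver u) ≠ 0) :
    stdLift p q φ ψ u v ∉ LinearMap.range p := by
  rintro ⟨x, hx⟩
  have h0 : p (ψ (ver v) • ver u - x) + q (φ (ver u) • ver v) = 0 := by
    rw [map_sub, hx, map_smul, map_smul, stdLift]
    abel
  have h1 := (h.eq_zero_of_add h0).2
  rw [map_smul] at h1
  exact smul_ne_zero hφ (h.ne₂ v hv) h1

theorem nondegenerateQuad (h : IsStd p q φ ψ)
    (hf : ∀ u ∈ UI, ∀ v ∈ UI, Represents (stdLift p q φ ψ u v) (f u v)) :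
    NondegenerateQuad (fun ε b => f (side ε) b) (fun δ a => f a (side δ)) := by
  have hf' := swap_rep hf
  refine ⟨fun ε => LinearMap.range (stdConic q p ψ φ (ver (side ε))),
    fun δ => LinearMap.range (stdConic p q φ ψ (ver (side δ))),
    fun ε => h.swap.isConicArc_side (f := fun u v => f v u) hf' ε,
    fun δ => h.isConicArc_side hf δ, h.swap.side_planes_ne, h.side_planes_ne, ?_⟩
  change Disjoint (LinearMap.range (stdConic q p ψ φ (ver 0)) ⊓
    LinearMap.range (stdConic q p ψ φ (ver 1))) (LinearMap.range (stdConic p q φ ψ (ver 0)) ⊓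
    LinearMap.range (stdConic p q φ ψ (ver 1))) ∧
    (∀ ε, ∀ t ∈ UI, ¬ (f (side ε) t).submodule ≤ LinearMap.range (stdConic p q φ ψ (ver 0)) ⊓
      LinearMap.range (stdConic p q φ ψ (ver 1))) ∧
    (∀ δ, ∀ t ∈ UI, ¬ (f t (side δ)).submodule ≤ LinearMap.range (stdConic q p ψ φ (ver 0)) ⊓
      LinearMap.range (stdConic q p ψ φ (ver 1))) ∧
    ((∀ ε, ∀ t ∈ UI, ¬ (f (side ε) t).submodule ≤ LinearMap.range (stdConic q p ψ φ (ver 0)) ⊓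
      LinearMap.range (stdConic q p ψ φ (ver 1))) ∨
     (∀ δ, ∀ t ∈ UI, ¬ (f t (side δ)).submodule ≤ LinearMap.range (stdConic p q φ ψ (ver 0)) ⊓
      LinearMap.range (stdConic p q φ ψ (ver 1))))
  rw [h.inf_side_planes, h.swap.inf_side_planes]
  refine ⟨h.disj.symm, fun ε t ht => ?_, fun δ t ht => ?_, ?_⟩
  · rw [(hf _ (side_mem_UI ε) t ht).submodule_le]
    exact h.lift_notMem ht (h.side_ne_zero ε)
  · rw [(hf t ht _ (side_mem_UI δ)).submodule_le, ← stdLift_swap]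
    exact h.swap.lift_notMem ht (h.swap.side_ne_zero δ)
  -- An arc of one pair meets the line of its own pair only at a zero of ψ, an arc of the other pair
  -- only at a zero of φ. As the forms have no simultaneous zeros, one of them has no zeros at all.
  · by_cases hc : ∃ t ∈ UI, φ (ver t) = 0
    · obtain ⟨s, hs, hs0⟩ := hc
      left
      intro ε t ht
      rw [(hf _ (side_mem_UI ε) t ht).submodule_le, ← stdLift_swap]
      exact h.swap.lift_notMem (side_mem_UI ε) ((h.ne s hs t ht).resolve_left (by simp [hs0]))
    · right
      intro δ t ht
      rw [(hf t ht _ (side_mem_UI δ)).submodule_le]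
      exact h.lift_notMem (side_mem_UI δ) fun h0 => hc ⟨t, ht, h0⟩

end IsStd

theorem IsConicArc.congr_image {c d : ℝ → RP3} {W W' : Submodule ℝ V4} (h : IsConicArc c W)
    (h' : IsConicArc d W') (him : d '' UI = c '' UI) : W' = W := by
  refine h'.eq_of_mem h.1 fun t ht => ?_
  obtain ⟨s, hs, hst⟩ : d t ∈ c '' UI := him ▸ ⟨t, ht, rfl⟩
  obtain ⟨v, hv⟩ := exists_represents (c s)
  exact ⟨v, h.mem hs hv, hst ▸ hv⟩

/-- A patch with the boundary of a patch in standard form is generic, with the same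
characteristic line. -/
theorem IsSCLift.planes_of_sameBoundary {F : ℝ → ℝ → V4} {S : Set ℝ} {f g : ℝ → ℝ → RP3}
    (hg : IsSCLift F S g) (hs : SameBoundary g f) {W : Bool → Submodule ℝ V4}
    (hW : ∀ δ, IsConicArc (fun u => f u (side δ)) (W δ)) :
    ∀ δ, IsConicArc (fun u => g u (side δ)) (W δ) := by
  intro δ
  rcases hg.line₁ _ (side_mem_UI δ) with ⟨W', hW'⟩ | hc
  · rwa [(hW δ).congr_image hW' (hs.2.2 δ)] at hW'
  · refine absurd ?_ (hW δ).not_const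
    have h0 : g 0 (side δ) = f 0 (side δ) := hs.1 false δ
    have h1 : g 1 (side δ) = f 1 (side δ) := hs.1 true δ
    change f 0 (side δ) = f 1 (side δ)
    rw [← h0, ← h1]
    exact (hc 1 one_mem_UI).symm

theorem SameBoundary.swap {f g : ℝ → ℝ → RP3} (h : SameBoundary g f) :
    SameBoundary (fun u v => g v u) (fun u v => f v u) :=
  ⟨fun ε δ => h.1 δ ε, h.2.2, h.2.1⟩

namespace IsStd

variable {p q : R3 →ₗ[ℝ] V4} {φ ψ : R3 →ₗ[ℝ] ℝ} {f : ℝ → ℝ → RP3}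

theorem isArcOf_side (h : IsStd p q φ ψ)
    (hf : ∀ u ∈ UI, ∀ v ∈ UI, Represents (stdLift p q φ ψ u v) (f u v)) {g : ℝ → ℝ → RP3}
    (hs : SameBoundary g f) :
    Function.Injective (stdConic p q φ ψ (ver 0)) ∧
      IsArcOf (stdConic p q φ ψ (ver 0)) (fun u => g u 0) := by
  refine ⟨h.conic_injective (h.swap.side_ne_zero false) (h.ne₂ 0 zero_mem_UI), ?_⟩
  have ha : IsArcOf (stdConic p q φ ψ (ver 0)) (fun u => f u 0) :=
    IsArcOf.of_reparam isReparam_id fun t ht => hf t ht 0 zero_mem_UI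
  exact ha.congr_image (hs.1 false false) (hs.1 true false) (hs.2.2 false)

/-- Patches in standard form are determined by their boundary. -/
theorem isReparamOf (h : IsStd p q φ ψ)
    (hf : ∀ u ∈ UI, ∀ v ∈ UI, Represents (stdLift p q φ ψ u v) (f u v)) {g : ℝ → ℝ → RP3}
    (hg : IsSCPatch g) (hs : SameBoundary g f) : IsReparamOf g f := by
  have hf' := swap_rep hf
  obtain ⟨F, S, hl⟩ := hg.exists_lift
  have hW := hl.planes_of_sameBoundary hs (h.isConicArc_side hf)
  have hV := hl.swap.planes_of_sameBoundary hs.swap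
    (h.swap.isConicArc_side (f := fun u v => f v u) hf')
  have e1 : charLine₁ g = LinearMap.range p := by
    rw [hl.charLine₁_eq (hW false) (hW true) h.side_planes_ne]
    exact h.inf_side_planes
  have e2 : charLine₂ g = LinearMap.range q := by
    change charLine₁ (fun u v => g v u) = _
    rw [hl.swap.charLine₁_eq (hV false) (hV true) h.swap.side_planes_ne]
    exact h.swap.inf_side_planes
  have hgen : IsGenericPatch g := ⟨⟨_, _, hV false, hV true, h.swap.side_planes_ne⟩,
    ⟨_, _, hW false, hW true, h.side_planes_ne⟩, by rw [e1, e2]; exact h.disj⟩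
  obtain ⟨i₁, a₁⟩ := h.isArcOf_side hf hs
  obtain ⟨i₂, a₂⟩ := h.swap.isArcOf_side hf' hs.swap
  obtain ⟨p', q', φ', ψ', r₁, r₂, hst, hA, hB, hr₁, hr₂, hrep, l₁, l₂⟩ :=
    hg.exists_std hgen i₁ i₂ a₁ a₂ (by
      rw [stdConic_apply, stdConic_swap_apply])
  rw [e1] at l₁
  rw [e2] at l₂
  -- Both patches have the same characteristic lines and the same equations of two adjacent boundary
  -- arcs. Splitting these equations along the two lines identifies all data.
  have comp : ∀ a b c d : V4, a ∈ LinearMap.range p → b ∈ LinearMap.range q →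
      c ∈ LinearMap.range p → d ∈ LinearMap.range q → a + b = c + d → a = c ∧ b = d := by
    rintro _ _ _ _ ⟨a, rfl⟩ ⟨b, rfl⟩ ⟨c, rfl⟩ ⟨d, rfl⟩ heq
    have := h.eq_zero_of_add (x := a - c) (y := b - d) (by
      rw [map_sub, map_sub, sub_add_sub_comm, heq, sub_self])
    rw [map_sub, map_sub] at this
    exact ⟨sub_eq_zero.1 this.1, sub_eq_zero.1 this.2⟩
  have pm : ∀ x, p' x ∈ LinearMap.range p := fun x => by rw [l₁]; exact ⟨x, rfl⟩
  have qm : ∀ x, q' x ∈ LinearMap.range q := fun x => by rw [l₂]; exact ⟨x, rfl⟩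
  have cA : ∀ x, p x = p' x ∧ φ x • q (ver 0) = φ' x • q' (ver 0) := fun x => by
    have := hA x
    rw [stdConic_apply, h.start₂, one_smul] at this
    exact comp _ _ _ _ ⟨x, rfl⟩ ⟨φ x • ver 0, map_smul _ _ _⟩ (pm x)
      (Submodule.smul_mem _ _ (qm _)) this
  have cB : ∀ y, ψ y • p (ver 0) = ψ' y • p' (ver 0) ∧ q y = q' y := fun y => by
    have := hB y
    rw [stdConic_swap_apply, h.start₁, one_smul, add_comm (q' y)] at this
    exact comp _ _ _ _ ⟨ψ y • ver 0, map_smul _ _ _⟩ ⟨y, rfl⟩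
      (Submodule.smul_mem _ _ (pm _)) (qm y) this
  have hp : p' = p := LinearMap.ext fun x => (cA x).1.symm
  have hq : q' = q := LinearMap.ext fun y => (cB y).2.symm
  subst hp
  subst hq
  have hφ : φ' = φ := LinearMap.ext fun x =>
    (smul_left_injective ℝ (h.ne₂ 0 zero_mem_UI) (cA x).2).symm
  have hψ : ψ' = ψ := LinearMap.ext fun x =>
    (smul_left_injective ℝ (h.ne₁ 0 zero_mem_UI) (cB x).1).symm
  subst hφ
  subst hψ
  exact ⟨r₁, r₂, hr₁, hr₂, fun a ha b hb =>
    (hrep a ha b hb).eq (hf _ (hr₁.mem_UI ha) _ (hr₂.mem_UI hb))⟩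

end IsStd

/-! ### Quadrilaterals that bound a patch in standard form -/

theorem IsConicArc.injective_of_param {Γ : R3 →ₗ[ℝ] V4} {c : ℝ → RP3} {W : Submodule ℝ V4}
    (h : IsConicArc c W) (hΓ : ∀ t ∈ UI, Represents (Γ (ver t)) (c t)) :
    Function.Injective Γ ∧ W = LinearMap.range Γ := by
  have hle : W ≤ LinearMap.range Γ := h.le_of_mem fun t ht => ⟨_, ⟨_, rfl⟩, hΓ t ht⟩
  have h1 := Submodule.finrank_mono hle
  have h2 := LinearMap.finrank_range_add_finrank_ker Γ
  rw [h.1] at h1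
  rw [Module.finrank_fin_fun] at h2
  have h3 : Module.finrank ℝ (LinearMap.ker Γ) = 0 := by omega
  refine ⟨LinearMap.ker_eq_bot.1 (Submodule.finrank_eq_zero.1 h3), ?_⟩
  exact Submodule.eq_of_le_of_finrank_eq hle (by rw [h.1]; omega)

theorem finrank_ker_functional {φ : R3 →ₗ[ℝ] ℝ} (h : φ ≠ 0) :
    Module.finrank ℝ (LinearMap.ker φ) = 2 := by
  have h1 := LinearMap.finrank_range_add_finrank_ker φ
  have h2 : LinearMap.range φ = ⊤ := LinearMap.range_eq_top.2 (LinearMap.surjective h)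
  rw [h2, finrank_top, Module.finrank_self, Module.finrank_fin_fun] at h1
  omega

/-- The intersection of the planes of two opposite arcs. -/
theorem inf_planes_of_arcs {A A' : R3 →ₗ[ℝ] V4} {φ : R3 →ₗ[ℝ] ℝ} (hφ : φ ≠ 0)
    {c : Bool → ℝ → RP3} {W : Bool → Submodule ℝ V4} (hW : ∀ δ, IsConicArc (c δ) (W δ))
    (hne : W false ≠ W true) (h0 : ∀ t ∈ UI, Represents (A (ver t)) (c false t))
    (h1 : ∀ t ∈ UI, Represents (A' (ver t)) (c true t)) {s : ℝ} (hs : ∀ x, φ x = 0 → A' x = s • A x) :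
    Function.Injective A ∧ (∀ x, φ x = 0 → A x ∈ W false ⊓ W true) ∧
      Module.finrank ℝ (W false ⊓ W true : Submodule ℝ V4) = 2 := by
  obtain ⟨i0, r0⟩ := (hW false).injective_of_param h0
  obtain ⟨i1, r1⟩ := (hW true).injective_of_param h1
  have hs0 : s ≠ 0 := by
    rintro rfl
    have h2 : LinearMap.ker φ ≤ LinearMap.ker A' := fun x hx => by
      rw [LinearMap.mem_ker, hs x hx, zero_smul]
    rw [LinearMap.ker_eq_bot.2 i1, le_bot_iff] at h2
    have h3 := finrank_ker_functional hφ
    rw [h2, finrank_bot] at h3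
    omega
  refine ⟨i0, fun x hx => ⟨?_, ?_⟩, finrank_inf_of_ne (hW _).1 (hW _).1 hne⟩
  · change A x ∈ W false
    rw [r0]; exact ⟨x, rfl⟩
  · change A x ∈ W true
    rw [r1, ← Submodule.smul_mem_iff _ hs0, ← hs x hx]
    exact ⟨x, rfl⟩

/-- A non-degenerate quadrilateral whose arcs belong to a trilinear parametrization bounds a patch
in standard form. -/
theorem exists_isStd_of_nondegenerateQuad {A B : R3 →ₗ[ℝ] V4} {φ ψ : R3 →ₗ[ℝ] ℝ} {o : V4}
    {a b : Bool → ℝ → RP3} (hq : NondegenerateQuad a b) (hA : A (ver 0) = o) (hB : B (ver 0) = o)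
    (hφ : φ (ver 0) = 1) (hψ : ψ (ver 0) = 1)
    (hb : ∀ δ, ∀ t ∈ UI, Represents (ψ (ver (side δ)) • A (ver t) + φ (ver t) • B (ver (side δ)) -
      (φ (ver t) * ψ (ver (side δ))) • o) (b δ t))
    (ha : ∀ ε, ∀ t ∈ UI, Represents (ψ (ver t) • A (ver (side ε)) + φ (ver (side ε)) • B (ver t) -
      (φ (ver (side ε)) * ψ (ver t)) • o) (a ε t)) :
    ∃ p q : R3 →ₗ[ℝ] V4, IsStd p q φ ψ ∧ (∀ x, A x = p x + φ x • q (ver 0)) ∧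
      (∀ y, B y = q y + ψ y • p (ver 0)) := by
  obtain ⟨WA, WB, hWA, hWB, hneA, hneB, hdis, hAB, hBA, hown⟩ := hq
  have hφ0 : φ ≠ 0 := by
    rintro rfl
    simp at hφ
  have hψ0 : ψ ≠ 0 := by
    rintro rfl
    simp at hψ
  have hb0 : ∀ t ∈ UI, Represents (A (ver t)) (b false t) := fun t ht => by
    have := hb false t ht
    change Represents (ψ (ver 0) • A (ver t) + φ (ver t) • B (ver 0) -
      (φ (ver t) * ψ (ver 0)) • o) (b false t) at this
    rw [hψ, hB] at this
    convert this using 1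
    module
  have ha0 : ∀ t ∈ UI, Represents (B (ver t)) (a false t) := fun t ht => by
    have := ha false t ht
    change Represents (ψ (ver t) • A (ver 0) + φ (ver 0) • B (ver t) -
      (φ (ver 0) * ψ (ver t)) • o) (a false t) at this
    rw [hφ, hA] at this
    convert this using 1
    module
  obtain ⟨iA, mA, dA⟩ := inf_planes_of_arcs (A := A)
    (A' := ψ (ver 1) • A + φ.smulRight (B (ver 1)) - (ψ (ver 1) • φ).smulRight o) hφ0 hWB hneB hb0
    (fun t ht => by
      convert hb true t ht using 1
      change ψ (ver 1) • A (ver t) + φ (ver t) • B (ver 1) - (ψ (ver 1) * φ (ver t)) • o =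
        ψ (ver 1) • A (ver t) + φ (ver t) • B (ver 1) - (φ (ver t) * ψ (ver 1)) • o
      rw [mul_comm]) (s := ψ (ver 1)) (fun x hx => by simp [hx])
  obtain ⟨iB, mB, dB⟩ := inf_planes_of_arcs (A := B)
    (A' := φ (ver 1) • B + ψ.smulRight (A (ver 1)) - (φ (ver 1) • ψ).smulRight o) hψ0 hWA hneA ha0
    (fun t ht => by
      convert ha true t ht using 1
      change φ (ver 1) • B (ver t) + ψ (ver t) • A (ver 1) - (φ (ver 1) * ψ (ver t)) • o =
        ψ (ver t) • A (ver 1) + φ (ver 1) • B (ver t) - (φ (ver 1) * ψ (ver t)) • o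
      rw [add_comm (φ (ver 1) • B (ver t))]) (s := φ (ver 1)) (fun x hx => by simp [hx])
  set L₁ := WB false ⊓ WB true with hL₁
  set L₂ := WA false ⊓ WA true with hL₂
  -- The vertex o is split along the two lines. Subtracting the other component, weighted by the
  -- linear form, from A and B moves their values into L₁ and L₂: this holds at the vertex by
  -- construction, and on the kernel of the form because opposite arcs have proportional equations
  -- there.
  obtain ⟨π, π1, π2, π3, π4⟩ := exists_projection (isCompl_of_disjoint dA dB hdis.symm)
  set p : R3 →ₗ[ℝ] V4 := A - φ.smulRight (o - π o) with hp
  set q : R3 →ₗ[ℝ] V4 := B - ψ.smulRight (π o) with hq'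
  have pa : ∀ x, p x = A x - φ x • (o - π o) := fun x => rfl
  have qa : ∀ x, q x = B x - ψ x • π o := fun x => rfl
  have p0 : p (ver 0) = π o := by rw [pa, hA, hφ]; module
  have q0 : q (ver 0) = o - π o := by rw [qa, hB, hψ]; module
  have pm : ∀ x, p x ∈ L₁ := fun x => by
    have h1 : p x = A (x - φ x • ver 0) + φ x • π o := by
      rw [pa, map_sub, map_smul, hA]; module
    rw [h1]
    exact L₁.add_mem (mA _ (by simp [hφ])) (L₁.smul_mem _ (π1 o))
  have qm : ∀ x, q x ∈ L₂ := fun x => by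
    have h1 : q x = B (x - ψ x • ver 0) + ψ x • (o - π o) := by
      rw [qa, map_sub, map_smul, hB]; module
    rw [h1]
    exact L₂.add_mem (mB _ (by simp [hψ])) (L₂.smul_mem _ (π2 o))
  have eA : ∀ x, A x = p x + φ x • q (ver 0) := fun x => by rw [q0, pa]; abel
  have eB : ∀ x, B x = q x + ψ x • p (ver 0) := fun x => by rw [p0, qa]; abel
  have n₁ : ∀ t ∈ UI, p (ver t) ≠ 0 := fun t ht h0 => by
    apply hBA false t ht
    rw [(hb0 t ht).submodule_le, eA, h0, zero_add]
    exact L₂.smul_mem _ (qm _)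
  have n₂ : ∀ t ∈ UI, q (ver t) ≠ 0 := fun t ht h0 => by
    apply hAB false t ht
    rw [(ha0 t ht).submodule_le, eB, h0, zero_add]
    exact L₁.smul_mem _ (pm _)
  have j₁ : ∀ x, p x = 0 → φ x = 0 → x = 0 := fun x h1 h2 =>
    iA (by rw [eA, h1, h2, zero_smul, add_zero, map_zero])
  have j₂ : ∀ y, q y = 0 → ψ y = 0 → y = 0 := fun y h1 h2 =>
    iB (by rw [eB, h1, h2, zero_smul, add_zero, map_zero])
  have hpR := range_eq_of_rank j₁ dA pm
  have hqR := range_eq_of_rank j₂ dB qm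
  have hlift : ∀ x y, ψ y • A x + φ x • B y - (φ x * ψ y) • o = ψ y • p x + φ x • q y :=
    fun x y => by rw [pa, qa]; module
  have f₁ := std_finish (f := fun _ v => a true v) (p := p) (q := q) (φ := φ) (ψ := ψ) (r := id)
    (hWA false).1 (hWA true) hneA (by rw [hqR]; exact inf_le_left)
    (by
      have h1 := (hWA false).mem zero_mem_UI (ha0 0 zero_mem_UI)
      rw [hB] at h1
      have h2 : q (ver 0) ∈ WA false := (inf_le_left : L₂ ≤ _) (qm _)
      have h3 := (WA false).sub_mem h1 h2
      rwa [q0, sub_sub_cancel, ← p0] at h3) (n₁ 0 zero_mem_UI)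
    (fun v hv => by
      have := ha true v hv
      rwa [hlift] at this)
  have f₂ := std_finish (f := fun _ v => b true v) (p := q) (q := p) (φ := ψ) (ψ := φ) (r := id)
    (hWB false).1 (hWB true) hneB (by rw [hpR]; exact inf_le_left)
    (by
      have h1 := (hWB false).mem zero_mem_UI (hb0 0 zero_mem_UI)
      rw [hA] at h1
      have h2 : p (ver 0) ∈ WB false := (inf_le_left : L₁ ≤ _) (pm _)
      have h3 := (WB false).sub_mem h1 h2
      rwa [p0, ← q0] at h3) (n₂ 0 zero_mem_UI)
    (fun v hv => by
      have := hb true v hv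
      rwa [hlift, add_comm] at this)
  refine ⟨p, q, ⟨?_, j₁, j₂, hφ, hψ, f₁.1, f₂.1, n₁, n₂, ?_, f₁.2, f₂.2⟩, eA, eB⟩
  · rw [hpR, hqR]; exact hdis.symm
  · intro s hs t ht
    by_contra hcon
    push Not at hcon
    -- Zeros of φ and ψ are parameters at which arcs meet the line of their own pair, and at most
    -- one pair has such arcs.
    rcases hown with ho | ho
    · refine ho false t ht ?_
      rw [(ha0 t ht).submodule_le]
      exact mB _ hcon.2
    · refine ho false s hs ?_
      rw [(hb0 s hs).submodule_le]
      exact mA _ hcon.1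

/-! ### Faces of a cube -/

theorem fin3_one_one (i : Fin 3) : i + 1 + 1 = i + 2 := by fin_cases i <;> rfl
theorem fin3_one_two (i : Fin 3) : i + 1 + 2 = i := by fin_cases i <;> rfl
theorem fin3_two_one (i : Fin 3) : i + 2 + 1 = i := by fin_cases i <;> rfl
theorem fin3_two_two (i : Fin 3) : i + 2 + 2 = i + 1 := by fin_cases i <;> rfl

/-- `f` is, up to changes of parameter, the patch with the standard form data `p, q, φ, ψ`. -/
structure IsStdPatch (f : ℝ → ℝ → RP3) (p q : R3 →ₗ[ℝ] V4) (φ ψ : R3 →ₗ[ℝ] ℝ) : Prop where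
  std : IsStd p q φ ψ
  rep : ∃ r₁ r₂ : ℝ → ℝ, IsReparam r₁ ∧ IsReparam r₂ ∧
    ∀ a ∈ UI, ∀ b ∈ UI, Represents (stdLift p q φ ψ (r₁ a) (r₂ b)) (f a b)
  line₁ : charLine₁ f = LinearMap.range p
  line₂ : charLine₂ f = LinearMap.range q

theorem IsSCPatch.exists_isStdPatch {f : ℝ → ℝ → RP3} (hf : IsSCPatch f) (hg : IsGenericPatch f)
    {Γ₁ Γ₂ : R3 →ₗ[ℝ] V4} (i₁ : Function.Injective Γ₁) (i₂ : Function.Injective Γ₂)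
    (a₁ : IsArcOf Γ₁ fun u => f u 0) (a₂ : IsArcOf Γ₂ fun v => f 0 v)
    (ho : Γ₁ (ver 0) = Γ₂ (ver 0)) :
    ∃ (p q : R3 →ₗ[ℝ] V4) (φ ψ : R3 →ₗ[ℝ] ℝ), IsStdPatch f p q φ ψ ∧
      (∀ x, Γ₁ x = p x + φ x • q (ver 0)) ∧ (∀ y, Γ₂ y = q y + ψ y • p (ver 0)) := by
  obtain ⟨p, q, φ, ψ, r₁, r₂, hs, h1, h2, hr₁, hr₂, hrep, l₁, l₂⟩ :=
    hf.exists_std hg i₁ i₂ a₁ a₂ ho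
  exact ⟨p, q, φ, ψ, ⟨hs, ⟨r₁, r₂, hr₁, hr₂, hrep⟩, l₁, l₂⟩, h1, h2⟩

namespace IsStdPatch

variable {f : ℝ → ℝ → RP3} {p q : R3 →ₗ[ℝ] V4} {φ ψ : R3 →ₗ[ℝ] ℝ}

theorem rep_side (h : IsStdPatch f p q φ ψ) (ε δ : Bool) :
    Represents (stdLift p q φ ψ (side ε) (side δ)) (f (side ε) (side δ)) := by
  obtain ⟨r₁, r₂, hr₁, hr₂, hrep⟩ := h.rep
  have := hrep _ (side_mem_UI ε) _ (side_mem_UI δ)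
  rwa [hr₁.side, hr₂.side] at this

theorem isArcOf₁ (h : IsStdPatch f p q φ ψ) (δ : Bool) :
    Function.Injective (stdConic p q φ ψ (ver (side δ))) ∧
      IsArcOf (stdConic p q φ ψ (ver (side δ))) (fun u => f u (side δ)) := by
  obtain ⟨r₁, r₂, hr₁, hr₂, hrep⟩ := h.rep
  refine ⟨h.std.conic_injective (h.std.swap.side_ne_zero δ) (h.std.ne₂ _ (side_mem_UI δ)),
    IsArcOf.of_reparam hr₁ fun t ht => ?_⟩
  have := hrep t ht _ (side_mem_UI δ)
  rwa [hr₂.side] at this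

theorem isArcOf₂ (h : IsStdPatch f p q φ ψ) (ε : Bool) :
    Function.Injective (stdConic q p ψ φ (ver (side ε))) ∧
      IsArcOf (stdConic q p ψ φ (ver (side ε))) (fun v => f (side ε) v) := by
  obtain ⟨r₁, r₂, hr₁, hr₂, hrep⟩ := h.rep
  refine ⟨h.std.swap.conic_injective (h.std.side_ne_zero ε) (h.std.ne₁ _ (side_mem_UI ε)),
    IsArcOf.of_reparam hr₂ fun t ht => ?_⟩
  have := hrep _ (side_mem_UI ε) t ht
  rw [hr₁.side, ← stdLift_swap] at this
  exact this

end IsStdPatch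

/-- Homogeneous coordinates for the three near faces of a cube: the edges `E d` through the first
vertex `o`, and linear forms that describe the faces between them. -/
structure IsCubeFrame (X : Fin 3 → Bool → ℝ → ℝ → RP3) (E : Fin 3 → R3 →ₗ[ℝ] V4)
    (α β : Fin 3 → R3 →ₗ[ℝ] ℝ) (o : V4) : Prop where
  start : ∀ d, E d (ver 0) = o
  near : ∀ i, ∃ p q : R3 →ₗ[ℝ] V4, IsStdPatch (X i false) p q (β (i + 1)) (α (i + 2)) ∧
    (∀ x, E (i + 1) x = p x + β (i + 1) x • q (ver 0)) ∧
    (∀ y, E (i + 2) y = q y + α (i + 2) y • p (ver 0))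

theorem IsSCCube.exists_frame {X : Fin 3 → Bool → ℝ → ℝ → RP3} (hX : IsSCCube X)
    (hgen : IsGenericCube X) : ∃ E α β o, IsCubeFrame X E α β o := by
  obtain ⟨o, ho⟩ := exists_represents (X 0 false 0 0)
  have hv1 : X 1 false 0 0 = X 2 false 0 0 := hX.vertices 0 false false false
  have hv2 : X 2 false 0 0 = X 0 false 0 0 := hX.vertices 1 false false false
  have ho' : ∀ i, Represents o (X i false 0 0) := by
    intro i
    fin_cases i
    · exact ho
    · exact (hv1.trans hv2) ▸ ho
    · exact hv2 ▸ ho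
  have hE : ∀ d : Fin 3, ∃ Γ : R3 →ₗ[ℝ] V4, Function.Injective Γ ∧ Γ (ver 0) = o ∧
      IsArcOf Γ (fun t => X (d + 1) false 0 t) ∧ IsArcOf Γ (fun t => X (d + 2) false t 0) := by
    intro d
    obtain ⟨W, -, hW, -, -⟩ := (hgen.faces (d + 1) false).1
    obtain ⟨Γ, hi, -, ha⟩ := hW.exists_isArcOf
    obtain ⟨a, ha0, hao⟩ := ha.start.exists_smul (ho' (d + 1))
    have ha' := ha.of_smul ha0
    refine ⟨a • Γ, fun x y hxy => hi (smul_right_injective V4 ha0 hxy), hao.symm, ha', ?_⟩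
    exact ha'.congr_image (hX.vertices d false false false).symm
      (hX.vertices d false false true).symm (hX.common_boundary d false false).symm
  choose E hEi hEo hE1 hE2 using hE
  have hface : ∀ i : Fin 3, ∃ (p q : R3 →ₗ[ℝ] V4) (φ ψ : R3 →ₗ[ℝ] ℝ),
      IsStdPatch (X i false) p q φ ψ ∧ (∀ x, E (i + 1) x = p x + φ x • q (ver 0)) ∧
      (∀ y, E (i + 2) y = q y + ψ y • p (ver 0)) := fun i => by
    have h1 := hE2 (i + 1)
    have h2 := hE1 (i + 2)
    rw [fin3_one_two] at h1
    rw [fin3_two_one] at h2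
    exact (hX.patch i false).exists_isStdPatch (hgen.faces i false) (hEi _) (hEi _) h1 h2
      (by rw [hEo, hEo])
  choose p q φ ψ hst h1 h2 using hface
  -- Edge d is the second boundary arc of the near face d + 1 and the first one of the near face d +
  -- 2, which gives it one form from either face.
  refine ⟨E, fun d => ψ (d + 1), fun d => φ (d + 2), o, hEo, fun i => ⟨p i, q i, ?_⟩⟩
  simp only [fin3_one_two, fin3_two_one]
  exact ⟨hst i, h1 i, h2 i⟩

/-- The trilinear map that parametrizes the cube. -/
noncomputable def cubeMap (E : Fin 3 → R3 →ₗ[ℝ] V4) (α β : Fin 3 → R3 →ₗ[ℝ] ℝ) (o : V4)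
    (i : Fin 3) (t a b : R3) : V4 :=
  (α (i + 1) a * α (i + 2) b + β (i + 1) a * β (i + 2) b - β (i + 1) a * α (i + 2) b) • E i t +
  (α (i + 2) b * α i t + β (i + 2) b * β i t - β (i + 2) b * α i t) • E (i + 1) a +
  (α i t * α (i + 1) a + β i t * β (i + 1) a - β i t * α (i + 1) a) • E (i + 2) b -
  (α i t * α (i + 1) a * α (i + 2) b + β i t * β (i + 1) a * β (i + 2) b) • o

/-! ### The trilinear map of a cube and its restriction to the near faces -/

section cubeMap

variable (E : Fin 3 → R3 →ₗ[ℝ] V4) (α β : Fin 3 → R3 →ₗ[ℝ] ℝ) (o : V4)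

/-- The cyclic symmetry reduces statements about the three directions to one. It is also the reason
for the shared conics of different families: both are restrictions of one map with the same two
arguments fixed. -/
theorem cubeMap_rot (i : Fin 3) (t a b : R3) :
    cubeMap E α β o (i + 1) a b t = cubeMap E α β o i t a b := by
  simp only [cubeMap, fin3_one_one, fin3_one_two]
  module

theorem cubeMap_rot' (i : Fin 3) (t a b : R3) :
    cubeMap E α β o (i + 2) b t a = cubeMap E α β o i t a b := by
  rw [← fin3_one_one, cubeMap_rot, cubeMap_rot]

end cubeMap

namespace IsCubeFrame

variable {X : Fin 3 → Bool → ℝ → ℝ → RP3} {E : Fin 3 → R3 →ₗ[ℝ] V4}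
  {α β : Fin 3 → R3 →ₗ[ℝ] ℝ} {o : V4}

theorem β_start (h : IsCubeFrame X E α β o) (d : Fin 3) : β d (ver 0) = 1 := by
  obtain ⟨p, q, hs, -, -⟩ := h.near (d + 2)
  rw [fin3_two_one] at hs
  exact hs.std.start₁

theorem α_start (h : IsCubeFrame X E α β o) (d : Fin 3) : α d (ver 0) = 1 := by
  obtain ⟨p, q, hs, -, -⟩ := h.near (d + 1)
  rw [fin3_one_two] at hs
  exact hs.std.start₂

theorem β_finish (h : IsCubeFrame X E α β o) (d : Fin 3) : β d (ver 1) ≠ 0 := by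
  obtain ⟨p, q, hs, -, -⟩ := h.near (d + 2)
  rw [fin3_two_one] at hs
  exact hs.std.finish₁

theorem α_finish (h : IsCubeFrame X E α β o) (d : Fin 3) : α d (ver 1) ≠ 0 := by
  obtain ⟨p, q, hs, -, -⟩ := h.near (d + 1)
  rw [fin3_one_two] at hs
  exact hs.std.finish₂

theorem cubeMap_start (h : IsCubeFrame X E α β o) (i : Fin 3) (a b : R3) :
    cubeMap E α β o i (ver 0) a b = α (i + 2) b • E (i + 1) a + β (i + 1) a • E (i + 2) b -
      (β (i + 1) a * α (i + 2) b) • o := by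
  simp only [cubeMap, h.α_start, h.β_start, h.start]
  module

/-- Boundary lines of a member of a family. -/
theorem cubeMap_mid (h : IsCubeFrame X E α β o) (i : Fin 3) (t a : R3) :
    cubeMap E α β o i t a (ver 0) = α (i + 1) a • E i t + β i t • E (i + 1) a -
      (β i t * α (i + 1) a) • o := by
  rw [← cubeMap_rot', h.cubeMap_start, fin3_two_two, fin3_two_one]

theorem cubeMap_mid' (h : IsCubeFrame X E α β o) (i : Fin 3) (t b : R3) :
    cubeMap E α β o i t (ver 0) b = α i t • E (i + 2) b + β (i + 2) b • E i t -
      (β (i + 2) b * α i t) • o := by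
  rw [← cubeMap_rot, h.cubeMap_start, fin3_one_one, fin3_one_two]

theorem cubeMap_edge (h : IsCubeFrame X E α β o) (i : Fin 3) (t : R3) :
    cubeMap E α β o i t (ver 0) (ver 0) = E i t := by
  rw [h.cubeMap_mid, h.start, h.α_start]
  module

/-- The lines of the cube through a point of an edge span the whole plane net. -/
theorem smul_cubeMap (h : IsCubeFrame X E α β o) (i : Fin 3) (t a b : R3) :
    (α i t * β i t) • cubeMap E α β o i t a b =
      (α i t * (α (i + 2) b * α i t + β (i + 2) b * β i t - β (i + 2) b * α i t)) •
        cubeMap E α β o i t a (ver 0) +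
      (β i t * (α i t * α (i + 1) a + β i t * β (i + 1) a - β i t * α (i + 1) a)) •
        cubeMap E α β o i t (ver 0) b -
      ((α (i + 2) b * α i t + β (i + 2) b * β i t - β (i + 2) b * α i t) *
        (α i t * α (i + 1) a + β i t * β (i + 1) a - β i t * α (i + 1) a)) • E i t := by
  rw [h.cubeMap_mid, h.cubeMap_mid', cubeMap]
  module

theorem near_rep (h : IsCubeFrame X E α β o) (i : Fin 3) :
    ∃ p q : R3 →ₗ[ℝ] V4, IsStdPatch (X i false) p q (β (i + 1)) (α (i + 2)) ∧
      ∀ x y, cubeMap E α β o i (ver 0) x y = α (i + 2) y • p x + β (i + 1) x • q y := by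
  obtain ⟨p, q, hs, h1, h2⟩ := h.near i
  refine ⟨p, q, hs, fun x y => ?_⟩
  have ho : o = p (ver 0) + q (ver 0) := by
    rw [← h.start (i + 1), h1, hs.std.start₁, one_smul]
  rw [h.cubeMap_start, h1, h2, ho]
  module

end IsCubeFrame

/-- Two equations of the same arc differ by a projective change of parameter. -/
theorem IsConicArc.exists_diagonal {c : ℝ → RP3} {W : Submodule ℝ V4} (h : IsConicArc c W)
    {Γ Γ' : R3 →ₗ[ℝ] V4} (hi : Function.Injective Γ) (hi' : Function.Injective Γ')
    (ha : IsArcOf Γ c) (ha' : IsArcOf Γ' c) (h0 : Γ' (ver 0) = Γ (ver 0)) :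
    ∃ l > 0, ∀ x, Γ' x = Γ ![x 0, l * x 1, l ^ 2 * x 2] := by
  obtain ⟨G, hG⟩ := exists_left_inverse hi
  -- Both maps have the same plane as range, so the second factors through the first by an
  -- endomorphism of the parameter space. This endomorphism preserves the standard arc and its ends.
  have hr : ∀ x, Γ (G (Γ' x)) = Γ' x := by
    intro x
    have : Γ' x ∈ LinearMap.range Γ := by
      rw [← h.eq_range hi ha, h.eq_range hi' ha']
      exact ⟨x, rfl⟩
    obtain ⟨y, hy⟩ := this
    rw [← hy, hG]
  obtain ⟨s, hs0, hs⟩ := ha.finish.exists_smul ha'.finish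
  obtain ⟨l, hl, hM⟩ := diagonal_of_preserves_arc (M := G ∘ₗ Γ') (s₀ := 1) (s₂ := s)
    (by rw [LinearMap.comp_apply, h0, hG, one_smul])
    (by rw [LinearMap.comp_apply, hs, map_smul, hG])
    (fun t ht => by
      obtain ⟨u, hu, hut⟩ := ha'.exists_point t ht
      obtain ⟨t', ht', hut'⟩ := ha.exists_param u hu
      obtain ⟨a, ha0, hat⟩ := hut'.exists_smul hut
      exact ⟨t', ht', a, ha0, by rw [LinearMap.comp_apply, hat, map_smul, hG]⟩)
  refine ⟨l, hl, fun x => ?_⟩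
  rw [← hr x]
  have := hM x
  rw [LinearMap.comp_apply, one_smul] at this
  rw [this]

theorem linearIndependent₄ {a b c d : V4} (h : LinearIndependent ℝ ![b, c, d])
    (ha : a ∉ Submodule.span ℝ (Set.range ![b, c, d])) : LinearIndependent ℝ ![a, b, c, d] :=
  linearIndependent_finCons.2 ⟨h, ha⟩

/-- Linear forms with prescribed values on a basis. -/
theorem exists_functional {a b c d : V4} (h : LinearIndependent ℝ ![a, b, c, d]) (x y z w : ℝ) :
    ∃ f : V4 →ₗ[ℝ] ℝ, f a = x ∧ f b = y ∧ f c = z ∧ f d = w := by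
  set B := basisOfLinearIndependentOfCardEqFinrank h (by simp) with hB
  have hBi : ∀ i, B i = ![a, b, c, d] i := fun i => by
    rw [hB, coe_basisOfLinearIndependentOfCardEqFinrank]
  have key : ∀ i, B.constr ℝ ![x, y, z, w] (![a, b, c, d] i) = ![x, y, z, w] i := fun i => by
    rw [← hBi, Module.Basis.constr_basis]
  exact ⟨B.constr ℝ ![x, y, z, w], key 0, key 1, key 2, key 3⟩

namespace IsStdPatch

variable {f : ℝ → ℝ → RP3} {p q : R3 →ₗ[ℝ] V4} {φ ψ : R3 →ₗ[ℝ] ℝ}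

/-- Three vertices of a patch are not collinear. -/
theorem li_vertices (h : IsStdPatch f p q φ ψ) : LinearIndependent ℝ
    ![stdLift p q φ ψ 0 0, stdLift p q φ ψ 1 0, stdLift p q φ ψ 0 1] := by
  refine linearIndependent₃ fun x y z hxyz => ?_
  simp only [stdLift, h.std.start₁, h.std.start₂, one_smul] at hxyz
  have h0 : p ((x + z * ψ (ver 1)) • ver 0 + y • ver 1) +
      q ((x + y * φ (ver 1)) • ver 0 + z • ver 1) = 0 := by
    rw [← hxyz]
    simp only [map_add, map_smul]
    module
  obtain ⟨h1, h2⟩ := h.std.eq_zero_of_add h0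
  rw [map_add, map_smul, map_smul] at h1 h2
  obtain ⟨h3, h4⟩ := LinearIndependent.pair_iff.1 h.std.li₁ _ _ h1
  obtain ⟨h5, h6⟩ := LinearIndependent.pair_iff.1 h.std.li₂ _ _ h2
  rw [h6, zero_mul, add_zero] at h3
  exact ⟨h3, h4, h6⟩

theorem stdLift_one_one (h : IsStdPatch f p q φ ψ) : stdLift p q φ ψ 1 1 =
    ψ (ver 1) • stdLift p q φ ψ 1 0 + φ (ver 1) • stdLift p q φ ψ 0 1 -
      (φ (ver 1) * ψ (ver 1)) • stdLift p q φ ψ 0 0 := by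
  simp only [stdLift, h.std.start₁, h.std.start₂]
  module

theorem vertexSpan_eq (h : IsStdPatch f p q φ ψ) : vertexSpan f = Submodule.span ℝ
    (Set.range ![stdLift p q φ ψ 0 0, stdLift p q φ ψ 1 0, stdLift p q φ ψ 0 1]) := by
  have r00 : Represents (stdLift p q φ ψ 0 0) (f 0 0) := h.rep_side false false
  have r10 : Represents (stdLift p q φ ψ 1 0) (f 1 0) := h.rep_side true false
  have r01 : Represents (stdLift p q φ ψ 0 1) (f 0 1) := h.rep_side false true
  have r11 : Represents (stdLift p q φ ψ 1 1) (f 1 1) := h.rep_side true true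
  set U := Submodule.span ℝ
    (Set.range ![stdLift p q φ ψ 0 0, stdLift p q φ ψ 1 0, stdLift p q φ ψ 0 1]) with hU
  have m00 : stdLift p q φ ψ 0 0 ∈ U := Submodule.subset_span ⟨0, rfl⟩
  have m10 : stdLift p q φ ψ 1 0 ∈ U := Submodule.subset_span ⟨1, rfl⟩
  have m01 : stdLift p q φ ψ 0 1 ∈ U := Submodule.subset_span ⟨2, rfl⟩
  rw [vertexSpan]
  apply le_antisymm
  · refine sup_le (sup_le (sup_le ?_ ?_) ?_) ?_
    · rwa [r00.submodule_le]
    · rwa [r10.submodule_le]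
    · rw [r11.submodule_le, h.stdLift_one_one]
      exact U.sub_mem (U.add_mem (U.smul_mem _ m10) (U.smul_mem _ m01)) (U.smul_mem _ m00)
    · rwa [r01.submodule_le]
  · rw [hU, Submodule.span_le]
    rintro _ ⟨i, rfl⟩
    fin_cases i
    · exact r00.submodule_le.1 (le_sup_of_le_left (le_sup_of_le_left le_sup_left))
    · exact r10.submodule_le.1 (le_sup_of_le_left (le_sup_of_le_left le_sup_right))
    · exact r01.submodule_le.1 le_sup_right

theorem finrank_vertexSpan (h : IsStdPatch f p q φ ψ) :
    Module.finrank ℝ (vertexSpan f) = 3 := by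
  rw [h.vertexSpan_eq, finrank_span_eq_card h.li_vertices, Fintype.card_fin]

end IsStdPatch

/-- Data for the face opposite to the near face with normal `i`. -/
structure IsFarData (X : Fin 3 → Bool → ℝ → ℝ → RP3) (E : Fin 3 → R3 →ₗ[ℝ] V4)
    (α β : Fin 3 → R3 →ₗ[ℝ] ℝ) (o : V4) (i : Fin 3) (p q : R3 →ₗ[ℝ] V4) (φ ψ : R3 →ₗ[ℝ] ℝ) :
    Prop where
  patch : IsStdPatch (X i true) p q φ ψ
  eq₁ : ∀ x, cubeMap E α β o i (ver 1) x (ver 0) = p x + φ x • q (ver 0)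
  eq₂ : ∀ y, cubeMap E α β o i (ver 1) (ver 0) y = q y + ψ y • p (ver 0)

/-! ### The far faces -/

namespace IsCubeFrame

variable {X : Fin 3 → Bool → ℝ → ℝ → RP3} {E : Fin 3 → R3 →ₗ[ℝ] V4}
  {α β : Fin 3 → R3 →ₗ[ℝ] ℝ} {o : V4}

/-- Two near faces supply equations of two edges of the far face, with the same vector at their
common vertex. The standard form is taken with respect to these equations. -/
theorem exists_far (h : IsCubeFrame X E α β o) (hX : IsSCCube X) (hgen : IsGenericCube X)
    (i : Fin 3) : ∃ p q φ ψ, IsFarData X E α β o i p q φ ψ := by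
  obtain ⟨p₁, q₁, hs₁, he₁⟩ := h.near_rep (i + 2)
  obtain ⟨p₂, q₂, hs₂, he₂⟩ := h.near_rep (i + 1)
  rw [fin3_two_one, fin3_two_two] at hs₁ he₁
  rw [fin3_one_one, fin3_one_two] at hs₂ he₂
  have c₁ : ∀ x, stdConic q₁ p₁ (α (i + 1)) (β i) (ver 1) x =
      cubeMap E α β o i (ver 1) x (ver 0) := fun x => by
    rw [stdConic_swap_apply, ← cubeMap_rot', he₁]
  have c₂ : ∀ y, stdConic p₂ q₂ (β (i + 2)) (α i) (ver 1) y =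
      cubeMap E α β o i (ver 1) (ver 0) y := fun y => by
    rw [stdConic_apply, ← cubeMap_rot, he₂]
  obtain ⟨i₁, a₁⟩ := hs₁.isArcOf₂ true
  obtain ⟨i₂, a₂⟩ := hs₂.isArcOf₁ true
  have v₁ := fun τ => hX.vertices (i + 1) false true τ
  have b₁ := hX.common_boundary (i + 1) false true
  have v₂ := fun τ => hX.vertices (i + 2) true false τ
  have b₂ := hX.common_boundary (i + 2) true false
  rw [fin3_one_one, fin3_one_two] at b₁
  rw [fin3_two_one, fin3_two_two] at b₂
  simp only [fin3_one_one, fin3_one_two] at v₁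
  simp only [fin3_two_one, fin3_two_two] at v₂
  obtain ⟨p, q, φ, ψ, hs, h1, h2⟩ := (hX.patch i true).exists_isStdPatch (hgen.faces i true) i₁ i₂
    (a₁.congr_image (v₁ false).symm (v₁ true).symm b₁.symm)
    (a₂.congr_image (v₂ false) (v₂ true) b₂)
    (by
      change stdConic q₁ p₁ (α (i + 1)) (β i) (ver 1) _ =
        stdConic p₂ q₂ (β (i + 2)) (α i) (ver 1) _
      rw [c₁, c₂])
  refine ⟨p, q, φ, ψ, hs, fun x => ?_, fun y => ?_⟩
  · rw [← c₁]; exact h1 x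
  · rw [← c₂]; exact h2 y

/-- The first vertex and its neighbours are not coplanar. -/
theorem linearIndependent (h : IsCubeFrame X E α β o) (hX : IsSCCube X) (hgen : IsGenericCube X)
    (i : Fin 3) : LinearIndependent ℝ
      ![E i (ver 1), o, E (i + 1) (ver 1), E (i + 2) (ver 1)] := by
  obtain ⟨p, q, hs, he⟩ := h.near_rep i
  obtain ⟨p', q', φ, ψ, hs', h1, h2⟩ := h.exists_far hX hgen i
  have e00 : stdLift p q (β (i + 1)) (α (i + 2)) 0 0 = o := by
    rw [stdLift, ← he, h.cubeMap_edge, h.start]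
  have e10 : stdLift p q (β (i + 1)) (α (i + 2)) 1 0 = E (i + 1) (ver 1) := by
    rw [stdLift, ← he, ← cubeMap_rot, h.cubeMap_edge]
  have e01 : stdLift p q (β (i + 1)) (α (i + 2)) 0 1 = E (i + 2) (ver 1) := by
    rw [stdLift, ← he, ← cubeMap_rot', h.cubeMap_edge]
  have f00 : stdLift p' q' φ ψ 0 0 = E i (ver 1) := by
    rw [stdLift, hs'.std.start₂, one_smul, ← h1, h.cubeMap_edge]
  have f10 : stdLift p' q' φ ψ 1 0 = cubeMap E α β o i (ver 1) (ver 1) (ver 0) := by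
    rw [stdLift, hs'.std.start₂, one_smul, ← h1]
  have f01 : stdLift p' q' φ ψ 0 1 = cubeMap E α β o i (ver 1) (ver 0) (ver 1) := by
    rw [stdLift, hs'.std.start₁, one_smul, add_comm, ← h2]
  have hs1 := hs.vertexSpan_eq
  have hs2 := hs'.vertexSpan_eq
  have hli := hs.li_vertices
  rw [e00, e10, e01] at hs1 hli
  rw [f00, f10, f01] at hs2
  -- Two further vertices of the far face are combinations of o and its neighbours. If `E i (ver 1)`
  -- were in the near vertex plane, they would be too, and the planes of opposite faces would agree.
  refine linearIndependent₄ hli fun hmem => hgen.opposite i ?_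
  rw [← hs1] at hmem
  have m0 : o ∈ vertexSpan (X i false) := by rw [hs1]; exact Submodule.subset_span ⟨0, rfl⟩
  have m1 : E (i + 1) (ver 1) ∈ vertexSpan (X i false) := by
    rw [hs1]; exact Submodule.subset_span ⟨1, rfl⟩
  have m2 : E (i + 2) (ver 1) ∈ vertexSpan (X i false) := by
    rw [hs1]; exact Submodule.subset_span ⟨2, rfl⟩
  set U := vertexSpan (X i false)
  refine (Submodule.eq_of_le_of_finrank_eq ?_
    (hs'.finrank_vertexSpan.trans hs.finrank_vertexSpan.symm)).symm
  rw [hs2, Submodule.span_le]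
  rintro _ ⟨τ, rfl⟩
  fin_cases τ
  · exact hmem
  · change cubeMap E α β o i (ver 1) (ver 1) (ver 0) ∈ U
    rw [h.cubeMap_mid]
    exact U.sub_mem (U.add_mem (U.smul_mem _ hmem) (U.smul_mem _ m1)) (U.smul_mem _ m0)
  · change cubeMap E α β o i (ver 1) (ver 0) (ver 1) ∈ U
    rw [h.cubeMap_mid']
    exact U.sub_mem (U.add_mem (U.smul_mem _ m2) (U.smul_mem _ hmem)) (U.smul_mem _ m0)

/-- This is the elimination behind `far_forms`: the two hypotheses on μ and ν are coordinates of one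
vector identity, linear in these values of the unknown forms. After inserting m and n from `hm` and
`hn`, the non-zero factor D can be cancelled. -/
theorem far_algebra {ai aj bi bj m n a c μ ν D : ℝ} (hai : ai ≠ 0) (hbi : bi ≠ 0)
    (hbj : bj ≠ 0) (hD : D = ai * aj + bi * bj - bi * aj) (hD0 : D ≠ 0) (hm : m * ai = D)
    (hn : n * bj = D) (h1 : n * a + μ * (bi - n) = ν * bi)
    (h2 : μ * aj = m * c + ν * (aj - m)) :
    ν * bi = ai * a + (bi - ai) * c ∧ μ * aj = aj * a + bj * c - bj * a := by
  obtain rfl : m = D / ai := by rw [eq_div_iff hai, hm]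
  obtain rfl : n = D / bj := by rw [eq_div_iff hbj, hn]
  have k1 : D * a + μ * (bi * bj - D) = ν * bi * bj := by
    field_simp at h1; linear_combination h1
  have k2 : μ * aj * ai = D * c + ν * (aj * ai - D) := by
    field_simp at h2; linear_combination h2
  have g1 : ν * bi = ai * a + (bi - ai) * c := by
    have : D * (ν * bi - (ai * a + (bi - ai) * c)) = 0 := by
      rw [hD] at k1 k2 ⊢
      linear_combination (-ai) * k1 + (bi - ai) * k2
    have h3 := (mul_eq_zero.1 this).resolve_left hD0
    linarith
  refine ⟨g1, ?_⟩
  have : ai * bi * (μ * aj - (aj * a + bj * c - bj * a)) = 0 := by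
    rw [hD] at k2
    linear_combination bi * k2 + (aj * ai - (ai * aj + bi * bj - bi * aj)) * g1
  have h3 := (mul_eq_zero.1 this).resolve_left (mul_ne_zero hai hbi)
  linarith

/-- The linear forms of two far faces with a common edge. -/
theorem far_forms (h : IsCubeFrame X E α β o) (hX : IsSCCube X) (hgen : IsGenericCube X)
    (i : Fin 3) {p q p' q' : R3 →ₗ[ℝ] V4} {φ ψ φ' ψ' : R3 →ₗ[ℝ] ℝ}
    (hI : IsFarData X E α β o i p q φ ψ) (hJ : IsFarData X E α β o (i + 1) p' q' φ' ψ') (b : R3) :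
    ψ b * β i (ver 1) = α i (ver 1) * α (i + 2) b +
      (β i (ver 1) - α i (ver 1)) * β (i + 2) b ∧
    φ' b * α (i + 1) (ver 1) = α (i + 1) (ver 1) * α (i + 2) b +
      β (i + 1) (ver 1) * β (i + 2) b - β (i + 1) (ver 1) * α (i + 2) b := by
  obtain ⟨p'', q'', φ'', ψ'', hK⟩ := h.exists_far hX hgen (i + 2)
  have hli := h.linearIndependent hX hgen i
  obtain ⟨iI, aI⟩ := hI.patch.isArcOf₂ true
  obtain ⟨iJ, aJ⟩ := hJ.patch.isArcOf₁ true
  have vt := fun τ => hX.vertices (i + 2) true true τ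
  have bd := hX.common_boundary (i + 2) true true
  rw [fin3_two_one, fin3_two_two] at bd
  simp only [fin3_two_one, fin3_two_two] at vt
  have aJ' := aJ.congr_image (d := fun t => X i true (side true) t) (vt false) (vt true) bd
  obtain ⟨W, hW⟩ : ∃ W, IsConicArc (fun t => X i true (side true) t) W := by
    obtain ⟨-, W, -, hW, -⟩ := (hgen.faces i true).1
    exact ⟨W, hW⟩
  set xi := E i (ver 1) with hxi
  set xj := E (i + 1) (ver 1) with hxj
  set xk := E (i + 2) (ver 1) with hxk
  set ai := α i (ver 1) with hai
  set aj := α (i + 1) (ver 1) with haj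
  set bi := β i (ver 1) with hbi
  set bj := β (i + 1) (ver 1) with hbj
  set m := φ (ver 1) with hm
  set n := ψ' (ver 1) with hn
  set xij := aj • xi + bi • xj - (bi * aj) • o with hxij
  have eB : ∀ y, cubeMap E α β o i (ver 1) (ver 0) y =
      ai • E (i + 2) y + β (i + 2) y • xi - (β (i + 2) y * ai) • o := fun y => h.cubeMap_mid' i _ y
  have eA : ∀ x, cubeMap E α β o (i + 1) (ver 1) x (ver 0) =
      α (i + 2) x • xj + bj • E (i + 2) x - (bj * α (i + 2) x) • o := fun x => by
    have := h.cubeMap_mid (i + 1) (ver 1) x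
    rwa [fin3_one_one] at this
  have exij : cubeMap E α β o i (ver 1) (ver 1) (ver 0) = xij := h.cubeMap_mid i _ _
  have exij' : cubeMap E α β o (i + 1) (ver 1) (ver 0) (ver 1) = xij := by
    have := h.cubeMap_mid' (i + 1) (ver 1) (ver 1)
    rw [fin3_one_two] at this
    rw [this, hxij]
  have gI : ∀ y, stdConic q p ψ φ (ver 1) y =
      m • cubeMap E α β o i (ver 1) (ver 0) y + ψ y • (xij - m • xi) := fun y => by
    have h1 := hI.eq₁ (ver 0)
    have h2 := hI.eq₁ (ver 1)
    rw [h.cubeMap_edge, hI.patch.std.start₁] at h1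
    rw [exij] at h2
    rw [stdConic_swap_apply, hI.eq₂, h2, hxi, h1]
    module
  have gJ : ∀ x, stdConic p' q' φ' ψ' (ver 1) x =
      n • cubeMap E α β o (i + 1) (ver 1) x (ver 0) + φ' x • (xij - n • xj) := fun x => by
    have h1 := hJ.eq₂ (ver 0)
    have h2 := hJ.eq₂ (ver 1)
    rw [h.cubeMap_edge, hJ.patch.std.start₂] at h1
    rw [exij'] at h2
    rw [stdConic_apply, hJ.eq₁, h2, hxj, h1]
    module
  have eB0 : cubeMap E α β o i (ver 1) (ver 0) (ver 0) = xi := h.cubeMap_edge i _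
  have eA0 : cubeMap E α β o (i + 1) (ver 1) (ver 0) (ver 0) = xj := h.cubeMap_edge (i + 1) _
  -- The edge shared by the two far faces now has two equations, equal at the common vertex.
  obtain ⟨l, hl, hdiag⟩ := hW.exists_diagonal iI iJ aI aJ' (by
    change stdConic p' q' φ' ψ' (ver 1) _ = stdConic q p ψ φ (ver 1) _
    rw [gI, gJ, eB0, eA0, hI.patch.std.start₂, hJ.patch.std.start₁]
    module)
  change ∀ x, stdConic p' q' φ' ψ' (ver 1) x = stdConic q p ψ φ (ver 1) _ at hdiag
  have hd1 : stdConic p' q' φ' ψ' (ver 1) (ver 1) =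
      l ^ 2 • stdConic q p ψ φ (ver 1) (ver 1) := by
    rw [hdiag, ← map_smul]
    congr 1
    apply ext3 <;> simp
  have hai0 : ai ≠ 0 := h.α_finish i
  have hbi0 : bi ≠ 0 := h.β_finish i
  have hbj0 : bj ≠ 0 := h.β_finish _
  -- These values make f vanish on the vertex plane of the third far face, with normal i + 2, and
  -- therefore at the last vertex of the cube.
  obtain ⟨f, fi, fo, fj, fk⟩ := exists_functional hli ai 1 bj 0
  have fI : f (stdConic q p ψ φ (ver 1) (ver 1)) = 0 := by
    have r1 : Represents (stdConic q p ψ φ (ver 1) (ver 1)) (X i true 1 1) := by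
      rw [stdConic_swap_apply]; exact hI.patch.rep_side true true
    have r2 : Represents (stdLift p'' q'' φ'' ψ'' 1 1) (X i true 1 1) := by
      have h1 := hX.vertices (i + 1) true true true
      rw [fin3_one_one, fin3_one_two] at h1
      have h2 := hK.patch.rep_side true true
      rwa [h1] at h2
    obtain ⟨s, -, hs⟩ := r2.exists_smul r1
    have k1 := hK.eq₁ (ver 1)
    have k2 := hK.eq₂ (ver 1)
    have k0 := hK.eq₁ (ver 0)
    rw [h.cubeMap_edge, hK.patch.std.start₁] at k0
    rw [h.cubeMap_mid, fin3_two_one] at k1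
    rw [h.cubeMap_mid', fin3_two_two] at k2
    have e : stdLift p'' q'' φ'' ψ'' 1 1 = ψ'' (ver 1) • (p'' (ver 1) + φ'' (ver 1) • q'' (ver 0)) +
        φ'' (ver 1) • (q'' (ver 1) + ψ'' (ver 1) • p'' (ver 0)) -
        (φ'' (ver 1) * ψ'' (ver 1)) • (p'' (ver 0) + (1 : ℝ) • q'' (ver 0)) := by
      rw [stdLift]; module
    rw [hs, e, ← k1, ← k2, ← k0]
    simp only [map_add, map_sub, map_smul, smul_eq_mul, ← hxi, ← hxj, ← hxk, fi, fo, fj, fk,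
      ← hai, ← hbj]
    ring
  have fxij : f xij = ai * aj + bi * bj - bi * aj := by
    simp only [hxij, map_add, map_sub, map_smul, smul_eq_mul, fi, fo, fj]
    ring
  set D := ai * aj + bi * bj - bi * aj with hD
  have hmD : m * ai = D := by
    have h1 := fI
    rw [gI, eB] at h1
    simp only [map_add, map_sub, map_smul, smul_eq_mul, fi, fo, fxij, ← hxk, fk] at h1
    have h2 : ψ (ver 1) * (D - m * ai) = 0 := by linear_combination h1
    have h3 := (mul_eq_zero.1 h2).resolve_left hI.patch.std.finish₂
    linarith
  have hnD : n * bj = D := by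
    have h1 := congrArg f hd1
    rw [map_smul, fI, smul_zero, gJ, eA] at h1
    simp only [map_add, map_sub, map_smul, smul_eq_mul, fj, fo, fxij, ← hxk, fk] at h1
    have h2 : φ' (ver 1) * (D - n * bj) = 0 := by linear_combination h1
    have h3 := (mul_eq_zero.1 h2).resolve_left hJ.patch.std.finish₁
    linarith
  have hm0 : m ≠ 0 := hI.patch.std.finish₁
  have hD0 : D ≠ 0 := by rw [← hmD]; exact mul_ne_zero hm0 hai0
  -- The coordinate along the third edge at the last vertex is proportional to D on both sides,
  -- which leaves l² = 1, and l is positive.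
  have hl1 : l = 1 := by
    obtain ⟨g, gi, go, gj, gk⟩ := exists_functional hli 0 0 0 1
    have h1 := congrArg g hd1
    rw [map_smul, gI, gJ, eB, eA, hxij] at h1
    simp only [map_add, map_sub, map_smul, smul_eq_mul, gi, gj, go, ← hxk, gk] at h1
    have h2 : D * (l ^ 2 - 1) = 0 := by linear_combination -h1 + hnD - l ^ 2 * hmD
    have h3 := (mul_eq_zero.1 h2).resolve_left hD0
    nlinarith
  have hfin : n • cubeMap E α β o (i + 1) (ver 1) b (ver 0) + φ' b • (xij - n • xj) =
      m • cubeMap E α β o i (ver 1) (ver 0) b + ψ b • (xij - m • xi) := by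
    rw [← gI, ← gJ, hdiag, hl1]
    congr 1
    apply ext3 <;> simp
  rw [eA, eB, hxij] at hfin
  -- The coordinates along the two other edges are compared. Those of `E (i + 2) b` drop out,
  -- because they enter both sides with the factor D.
  refine far_algebra hai0 hbi0 hbj0 hD hD0 hmD hnD ?_ ?_
  · obtain ⟨g, gi, go, gj, gk⟩ := exists_functional hli 0 0 1 0
    have h1 := congrArg g hfin
    simp only [map_add, map_sub, map_smul, smul_eq_mul, gi, gj, go] at h1
    linear_combination h1 + g (E (i + 2) b) * (hmD - hnD)
  · obtain ⟨g, gi, go, gj, gk⟩ := exists_functional hli 1 0 0 0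
    have h1 := congrArg g hfin
    simp only [map_add, map_sub, map_smul, smul_eq_mul, gi, gj, go] at h1
    linear_combination h1 + g (E (i + 2) b) * (hmD - hnD)

/-- The cube map parametrizes the far faces. -/
theorem far_rep (h : IsCubeFrame X E α β o) (hX : IsSCCube X) (hgen : IsGenericCube X)
    (i : Fin 3) : ∃ (p q : R3 →ₗ[ℝ] V4) (φ ψ : R3 →ₗ[ℝ] ℝ), IsStdPatch (X i true) p q φ ψ ∧
      ∀ x y, cubeMap E α β o i (ver 1) x y = ψ y • p x + φ x • q y := by
  obtain ⟨p, q, φ, ψ, hI⟩ := h.exists_far hX hgen i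
  obtain ⟨p₁, q₁, φ₁, ψ₁, hJ⟩ := h.exists_far hX hgen (i + 1)
  obtain ⟨p₂, q₂, φ₂, ψ₂, hK⟩ := h.exists_far hX hgen (i + 2)
  refine ⟨p, q, φ, ψ, hI.patch, fun x y => ?_⟩
  have e1 := (h.far_forms hX hgen i hI hJ y).1
  have hI' : IsFarData X E α β o (i + 2 + 1) p q φ ψ := by rwa [fin3_two_one]
  have e2 := (h.far_forms hX hgen (i + 2) hK hI' x).2
  -- The form ψ comes from the comparison with far face i + 1, the form φ from that with far face i
  -- + 2. Inserted into the expression of the slice by its two edges, they give the lift of the far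
  -- face.
  rw [fin3_two_one, fin3_two_two] at e2
  have ha := h.α_finish i
  have hb := h.β_finish i
  refine smul_right_injective V4 (mul_ne_zero ha hb) ?_
  have e3 := hI.eq₁ (ver 0)
  rw [h.cubeMap_edge, hI.patch.std.start₁] at e3
  change (α i (ver 1) * β i (ver 1)) • cubeMap E α β o i (ver 1) x y = _
  rw [h.smul_cubeMap, hI.eq₁, hI.eq₂, e3]
  have e1' : α (i + 2) y * α i (ver 1) + β (i + 2) y * β i (ver 1) - β (i + 2) y * α i (ver 1) =
      ψ y * β i (ver 1) := by rw [e1]; ring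
  rw [e1', ← e2]
  module

/-- The cube map parametrizes all faces. -/
theorem face_rep (h : IsCubeFrame X E α β o) (hX : IsSCCube X) (hgen : IsGenericCube X)
    (i : Fin 3) (ε : Bool) : ∃ (p q : R3 →ₗ[ℝ] V4) (φ ψ : R3 →ₗ[ℝ] ℝ),
      IsStdPatch (X i ε) p q φ ψ ∧
      ∀ x y, cubeMap E α β o i (ver (side ε)) x y = ψ y • p x + φ x • q y := by
  cases ε
  · obtain ⟨p, q, hs, he⟩ := h.near_rep i
    exact ⟨p, q, _, _, hs, he⟩
  · exact h.far_rep hX hgen i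

end IsCubeFrame

/-- The point with given parameters of the cube. -/
noncomputable def cubePoint (E : Fin 3 → R3 →ₗ[ℝ] V4) (α β : Fin 3 → R3 →ₗ[ℝ] ℝ) (o : V4)
    (i : Fin 3) (t a b : ℝ) : RP3 :=
  toPoint (cubeMap E α β o i (ver t) (ver a) (ver b))

/-- The faces of the cube with matching parameters. -/
noncomputable def cubeFace (E : Fin 3 → R3 →ₗ[ℝ] V4) (α β : Fin 3 → R3 →ₗ[ℝ] ℝ) (o : V4)
    (i : Fin 3) (ε : Bool) (a b : ℝ) : RP3 :=
  cubePoint E α β o i (side ε) a b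

/-! ### Points of the cube and the members of its families -/

section cubePoint

variable (E : Fin 3 → R3 →ₗ[ℝ] V4) (α β : Fin 3 → R3 →ₗ[ℝ] ℝ) (o : V4)

theorem cubePoint_rot (i : Fin 3) (t a b : ℝ) :
    cubePoint E α β o (i + 1) a b t = cubePoint E α β o i t a b := by
  rw [cubePoint, cubeMap_rot, cubePoint]

theorem cubePoint_rot' (i : Fin 3) (t a b : ℝ) :
    cubePoint E α β o (i + 2) b t a = cubePoint E α β o i t a b := by
  rw [cubePoint, cubeMap_rot', cubePoint]

theorem contDiff_cubeMap (i : Fin 3) : ContDiff ℝ ∞ fun x : ℝ × ℝ × ℝ =>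
    cubeMap E α β o i (ver x.1) (ver x.2.1) (ver x.2.2) := by
  have h0 : ∀ {F : Type} [NormedAddCommGroup F] [NormedSpace ℝ F] (Γ : R3 →ₗ[ℝ] F),
      ContDiff ℝ ∞ fun x : ℝ × ℝ × ℝ => Γ (ver x.1) :=
    fun Γ => (contDiff_lin_ver Γ).comp contDiff_fst
  have h1 : ∀ {F : Type} [NormedAddCommGroup F] [NormedSpace ℝ F] (Γ : R3 →ₗ[ℝ] F),
      ContDiff ℝ ∞ fun x : ℝ × ℝ × ℝ => Γ (ver x.2.1) := fun Γ =>
    (contDiff_lin_ver Γ).comp (contDiff_fst.comp contDiff_snd)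
  have h2 : ∀ {F : Type} [NormedAddCommGroup F] [NormedSpace ℝ F] (Γ : R3 →ₗ[ℝ] F),
      ContDiff ℝ ∞ fun x : ℝ × ℝ × ℝ => Γ (ver x.2.2) := fun Γ =>
    (contDiff_lin_ver Γ).comp (contDiff_snd.comp contDiff_snd)
  unfold cubeMap
  have a0 := h0 (α i)
  have b0 := h0 (β i)
  have a1 := h1 (α (i + 1))
  have b1 := h1 (β (i + 1))
  have a2 := h2 (α (i + 2))
  have b2 := h2 (β (i + 2))
  exact ((((((a1.mul a2).add (b1.mul b2)).sub (b1.mul a2)).smul (h0 (E i))).add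
    ((((a2.mul a0).add (b2.mul b0)).sub (b2.mul a0)).smul (h1 (E (i + 1))))).add
    ((((a0.mul a1).add (b0.mul b1)).sub (b0.mul a1)).smul (h2 (E (i + 2))))).sub
    ((((a0.mul a1).mul a2).add ((b0.mul b1).mul b2)).smul contDiff_const)

end cubePoint

namespace IsCubeFrame

variable {X : Fin 3 → Bool → ℝ → ℝ → RP3} {E : Fin 3 → R3 →ₗ[ℝ] V4}
  {α β : Fin 3 → R3 →ₗ[ℝ] ℝ} {o : V4}

theorem rep_of_eq {i : Fin 3} {t : ℝ} {p q : R3 →ₗ[ℝ] V4} {φ ψ : R3 →ₗ[ℝ] ℝ}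
    (hs : IsStd p q φ ψ) (he : ∀ x y, cubeMap E α β o i (ver t) x y = ψ y • p x + φ x • q y) :
    ∀ u ∈ UI, ∀ v ∈ UI, Represents (stdLift p q φ ψ u v) (cubePoint E α β o i t u v) :=
  fun u hu v hv => by
    rw [cubePoint, he]
    exact represents_toPoint (hs.lift_ne_zero hu hv)

theorem face_ne_zero (h : IsCubeFrame X E α β o) (hX : IsSCCube X) (hgen : IsGenericCube X)
    (i : Fin 3) (ε : Bool) {a b : ℝ} (ha : a ∈ UI) (hb : b ∈ UI) :
    cubeMap E α β o i (ver (side ε)) (ver a) (ver b) ≠ 0 := by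
  obtain ⟨p, q, φ, ψ, hs, he⟩ := h.face_rep hX hgen i ε
  rw [he]
  exact hs.std.lift_ne_zero ha hb

theorem isReparamOf_face (h : IsCubeFrame X E α β o) (hX : IsSCCube X) (hgen : IsGenericCube X)
    (i : Fin 3) (ε : Bool) : IsReparamOf (cubeFace E α β o i ε) (X i ε) := by
  obtain ⟨p, q, φ, ψ, hs, he⟩ := h.face_rep hX hgen i ε
  obtain ⟨r₁, r₂, hr₁, hr₂, hrep⟩ := hs.rep
  obtain ⟨k₁, hk₁, e₁⟩ := hr₁.exists_inverse
  obtain ⟨k₂, hk₂, e₂⟩ := hr₂.exists_inverse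
  -- The parameters of the trilinear map are the arguments of `ver`, so the changes of parameter of
  -- the standard form have to be inverted.
  refine ⟨k₁, k₂, hk₁, hk₂, fun a ha b hb => ?_⟩
  have h1 := hrep _ (hk₁.mem_UI ha) _ (hk₂.mem_UI hb)
  rw [e₁ a ha, e₂ b hb] at h1
  exact (rep_of_eq hs.std he a ha b hb).eq h1

theorem face_edge (i : Fin 3) (ε δ : Bool) (t : ℝ) :
    cubeFace E α β o (i + 1) ε (side δ) t = cubeFace E α β o (i + 2) δ t (side ε) := by
  rw [cubeFace, cubePoint_rot, cubeFace, cubePoint_rot']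

theorem side_mem_params (h : IsCubeFrame X E α β o) (hX : IsSCCube X) (hgen : IsGenericCube X)
    (i : Fin 3) (ε : Bool) : side ε ∈ nondegenerateParams (cubeFace E α β o) i := by
  obtain ⟨p, q, φ, ψ, hs, he⟩ := h.face_rep hX hgen i ε
  refine ⟨side_mem_UI ε, ?_⟩
  convert hs.std.nondegenerateQuad (rep_of_eq hs.std he) using 3 with δ b δ a
  · rw [cubeFace, cubePoint_rot]
  · rw [cubeFace, cubePoint_rot']

/-- The members of the families of a cube. -/
theorem exists_member (h : IsCubeFrame X E α β o) (hX : IsSCCube X) (hgen : IsGenericCube X)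
    (i : Fin 3) {t : ℝ} (ht : t ∈ nondegenerateParams (cubeFace E α β o) i) :
    ∃ (p q : R3 →ₗ[ℝ] V4) (φ ψ : R3 →ₗ[ℝ] ℝ), IsStd p q φ ψ ∧
      (∀ x y, cubeMap E α β o i (ver t) x y = ψ y • p x + φ x • q y) ∧
      α i (ver t) ≠ 0 ∧ β i (ver t) ≠ 0 ∧
      (∀ x, cubeMap E α β o i (ver t) x (ver 0) = p x + φ x • q (ver 0)) ∧
      (∀ y, cubeMap E α β o i (ver t) (ver 0) y = q y + ψ y • p (ver 0)) ∧
      (∀ x, φ x * α i (ver t) = α i (ver t) * α (i + 1) x + β i (ver t) * β (i + 1) x -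
        β i (ver t) * α (i + 1) x) ∧
      ∀ y, ψ y * β i (ver t) = α (i + 2) y * α i (ver t) + β (i + 2) y * β i (ver t) -
        β (i + 2) y * α i (ver t) := by
  obtain ⟨htU, hquad⟩ := ht
  have hb : ∀ δ, ∀ a ∈ UI, Represents (cubeMap E α β o i (ver t) (ver a) (ver (side δ)))
      (cubeFace E α β o (i + 2) δ t a) := fun δ a ha => by
    have hne := h.face_ne_zero hX hgen (i + 2) δ htU ha
    rw [cubeFace, cubePoint_rot', cubePoint]
    rw [cubeMap_rot'] at hne
    exact represents_toPoint hne
  have ha : ∀ ε, ∀ b ∈ UI, Represents (cubeMap E α β o i (ver t) (ver (side ε)) (ver b))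
      (cubeFace E α β o (i + 1) ε b t) := fun ε b hb => by
    have hne := h.face_ne_zero hX hgen (i + 1) ε hb htU
    rw [cubeFace, cubePoint_rot, cubePoint]
    rw [cubeMap_rot] at hne
    exact represents_toPoint hne
  set A : R3 →ₗ[ℝ] V4 := (α (i + 1)).smulRight (E i (ver t)) + β i (ver t) • E (i + 1) -
    (β i (ver t) • α (i + 1)).smulRight o with hA
  set B : R3 →ₗ[ℝ] V4 := α i (ver t) • E (i + 2) + (β (i + 2)).smulRight (E i (ver t)) -
    (α i (ver t) • β (i + 2)).smulRight o with hB
  have eA : ∀ x, cubeMap E α β o i (ver t) x (ver 0) = A x := fun x => by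
    rw [h.cubeMap_mid]
    simp [hA]
  have eB : ∀ y, cubeMap E α β o i (ver t) (ver 0) y = B y := fun y => by
    rw [h.cubeMap_mid', mul_comm (β (i + 2) y)]
    simp [hB]
  obtain ⟨WA, WB, hWA, hWB, -⟩ := id hquad
  have iA : Function.Injective A := ((hWB false).injective_of_param fun a ha => by
    rw [← eA]; exact hb false a ha).1
  have iB : Function.Injective B := ((hWA false).injective_of_param fun b hb => by
    rw [← eB]; exact ha false b hb).1
  have hker : ∀ ℓ : R3 →ₗ[ℝ] ℝ, ∃ x, x ≠ 0 ∧ ℓ x = 0 := fun ℓ => by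
    by_contra hcon
    push Not at hcon
    have hi : Function.Injective ℓ := by
      rw [← LinearMap.ker_eq_bot, LinearMap.ker_eq_bot']
      exact fun x hx => by_contra fun hx0 => hcon x hx0 hx
    have := LinearMap.finrank_le_finrank_of_injective hi
    simp at this
  -- For β = 0 the equation A of a boundary arc would kill the kernel of the form `α (i + 1)`, yet
  -- conic arcs have injective equations. The argument for α is the same with B.
  have hβ : β i (ver t) ≠ 0 := by
    intro h0
    obtain ⟨x, hx, hx0⟩ := hker (α (i + 1))
    exact hx (iA (by simp [hA, h0, hx0]))
  have hα : α i (ver t) ≠ 0 := by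
    intro h0
    obtain ⟨x, hx, hx0⟩ := hker (β (i + 2))
    exact hx (iB (by simp [hB, h0, hx0]))
  set φ : R3 →ₗ[ℝ] ℝ := (α i (ver t))⁻¹ • (α i (ver t) • α (i + 1) + β i (ver t) • β (i + 1) -
    β i (ver t) • α (i + 1)) with hφ
  set ψ : R3 →ₗ[ℝ] ℝ := (β i (ver t))⁻¹ • (α i (ver t) • α (i + 2) + β i (ver t) • β (i + 2) -
    α i (ver t) • β (i + 2)) with hψ
  have eφ : ∀ x, φ x * α i (ver t) = α i (ver t) * α (i + 1) x + β i (ver t) * β (i + 1) x -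
      β i (ver t) * α (i + 1) x := fun x => by
    simp only [hφ, LinearMap.smul_apply, LinearMap.sub_apply, LinearMap.add_apply, smul_eq_mul]
    field_simp
  have eψ : ∀ y, ψ y * β i (ver t) = α (i + 2) y * α i (ver t) + β (i + 2) y * β i (ver t) -
      β (i + 2) y * α i (ver t) := fun y => by
    simp only [hψ, LinearMap.smul_apply, LinearMap.sub_apply, LinearMap.add_apply, smul_eq_mul]
    field_simp
  -- Division of `smul_cubeMap` by the non-zero factor shows that the slice at t is built from its
  -- two edges like a near face, with new forms φ and ψ.
  have eT : ∀ x y, cubeMap E α β o i (ver t) x y =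
      ψ y • A x + φ x • B y - (φ x * ψ y) • E i (ver t) := fun x y => by
    refine smul_right_injective V4 (mul_ne_zero hα hβ) ?_
    change (α i (ver t) * β i (ver t)) • cubeMap E α β o i (ver t) x y = _
    rw [h.smul_cubeMap, eA, eB, ← eφ, ← eψ]
    module
  obtain ⟨p, q, hs, hp, hq⟩ := exists_isStd_of_nondegenerateQuad (A := A) (B := B) (φ := φ)
    (ψ := ψ) (o := E i (ver t)) hquad (by rw [← eA, h.cubeMap_edge])
    (by rw [← eB, h.cubeMap_edge])
    (by
      refine mul_right_cancel₀ hα ?_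
      rw [eφ, h.α_start, h.β_start]; ring)
    (by
      refine mul_right_cancel₀ hβ ?_
      rw [eψ, h.α_start, h.β_start]; ring)
    (fun δ a ha => by rw [← eT]; exact hb δ a ha) (fun ε b hb => by rw [← eT]; exact ha ε b hb)
  have ho : E i (ver t) = p (ver 0) + q (ver 0) := by
    rw [← h.cubeMap_edge, eA, hp, hs.start₁, one_smul]
  refine ⟨p, q, φ, ψ, hs, fun x y => ?_, hα, hβ, fun x => by rw [eA, hp],
    fun y => by rw [eB, hq], eφ, eψ⟩
  rw [eT, hp, hq, ho]
  module

end IsCubeFrame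

/-- For values g(y) P(x) + f(x) Q(y), the alternating sum with weights f'g', f'g, fg', fg cancels.
The remaining cases are those where all these weights vanish. -/
theorem not_linearIndependent_of_products {s f f' g g' : ℝ} {P P' Q Q' t₁ t₂ t₃ t₄ : V4}
    (hs : s ≠ 0) (h₁ : s • t₁ = g • P + f • Q) (h₂ : s • t₂ = g' • P + f • Q')
    (h₃ : s • t₃ = g • P' + f' • Q) (h₄ : s • t₄ = g' • P' + f' • Q') :
    ¬ LinearIndependent ℝ ![t₁, t₂, t₃, t₄] := by
  have key : ∀ x y z w : ℝ, x • (g • P + f • Q) + y • (g' • P + f • Q') + z • (g • P' + f' • Q) +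
      w • (g' • P' + f' • Q') = 0 → ¬ (x = 0 ∧ y = 0 ∧ z = 0 ∧ w = 0) →
      ¬ LinearIndependent ℝ ![t₁, t₂, t₃, t₄] := by
    intro x y z w h0 hne
    refine not_linearIndependent₄ x y z w ?_ hne
    refine (smul_eq_zero.1 ?_).resolve_left hs
    rw [← h0, ← h₁, ← h₂, ← h₃, ← h₄]
    module
  -- If all weights vanish, the forms degenerate so far that one of the vectors is zero or two of
  -- them are proportional.
  by_cases hc : f' * g' = 0 ∧ f' * g = 0 ∧ f * g' = 0 ∧ f * g = 0
  · by_cases hg : g = 0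
    · by_cases hf : f = 0
      · exact key 1 0 0 0 (by rw [hg, hf]; module) (by simp)
      · exact key f' 0 (-f) 0 (by rw [hg]; module) (by simp [hf])
    · have hf : f = 0 := (mul_eq_zero.1 hc.2.2.2).resolve_right hg
      have hf' : f' = 0 := (mul_eq_zero.1 hc.2.1).resolve_right hg
      exact key g' (-g) 0 0 (by rw [hf]; module) (by simp [hg])
  · refine key (-(f' * g')) (f' * g) (f * g') (-(f * g)) (by module) ?_
    rintro ⟨h1, h2, h3, h4⟩
    exact hc ⟨neg_eq_zero.1 h1, h2, h3, neg_eq_zero.1 h4⟩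

namespace IsCubeFrame

variable {X : Fin 3 → Bool → ℝ → ℝ → RP3} {E : Fin 3 → R3 →ₗ[ℝ] V4}
  {α β : Fin 3 → R3 →ₗ[ℝ] ℝ} {o : V4}

/-! ### Fundamental transforms -/

/-- Up to the factor α_i(c) β_i(c) the slice has the form g(y) P(x) + f(x) Q(y). The finitely many
zeros of the factor are covered because dependence is a closed condition. -/
theorem not_linearIndependent_slice (h : IsCubeFrame X E α β o) (i : Fin 3) (x x' y y' : R3)
    {c : ℝ} (hc : c ∈ UI) : ¬ LinearIndependent ℝ
      ![cubeMap E α β o i (ver c) x y, cubeMap E α β o i (ver c) x y',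
        cubeMap E α β o i (ver c) x' y, cubeMap E α β o i (ver c) x' y'] := by
  have hα : α i ≠ 0 := fun h0 => by simpa [h0] using h.α_start i
  have hβ : β i ≠ 0 := fun h0 => by simpa [h0] using h.β_start i
  have hcont : ∀ x y, Continuous fun c => cubeMap E α β o i (ver c) x y := fun x y => by
    have h1 : Continuous fun c => α i (ver c) := (contDiff_lin_ver (α i)).continuous
    have h2 : Continuous fun c => β i (ver c) := (contDiff_lin_ver (β i)).continuous
    have h3 : Continuous fun c => E i (ver c) := (contDiff_lin_ver (E i)).continuous
    have h4 : Continuous fun p : ℝ × ℝ × V4 =>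
        (α (i + 1) x * α (i + 2) y + β (i + 1) x * β (i + 2) y - β (i + 1) x * α (i + 2) y) •
            p.2.2 +
          (α (i + 2) y * p.1 + β (i + 2) y * p.2.1 - β (i + 2) y * p.1) • E (i + 1) x +
          (p.1 * α (i + 1) x + p.2.1 * β (i + 1) x - p.2.1 * α (i + 1) x) • E (i + 2) y -
          (p.1 * α (i + 1) x * α (i + 2) y + p.2.1 * β (i + 1) x * β (i + 2) y) • o := by
      fun_prop
    exact h4.comp (h1.prodMk (h2.prodMk h3))
  suffices H : ∀ c ∈ UI, ¬ LinearIndependent ℝ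
      ![cubeMap E α β o i (ver c) x y, cubeMap E α β o i (ver c) x y',
        cubeMap E α β o i (ver c) x' y, cubeMap E α β o i (ver c) x' y'] from H c hc
  refine forall_UI_of_cofinite (isClosed_not_linearIndependent (continuous_pi fun j => ?_))
    ((lin_ver_finite hα).union (lin_ver_finite hβ)) fun c hc hcZ => ?_
  · fin_cases j
    · exact hcont x y
    · exact hcont x y'
    · exact hcont x' y
    · exact hcont x' y'
  · simp only [Set.mem_union, Set.mem_ofPred_eq, not_or] at hcZ
    set a := α i (ver c)
    set b := β i (ver c)
    have key : ∀ x y, (a * b) • cubeMap E α β o i (ver c) x y =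
        (α (i + 2) y * a + β (i + 2) y * b - β (i + 2) y * a) •
          (a • cubeMap E α β o i (ver c) x (ver 0) -
            (a * α (i + 1) x + b * β (i + 1) x - b * α (i + 1) x) • E i (ver c)) +
        (a * α (i + 1) x + b * β (i + 1) x - b * α (i + 1) x) •
          (b • cubeMap E α β o i (ver c) (ver 0) y) := fun x y => by
      rw [h.smul_cubeMap]
      module
    exact not_linearIndependent_of_products (mul_ne_zero hcZ.1 hcZ.2) (key x y) (key x y')
      (key x' y) (key x' y')

/-- Point and tangent of both nets are values of one slice: the parameter of the curve is fixed, one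
argument runs through `ver s` and `ver t`, the other through `ver` and `dver` of the moving
parameter. -/
theorem isFundamentalTransform (h : IsCubeFrame X E α β o) (i : Fin 3) {s t : ℝ}
    {p q p' q' : R3 →ₗ[ℝ] V4} {φ ψ φ' ψ' : R3 →ₗ[ℝ] ℝ} (hs : IsStd p q φ ψ)
    (es : ∀ x y, cubeMap E α β o i (ver s) x y = ψ y • p x + φ x • q y) (ht : IsStd p' q' φ' ψ')
    (et : ∀ x y, cubeMap E α β o i (ver t) x y = ψ' y • p' x + φ' x • q' y) :
    IsFundamentalTransform (cubePoint E α β o i s) (cubePoint E α β o i t) := by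
  refine ⟨stdLift p q φ ψ, stdLift p' q' φ' ψ', ⟨contDiff_stdLift _ _ _ _, rep_of_eq hs es⟩,
    ⟨contDiff_stdLift _ _ _ _, rep_of_eq ht et⟩, hs.conj, ht.conj, fun u hu v hv => ⟨?_, ?_⟩⟩
  · rw [partial₁_stdLift, partial₁_stdLift, stdLift, stdLift, ← es, ← es, ← et, ← et]
    simp only [← cubeMap_rot' E α β o i]
    exact h.not_linearIndependent_slice (i + 2) _ _ _ _ hv
  · rw [partial₂_stdLift, partial₂_stdLift, stdLift, stdLift, ← es, ← es, ← et, ← et]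
    simp only [← cubeMap_rot E α β o i]
    intro hli
    exact h.not_linearIndependent_slice (i + 1) _ _ _ _ hu (linearIndependent_swap₄ hli)

/-! ### Characteristic lines -/

theorem E_injective (h : IsCubeFrame X E α β o) (d : Fin 3) : Function.Injective (E d) := by
  obtain ⟨p, q, hs, h1, -⟩ := h.near (d + 2)
  rw [fin3_two_one] at hs h1
  rw [← LinearMap.ker_eq_bot, LinearMap.ker_eq_bot']
  intro x hx
  rw [h1, ← map_smul] at hx
  obtain ⟨h2, h3⟩ := hs.std.eq_zero_of_add hx
  rw [map_smul] at h3
  exact hs.std.inj₁ x h2 ((smul_eq_zero.1 h3).resolve_right (hs.std.ne₂ 0 zero_mem_UI))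

theorem finrank_map_ker (h : IsCubeFrame X E α β o) (i : Fin 3) {ℓ : R3 →ₗ[ℝ] ℝ} (hℓ : ℓ ≠ 0) :
    Module.finrank ℝ ((LinearMap.ker ℓ).map (E i)) = 2 := by
  rw [← (Submodule.equivMapOfInjective (E i) (h.E_injective i) (LinearMap.ker ℓ)).finrank_eq,
    finrank_ker_functional hℓ]

/-- Where α_i and β_i both vanish, so does the form ψ of the member. The equation of its boundary
arc then reduces on one side to a value of q, on the other to a non-zero multiple of E_i. -/
theorem member_charLine₂ (h : IsCubeFrame X E α β o) (hX : IsSCCube X) (hgen : IsGenericCube X)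
    (i : Fin 3) {t : ℝ} (ht : t ∈ nondegenerateParams (cubeFace E α β o) (i + 1)) :
    Module.finrank ℝ (charLine₂ (cubePoint E α β o (i + 1) t)) = 2 ∧
      ∀ y, α i y = 0 → β i y = 0 → E i y ∈ charLine₂ (cubePoint E α β o (i + 1) t) := by
  obtain ⟨p, q, φ, ψ, hs, he, hα, hβ, -, eB, -, eψ⟩ := h.exists_member hX hgen (i + 1) ht
  rw [hs.charLine₂_eq (rep_of_eq hs he)]
  refine ⟨hs.swap.rank₁, fun y hy hy' => ⟨(α (i + 1) (ver t))⁻¹ • y, ?_⟩⟩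
  have h1 := eψ y
  rw [fin3_one_two, hy, hy'] at h1
  have h2 : ψ y = 0 := by simpa [hβ] using h1
  have h3 := eB y
  rw [h.cubeMap_mid', fin3_one_two, hy', h2] at h3
  rw [map_smul, show q y = α (i + 1) (ver t) • E i y by simpa using h3.symm, smul_smul,
    inv_mul_cancel₀ hα, one_smul]

theorem member_charLine₁ (h : IsCubeFrame X E α β o) (hX : IsSCCube X) (hgen : IsGenericCube X)
    (i : Fin 3) {t : ℝ} (ht : t ∈ nondegenerateParams (cubeFace E α β o) (i + 2)) :
    Module.finrank ℝ (charLine₁ (cubePoint E α β o (i + 2) t)) = 2 ∧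
      ∀ y, α i y = 0 → β i y = 0 → E i y ∈ charLine₁ (cubePoint E α β o (i + 2) t) := by
  obtain ⟨p, q, φ, ψ, hs, he, hα, hβ, eA, -, eφ, -⟩ := h.exists_member hX hgen (i + 2) ht
  rw [hs.charLine₁_eq (rep_of_eq hs he)]
  refine ⟨hs.rank₁, fun y hy hy' => ⟨(β (i + 2) (ver t))⁻¹ • y, ?_⟩⟩
  have h1 := eφ y
  rw [fin3_two_one, hy, hy'] at h1
  have h2 : φ y = 0 := by simpa [hα] using h1
  have h3 := eA y
  rw [h.cubeMap_mid, fin3_two_one, hy, h2] at h3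
  rw [map_smul, show p y = β (i + 2) (ver t) • E i y by simpa using h3.symm, smul_smul,
    inv_mul_cancel₀ hβ, one_smul]

theorem charLine_face (h : IsCubeFrame X E α β o) (hX : IsSCCube X) (hgen : IsGenericCube X)
    (i : Fin 3) (ε : Bool) :
    charLine₁ (X i ε) = charLine₁ (cubePoint E α β o i (side ε)) ∧
      charLine₂ (X i ε) = charLine₂ (cubePoint E α β o i (side ε)) := by
  obtain ⟨p, q, φ, ψ, hs, he⟩ := h.face_rep hX hgen i ε
  rw [hs.std.charLine₁_eq (rep_of_eq hs.std he), hs.std.charLine₂_eq (rep_of_eq hs.std he)]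
  exact ⟨hs.line₁, hs.line₂⟩

/-- On the kernel of its form the equation of the edge takes values in the characteristic line.
Equality follows by counting dimensions. -/
theorem near_charLine₂ (h : IsCubeFrame X E α β o) (i : Fin 3) :
    charLine₂ (X (i + 1) false) = (LinearMap.ker (α i)).map (E i) := by
  obtain ⟨p, q, hs, -, h2⟩ := h.near (i + 1)
  rw [fin3_one_two] at hs h2
  rw [hs.line₂]
  refine (Submodule.eq_of_le_of_finrank_eq ?_ ?_).symm
  · rintro _ ⟨y, hy, rfl⟩
    exact ⟨y, by rw [h2, LinearMap.mem_ker.1 hy, zero_smul, add_zero]⟩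
  · rw [h.finrank_map_ker i hs.std.swap.ne_zero₁, hs.std.swap.rank₁]

theorem near_charLine₁ (h : IsCubeFrame X E α β o) (i : Fin 3) :
    charLine₁ (X (i + 2) false) = (LinearMap.ker (β i)).map (E i) := by
  obtain ⟨p, q, hs, h1, -⟩ := h.near (i + 2)
  rw [fin3_two_one] at hs h1
  rw [hs.line₁]
  refine (Submodule.eq_of_le_of_finrank_eq ?_ ?_).symm
  · rintro _ ⟨y, hy, rfl⟩
    exact ⟨y, by rw [h1, LinearMap.mem_ker.1 hy, zero_smul, add_zero]⟩
  · rw [h.finrank_map_ker i hs.std.ne_zero₁, hs.std.rank₁]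

/-- If the two linear forms of a direction agree, so do the characteristic lines. -/
theorem charLines_eq (h : IsCubeFrame X E α β o) (hX : IsSCCube X) (hgen : IsGenericCube X)
    {i : Fin 3} (hαβ : α i = β i) : ∃ L : Submodule ℝ V4,
      (∀ ε, charLine₂ (X (i + 1) ε) = L) ∧ ∀ δ, charLine₁ (X (i + 2) δ) = L := by
  have hα : α i ≠ 0 := fun h0 => by simpa [h0] using h.α_start i
  refine ⟨(LinearMap.ker (α i)).map (E i), fun ε => ?_, fun δ => ?_⟩
  · obtain ⟨h1, h2⟩ := h.member_charLine₂ hX hgen i (h.side_mem_params hX hgen (i + 1) ε)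
    rw [(h.charLine_face hX hgen (i + 1) ε).2]
    refine (Submodule.eq_of_le_of_finrank_eq ?_ ?_).symm
    · rintro _ ⟨y, hy, rfl⟩
      exact h2 y hy (by rw [← hαβ]; exact hy)
    · rw [h1, h.finrank_map_ker i hα]
  · obtain ⟨h1, h2⟩ := h.member_charLine₁ hX hgen i (h.side_mem_params hX hgen (i + 2) δ)
    rw [(h.charLine_face hX hgen (i + 2) δ).1]
    refine (Submodule.eq_of_le_of_finrank_eq ?_ ?_).symm
    · rintro _ ⟨y, hy, rfl⟩
      exact h2 y hy (by rw [← hαβ]; exact hy)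
    · rw [h1, h.finrank_map_ker i hα]

/-- The point is the image under E_i of the common zero of α_i and β_i. Two of the characteristic
lines of near faces are the images of the two kernels, so a second common point forces the kernels,
and then the forms, to agree. -/
theorem exists_common_point (h : IsCubeFrame X E α β o) (hX : IsSCCube X)
    (hgen : IsGenericCube X) (i : Fin 3) : ∃ q : RP3,
      (∀ t ∈ nondegenerateParams (cubeFace E α β o) (i + 1),
        Module.finrank ℝ (charLine₂ (cubePoint E α β o (i + 1) t)) = 2 ∧
        q.submodule ≤ charLine₂ (cubePoint E α β o (i + 1) t)) ∧
      (∀ t ∈ nondegenerateParams (cubeFace E α β o) (i + 2),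
        Module.finrank ℝ (charLine₁ (cubePoint E α β o (i + 2) t)) = 2 ∧
        q.submodule ≤ charLine₁ (cubePoint E α β o (i + 2) t)) ∧
      ((¬ ∃ L : Submodule ℝ V4,
          (∀ ε, charLine₂ (X (i + 1) ε) = L) ∧ (∀ δ, charLine₁ (X (i + 2) δ) = L)) →
        ∀ q' : RP3,
          (∀ t ∈ nondegenerateParams (cubeFace E α β o) (i + 1),
            q'.submodule ≤ charLine₂ (cubePoint E α β o (i + 1) t)) →
          (∀ t ∈ nondegenerateParams (cubeFace E α β o) (i + 2),
            q'.submodule ≤ charLine₁ (cubePoint E α β o (i + 2) t)) →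
          q' = q) := by
  -- Two linear forms on a three-dimensional space have a common zero.
  obtain ⟨κ, hκ0, hκα, hκβ⟩ : ∃ κ : R3, κ ≠ 0 ∧ α i κ = 0 ∧ β i κ = 0 := by
    by_contra hcon
    push Not at hcon
    have hi : Function.Injective ((α i).prod (β i)) := by
      rw [← LinearMap.ker_eq_bot, LinearMap.ker_eq_bot']
      intro x hx
      by_contra hx0
      exact hcon x hx0 (congrArg Prod.fst hx) (congrArg Prod.snd hx)
    have := LinearMap.finrank_le_finrank_of_injective hi
    simp at this
  have hEκ : E i κ ≠ 0 := fun h0 => hκ0 (h.E_injective i (by rw [h0, map_zero]))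
  have hrep := represents_toPoint hEκ
  refine ⟨toPoint (E i κ), fun t ht => ?_, fun t ht => ?_, fun hL q' h1 h2 => ?_⟩
  · obtain ⟨hr, hm⟩ := h.member_charLine₂ hX hgen i ht
    exact ⟨hr, hrep.submodule_le.2 (hm κ hκα hκβ)⟩
  · obtain ⟨hr, hm⟩ := h.member_charLine₁ hX hgen i ht
    exact ⟨hr, hrep.submodule_le.2 (hm κ hκα hκβ)⟩
  · obtain ⟨v, hv⟩ := exists_represents q'
    have m1 := hv.submodule_le.1 (h1 _ (h.side_mem_params hX hgen (i + 1) false))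
    have m2 := hv.submodule_le.1 (h2 _ (h.side_mem_params hX hgen (i + 2) false))
    rw [← (h.charLine_face hX hgen (i + 1) false).2, h.near_charLine₂] at m1
    rw [← (h.charLine_face hX hgen (i + 2) false).1, h.near_charLine₁] at m2
    obtain ⟨y, hy, rfl⟩ := m1
    obtain ⟨z, hz, hzy⟩ := m2
    obtain rfl := h.E_injective i hzy
    have hne : α i ≠ β i := fun h0 => hL (h.charLines_eq hX hgen h0)
    have hα : α i ≠ 0 := fun h0 => by simpa [h0] using h.α_start i
    have hfin : Module.finrank ℝ (LinearMap.ker (α i) ⊓ LinearMap.ker (β i) : Submodule ℝ R3) ≤ 1 := by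
      by_contra hcon
      have h3 : LinearMap.ker (α i) ⊓ LinearMap.ker (β i) = LinearMap.ker (α i) :=
        Submodule.eq_of_le_of_finrank_le inf_le_left (by rw [finrank_ker_functional hα]; omega)
      have h4 : LinearMap.ker (α i) ≤ LinearMap.ker (β i) := inf_eq_left.1 h3
      -- Forms with the same kernel are proportional, and both have the value 1 at `ver 0`.
      refine hne (LinearMap.ext fun x => ?_)
      have h5 : x - α i x • ver 0 ∈ LinearMap.ker (β i) := h4 (by
        rw [LinearMap.mem_ker, map_sub, map_smul, h.α_start]; simp)
      rw [LinearMap.mem_ker, map_sub, map_smul, h.β_start, smul_eq_mul, mul_one] at h5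
      linarith
    obtain ⟨w, hw⟩ := (finrank_le_one_iff).1 hfin
    obtain ⟨c, hc⟩ := hw ⟨κ, hκα, hκβ⟩
    obtain ⟨d, hd⟩ := hw ⟨z, hy, hz⟩
    have hc' : c • (w : R3) = κ := congrArg Subtype.val hc
    have hd' : d • (w : R3) = z := congrArg Subtype.val hd
    have hc0 : c ≠ 0 := by
      rintro rfl
      exact hκ0 (by rw [← hc', zero_smul])
    have : E i z = (d * c⁻¹) • E i κ := by
      rw [← hc', ← hd', map_smul, map_smul, smul_smul, mul_assoc, inv_mul_cancel₀ hc0, mul_one]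
    exact hv.eq (hrep.of_eq_smul hv.ne_zero this)

/-! ### Closing -/

theorem exists_matching (h : IsCubeFrame X E α β o) (hX : IsSCCube X) (hgen : IsGenericCube X)
    (i : Fin 3) (ε : Bool) : ∃ r₁ r₂ : ℝ → ℝ, IsReparam r₁ ∧ IsReparam r₂ ∧
      ∀ a ∈ UI, ∀ b ∈ UI, X i ε a b = cubeFace E α β o i ε (r₁ a) (r₂ b) := by
  obtain ⟨p, q, φ, ψ, hs, he⟩ := h.face_rep hX hgen i ε
  obtain ⟨r₁, r₂, hr₁, hr₂, hrep⟩ := hs.rep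
  exact ⟨r₁, r₂, hr₁, hr₂, fun a ha b hb => (hrep a ha b hb).eq
    (rep_of_eq hs.std he _ (hr₁.mem_UI ha) _ (hr₂.mem_UI hb))⟩

theorem edge_injective (h : IsCubeFrame X E α β o) (hX : IsSCCube X) (hgen : IsGenericCube X)
    (i : Fin 3) (ε δ : Bool) :
    Set.InjOn (fun t => cubeFace E α β o i ε (side δ) t) UI := by
  obtain ⟨r, r', hr, hr', he⟩ := h.isReparamOf_face hX hgen i ε
  have hinj : Set.InjOn (fun t => X i ε (side δ) t) UI := by
    obtain ⟨W₀, W₁, h0, h1, -⟩ := (hgen.faces i ε).1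
    cases δ
    · exact h0.2.1
    · exact h1.2.1
  intro s hs t ht hst
  have hst' : cubeFace E α β o i ε (side δ) s = cubeFace E α β o i ε (side δ) t := hst
  rw [he _ (side_mem_UI δ) s hs, he _ (side_mem_UI δ) t ht, hr.side] at hst'
  exact hr'.strictMonoOn.injOn hs ht (hinj (hr'.mem_UI hs) (hr'.mem_UI ht) hst')

/-- In the matching parametrization two conics meet on an edge exactly if their parameters are
equal. Three equalities around the cycle imply the fourth. -/
theorem closing (h : IsCubeFrame X E α β o) (hX : IsSCCube X) (hgen : IsGenericCube X)
    (i : Fin 3) (s s' : Bool → ℝ) (hs : ∀ ε, s ε ∈ UI) (hs' : ∀ δ, s' δ ∈ UI) (ε₀ δ₀ : Bool)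
    (hcl : ∀ ε δ, (ε, δ) ≠ (ε₀, δ₀) →
      X (i + 1) ε (side δ) (s ε) = X (i + 2) δ (s' δ) (side ε)) :
    X (i + 1) ε₀ (side δ₀) (s ε₀) = X (i + 2) δ₀ (s' δ₀) (side ε₀) := by
  choose r₁ r₂ hr₁ hr₂ hr using fun ε => h.exists_matching hX hgen (i + 1) ε
  choose k₁ k₂ hk₁ hk₂ hk using fun δ => h.exists_matching hX hgen (i + 2) δ
  have key : ∀ ε δ, X (i + 1) ε (side δ) (s ε) = X (i + 2) δ (s' δ) (side ε) ↔
      r₂ ε (s ε) = k₁ δ (s' δ) := by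
    intro ε δ
    rw [hr ε _ (side_mem_UI δ) _ (hs ε), hk δ _ (hs' δ) _ (side_mem_UI ε), (hr₁ ε).side,
      (hk₂ δ).side, ← face_edge]
    exact (h.edge_injective hX hgen (i + 1) ε δ).eq_iff ((hr₂ ε).mem_UI (hs ε))
      ((hk₁ δ).mem_UI (hs' δ))
  have e1 := (key ε₀ !δ₀).1 (hcl _ _ (by simp))
  have e2 := (key (!ε₀) !δ₀).1 (hcl _ _ (by simp))
  have e3 := (key (!ε₀) δ₀).1 (hcl _ _ (by simp))
  rw [key, e1, ← e2, e3]

/-- Two members of a family are fundamental transforms of each other. -/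
theorem isFundamentalTransform_members (h : IsCubeFrame X E α β o) (hX : IsSCCube X)
    (hgen : IsGenericCube X) (i : Fin 3) {s t : ℝ}
    (hs : s ∈ nondegenerateParams (cubeFace E α β o) i)
    (ht : t ∈ nondegenerateParams (cubeFace E α β o) i) :
    IsFundamentalTransform (cubePoint E α β o i s) (cubePoint E α β o i t) := by
  obtain ⟨p, q, φ, ψ, hstd, he, -⟩ := h.exists_member hX hgen i hs
  obtain ⟨p', q', φ', ψ', hstd', he', -⟩ := h.exists_member hX hgen i ht
  exact h.isFundamentalTransform i hstd he hstd' he'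

end IsCubeFrame

/-! ### The theorem on generic SC-cubes -/

theorem mainTheorem6 (X : Fin 3 → Bool → ℝ → ℝ → RP3)
    (hX : IsSCCube X) (hgen : IsGenericCube X) :
    -- characteristic conics around the cube close up
    (∀ (i : Fin 3) (s s' : Bool → ℝ), (∀ ε, s ε ∈ UI) → (∀ δ, s' δ ∈ UI) →
      ∀ ε₀ δ₀ : Bool,
        (∀ ε δ, (ε, δ) ≠ (ε₀, δ₀) →
          X (i + 1) ε (side δ) (s ε) = X (i + 2) δ (s' δ) (side ε)) →
        X (i + 1) ε₀ (side δ₀) (s ε₀) = X (i + 2) δ₀ (s' δ₀) (side ε₀)) ∧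
    -- common net parameters `Y` on the six faces, and the three families `Φ i`
    ∃ (Y : Fin 3 → Bool → ℝ → ℝ → RP3) (Φ : Fin 3 → ℝ → ℝ → ℝ → RP3),
      (∀ i ε, IsReparamOf (Y i ε) (X i ε)) ∧
      (∀ i ε δ, ∀ t ∈ UI, Y (i + 1) ε (side δ) t = Y (i + 2) δ t (side ε)) ∧
      -- the families interpolate between opposite faces, smoothly
      (∀ i ε, side ε ∈ nondegenerateParams Y i ∧
        ∀ a ∈ UI, ∀ b ∈ UI, Φ i (side ε) a b = Y i ε a b) ∧
      (∀ i, ∃ G : ℝ → ℝ → ℝ → V4,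
        ContDiff ℝ ∞ (fun p : ℝ × ℝ × ℝ => G p.1 p.2.1 p.2.2) ∧
        ∀ t ∈ nondegenerateParams Y i, ∀ a ∈ UI, ∀ b ∈ UI,
          Represents (G t a b) (Φ i t a b)) ∧
      -- their members are generic SC-patches, bounded by the closed quadrilaterals of conics,
      -- and they are determined by their boundary
      (∀ i, ∀ t ∈ nondegenerateParams Y i,
        IsSCPatch (Φ i t) ∧ IsGenericPatch (Φ i t) ∧
        (∀ ε, ∀ b ∈ UI, Φ i t (side ε) b = Y (i + 1) ε b t) ∧
        (∀ δ, ∀ a ∈ UI, Φ i t a (side δ) = Y (i + 2) δ t a) ∧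
        ∀ g, IsSCPatch g → SameBoundary g (Φ i t) → IsReparamOf g (Φ i t)) ∧
      -- (i) the characteristic lines of direction `i` pass through one point
      (∀ i, ∃ q : RP3,
        (∀ t ∈ nondegenerateParams Y (i + 1),
          Module.finrank ℝ (charLine₂ (Φ (i + 1) t)) = 2 ∧
          q.submodule ≤ charLine₂ (Φ (i + 1) t)) ∧
        (∀ t ∈ nondegenerateParams Y (i + 2),
          Module.finrank ℝ (charLine₁ (Φ (i + 2) t)) = 2 ∧
          q.submodule ≤ charLine₁ (Φ (i + 2) t)) ∧
        ((¬ ∃ L : Submodule ℝ V4,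
            (∀ ε, charLine₂ (X (i + 1) ε) = L) ∧ (∀ δ, charLine₁ (X (i + 2) δ) = L)) →
          ∀ q' : RP3,
            (∀ t ∈ nondegenerateParams Y (i + 1),
              q'.submodule ≤ charLine₂ (Φ (i + 1) t)) →
            (∀ t ∈ nondegenerateParams Y (i + 2),
              q'.submodule ≤ charLine₁ (Φ (i + 2) t)) →
            q' = q)) ∧
      -- (ii) members of different families share a characteristic conic
      (∀ i, ∀ s ∈ nondegenerateParams Y i, ∀ t ∈ nondegenerateParams Y (i + 1),
        ∀ b ∈ UI, Φ i s t b = Φ (i + 1) t b s) ∧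
      -- (iii) members of the same family are fundamental transforms of each other
      (∀ i, ∀ s ∈ nondegenerateParams Y i, ∀ t ∈ nondegenerateParams Y i,
        IsFundamentalTransform (Φ i s) (Φ i t)) ∧
      (∀ i, IsFundamentalTransform (Y i false) (Y i true)) := by
  obtain ⟨E, α, β, o, h⟩ := hX.exists_frame hgen
  refine ⟨fun i s s' hs hs' ε₀ δ₀ hcl => h.closing hX hgen i s s' hs hs' ε₀ δ₀ hcl,
    cubeFace E α β o, cubePoint E α β o, h.isReparamOf_face hX hgen,
    fun i ε δ t _ => IsCubeFrame.face_edge i ε δ t,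
    fun i ε => ⟨h.side_mem_params hX hgen i ε, fun _ _ _ _ => rfl⟩,
    fun i => ⟨fun t a b => cubeMap E α β o i (ver t) (ver a) (ver b),
      contDiff_cubeMap E α β o i, fun t ht a ha b hb => ?_⟩,
    fun i t ht => ?_, h.exists_common_point hX hgen,
    fun i s _ t _ b _ => (cubePoint_rot E α β o i s t b).symm,
    fun i s hs t ht => h.isFundamentalTransform_members hX hgen i hs ht,
    fun i => h.isFundamentalTransform_members hX hgen i (h.side_mem_params hX hgen i false)
      (h.side_mem_params hX hgen i true)⟩
  · obtain ⟨p, q, φ, ψ, hs, he, -⟩ := h.exists_member hX hgen i ht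
    beta_reduce
    rw [he]
    exact IsCubeFrame.rep_of_eq hs he a ha b hb
  · obtain ⟨p, q, φ, ψ, hs, he, -⟩ := h.exists_member hX hgen i ht
    have hf := IsCubeFrame.rep_of_eq hs he
    exact ⟨hs.isSCPatch hf, hs.isGenericPatch hf,
      fun ε b _ => (cubePoint_rot E α β o i t (side ε) b).symm,
      fun δ a _ => (cubePoint_rot' E α β o i t a (side δ)).symm,
      fun g hg hb => hs.isReparamOf hf hg hb⟩
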